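/- Let $W\in C^3(\mathbb R)$ with $W''>0$, and let $u\in C^3([0,1]\times[0,T])$, $T>0$, solve $$\frac{u_t}{\sqrt{1+u_x^2}}=W''(u_x)\,u_{xx}\ \text{ on }[0,1]\times[0,T],\qquad u_x(0,t)=a,\quad u_x(1,t)=b,$$ with constants $a,b$. Let $S\subset\mathbb R$ be a set of admissible slopes (the abscissae of the corners of the piecewise linear energy that agrees with $W$ at its corners). Two distinct elements of $S$ are called adjacent if no element of $S$ lies strictly between them. **Scheme.** The discrete solution $u^m(x,t)$ is continuous on $[0,1]\times[0,T]$. The interval $[0,T]$ is divided by finitely many times into phases. In each phase $u^m(\cdot,t)$ is piecewise linear with a fixed number $N$ of faces, numbered from left to right, with corners $0=x_0(t)<x_1(t)<\dots<x_N(t)=1$ and constant slopes $s_1,\dots,s_N\in S$, where $s_i\ne s_{i+1}$, $s_1=a$ and $s_N=b$. One extends the slopes by $s_0,s_{N+1}$ such that $s_0,s_1$ are adjacent, $s_N,s_{N+1}$ are adjacent, $s_1$ lies strictly between $s_0$ and $s_2$, and $s_N$ lies strictly between $s_{N-1}$ and $s_{N+1}$. With $l_i=x_i-x_{i-1}$,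 face $i$ moves vertically with velocity $$(u^m_t)_i=\sqrt{1+s_i^2}\;\frac{\Delta_i}{l_i}\,r_i,\qquad \Delta_i=\frac{W(s_{i+1})-W(s_i)}{s_{i+1}-s_i}-\frac{W(s_i)-W(s_{i-1})}{s_i-s_{i-1}},$$ $$r_1=\frac{s_2-s_1}{s_2-s_0},\qquad r_N=\frac{s_N-s_{N-1}}{s_{N+1}-s_{N-1}},\qquad r_i=1\ (1<i<N),$$ so that the corners satisfy $\dot x_i=-\dfrac{(u^m_t)_{i+1}-(u^m_t)_i}{s_{i+1}-s_i}$ for $1\le i\le N-1$. If $N=1$ (possible only if $a=b$), the single face does not move. When faces disappear, the faces of the limiting profile are renumbered and the next phase starts from that profile. At time $0$ all consecutive slopes $s_i,s_{i+1}$, $0\le i\le N$, are adjacent. Let $m>0$ and let $c$ be a constant. Assume that initially $|s_i-s_{i-1}|\le m$ for $1\le i\le N+1$ and that the number of faces of $u^m(\cdot,0)$ is $N\le c/m$. Write $\langle g\rangle=\int_0^1 g\,dx$. 1. For every $R$ there is a constant $C$ depending only on $W$, $c$ and $R$ such that, if $\max_{1\le i\le N}|s_i|\le R$ initially, then in the interior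 of each phase $\langle u-u^m\rangle$ is differentiable in time and $$\Bigl|\frac{d}{dt}\langle u-u^m\rangle\Bigr|\le C\,m .$$ 2. Let $c_0$ be a constant. There is a constant $C_T$, depending on $W,u,T,c,c_0$ but not on $m$, $S$ or $u^m$, such that, if in addition $\|u^m_x(\cdot,0)-u_x(\cdot,0)\|_{L^\infty}\le m$ and $|\langle u(\cdot,0)-u^m(\cdot,0)\rangle|\le c_0\,m^{1/2}$, then $$\sup_{0\le t\le T}\|u-u^m\|_{H^1([0,1])}\le C_T\,m^{1/2}.$$ -/

import Mathlib

open Set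

noncomputable section

/-! ## The continuous problem -/

/-- `u_x(x,t)` for a function on `[0,1] × [0,T]` (one-sided at the end points). -/
def spaceDeriv (u : ℝ → ℝ → ℝ) (x t : ℝ) : ℝ :=
  derivWithin (fun y => u y t) (Icc 0 1) x

/-- `u_xx(x,t)` for a function on `[0,1] × [0,T]`. -/
def spaceDeriv2 (u : ℝ → ℝ → ℝ) (x t : ℝ) : ℝ :=
  derivWithin (fun y => spaceDeriv u y t) (Icc 0 1) x

/-- `u_t(x,t)` for a function on `[0,1] × [0,T]`. -/
def timeDeriv (T : ℝ) (u : ℝ → ℝ → ℝ) (x t : ℝ) : ℝ :=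
  derivWithin (fun r => u x r) (Icc 0 T) t

/-- `u` is a `C³` solution on the closed rectangle `[0,1] × [0,T]` of
`u_t / √(1 + u_x²) = W''(u_x) u_xx` with `u_x(0,t) = a` and `u_x(1,t) = b`. -/
structure IsNeumannSolution (W : ℝ → ℝ) (a b T : ℝ) (u : ℝ → ℝ → ℝ) : Prop where
  contDiffOn : ContDiffOn ℝ 3 (fun p : ℝ × ℝ => u p.1 p.2) (Icc 0 1 ×ˢ Icc 0 T)
  equation : ∀ x ∈ Icc (0 : ℝ) 1, ∀ t ∈ Icc (0 : ℝ) T,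
    timeDeriv T u x t / √(1 + spaceDeriv u x t ^ 2)
      = deriv (deriv W) (spaceDeriv u x t) * spaceDeriv2 u x t
  left_slope : ∀ t ∈ Icc (0 : ℝ) T, spaceDeriv u 0 t = a
  right_slope : ∀ t ∈ Icc (0 : ℝ) T, spaceDeriv u 1 t = b

/-- The `H¹([0,1])` norm of a Lipschitz (e.g. continuous and piecewise `C¹`) function; its weak
derivative is the classical derivative, which exists almost everywhere. -/
def h1Norm (f : ℝ → ℝ) : ℝ :=
  √((∫ x in (0 : ℝ)..1, f x ^ 2) + ∫ x in (0 : ℝ)..1, derivWithin f (Icc 0 1) x ^ 2)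

/-! ## The crystalline scheme

`S` is the set of admissible slopes: the abscissae of the corners of the piecewise linear energy
density that coincides with `W` at these corners. Faces are numbered `1, …, N` from left to right;
face `i` has slope `s i` and occupies `[x (i-1) t, x i t]`. The slopes `s 0` and `s (N+1)`
are those of the extension of the discrete solution beyond the two end points. -/

/-- `p` and `q` are the abscissae of adjacent corners. -/
def AdjacentSlopes (S : Set ℝ) (p q : ℝ) : Prop :=
  p ∈ S ∧ q ∈ S ∧ p ≠ q ∧ ∀ z ∈ S, z ∉ Ioo (min p q) (max p q)

/-- `q` lies strictly between `p` and `r`. -/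
def LiesBetween (p q r : ℝ) : Prop := (p < q ∧ q < r) ∨ (r < q ∧ q < p)

/-- `Δ_i`, the jump at face `i` of the difference quotients of `W`. -/
def slopeJump (W : ℝ → ℝ) (s : ℕ → ℝ) (i : ℕ) : ℝ :=
  (W (s (i + 1)) - W (s i)) / (s (i + 1) - s i)
    - (W (s i) - W (s (i - 1))) / (s i - s (i - 1))

/-- The ratios `r_i`: `r_1` and `r_N` are the lengths of the end faces divided by the lengths of
the end faces of the extension, and `r_i = 1` at interior faces. -/
def faceRatio (N : ℕ) (s : ℕ → ℝ) (i : ℕ) : ℝ :=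
  if i = 1 then (s 2 - s 1) / (s 2 - s 0)
  else if i = N then (s N - s (N - 1)) / (s (N + 1) - s (N - 1))
  else 1

/-- `(u_t^m)_i = √(1 + s_i²) (Δ_i / l_i) r_i`, the vertical velocity of face `i`, where
`l_i = x_i - x_{i-1}`. If there is only one face (possible only if `a = b`), it spans `[0,1]`,
the crystalline energy does not depend on its height, and it does not move. -/
def faceVelocity (W : ℝ → ℝ) (N : ℕ) (s : ℕ → ℝ) (x : ℕ → ℝ → ℝ) (t : ℝ) (i : ℕ) : ℝ :=
  if N = 1 then 0
  else √(1 + s i ^ 2) * (slopeJump W s i / (x i t - x (i - 1) t)) * faceRatio N s i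

/-- The discrete evolution of `v` on a time interval `[t₀, t₁)` during which no face disappears.
On face `i` the function is `y ↦ s i * y + p i t`. -/
structure IsNeumannPhase (W : ℝ → ℝ) (S : Set ℝ) (a b t₀ t₁ : ℝ) (v : ℝ → ℝ → ℝ)
    (N : ℕ) (s : ℕ → ℝ) (x p : ℕ → ℝ → ℝ) : Prop where
  one_le : 1 ≤ N
  /-- All faces have admissible slopes, and consecutive ones are different. -/
  admissible : ∀ i ∈ Icc 1 N, s i ∈ S
  slope_ne : ∀ i ∈ Ico 1 N, s i ≠ s (i + 1)
  /-- The Neumann conditions. -/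
  first_slope : s 1 = a
  last_slope : s N = b
  /-- The extension beyond the end points. -/
  ext_left : AdjacentSlopes S (s 0) (s 1)
  ext_left_between : LiesBetween (s 0) (s 1) (s 2)
  ext_right : AdjacentSlopes S (s N) (s (N + 1))
  ext_right_between : LiesBetween (s (N - 1)) (s N) (s (N + 1))
  /-- The corners are ordered: all faces have positive length. -/
  x_zero : ∀ t ∈ Ico t₀ t₁, x 0 t = 0
  x_last : ∀ t ∈ Ico t₀ t₁, x N t = 1
  x_lt : ∀ t ∈ Ico t₀ t₁, ∀ i ∈ Icc 1 N, x (i - 1) t < x i t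
  x_cont : ∀ i ≤ N, ContinuousOn (x i) (Ico t₀ t₁)
  p_cont : ∀ i ∈ Icc 1 N, ContinuousOn (p i) (Ico t₀ t₁)
  profile : ∀ t ∈ Ico t₀ t₁, ∀ i ∈ Icc 1 N, ∀ y ∈ Icc (x (i - 1) t) (x i t),
    v y t = s i * y + p i t
  /-- Face `i` moves vertically with velocity `(u_t^m)_i`. -/
  face_motion : ∀ t ∈ Ioo t₀ t₁, ∀ i ∈ Icc 1 N,
    HasDerivAt (p i) (faceVelocity W N s x t i) t
  /-- The equations of motion of the corners, i.e. of the lengths `x i t - x (i-1) t`. -/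
  corner_motion : ∀ t ∈ Ioo t₀ t₁, ∀ i ∈ Ico 1 N,
    HasDerivAt (x i)
      (-((faceVelocity W N s x t (i + 1) - faceVelocity W N s x t i) / (s (i + 1) - s i))) t

/-- A solution on `[0,T]` of the discretized Neumann problem. Faces disappear at finitely many
times at most; at such a time the profile is the limit of the preceding profiles
(`toFun` is continuous), a new phase starts from it, and the faces are renumbered. -/
structure NeumannCrystallineFlow (W : ℝ → ℝ) (S : Set ℝ) (a b T : ℝ) where
  /-- The discrete solution `u^m(x,t)`. -/
  toFun : ℝ → ℝ → ℝ
  continuousOn : ContinuousOn (fun q : ℝ × ℝ => toFun q.1 q.2) (Icc 0 1 ×ˢ Icc 0 T)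
  /-- The number of phases; phase `k < numPhases` is the time interval `[τ k, τ (k+1))`. -/
  numPhases : ℕ
  τ : ℕ → ℝ
  τ_zero : τ 0 = 0
  τ_last : τ numPhases = T
  τ_lt : ∀ k < numPhases, τ k < τ (k + 1)
  /-- Number of faces, slopes, corners and intercepts in phase `k`. -/
  N : ℕ → ℕ
  s : ℕ → ℕ → ℝ
  x : ℕ → ℕ → ℝ → ℝ
  p : ℕ → ℕ → ℝ → ℝ
  phase : ∀ k < numPhases,
    IsNeumannPhase W S a b (τ k) (τ (k + 1)) toFun (N k) (s k) (x k) (p k)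
  /-- Initially, jumps in the slope (extension included) correspond to adjacent corners. -/
  initial_adjacent : ∀ i ≤ N 0, AdjacentSlopes S (s 0 i) (s 0 (i + 1))

namespace NeumannCrystallineFlow

variable {W : ℝ → ℝ} {S : Set ℝ} {a b T : ℝ}

/-- Consecutive slopes of the initial data (extension included) differ by at most `m`:
`|s_i - s_{i-1}| ≤ m` for `1 ≤ i ≤ N + 1`. -/
def InitialJumpsLE (U : NeumannCrystallineFlow W S a b T) (m : ℝ) : Prop :=
  ∀ i ∈ Icc 1 (U.N 0 + 1), |U.s 0 i - U.s 0 (i - 1)| ≤ m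

/-- `‖(u₀^m)_x - (u₀)_x‖_∞ ≤ m`, where `u₀ = u(·,0)`. -/
def InitialSlopesClose (U : NeumannCrystallineFlow W S a b T) (u : ℝ → ℝ → ℝ) (m : ℝ) : Prop :=
  ∀ i ∈ Icc 1 (U.N 0), ∀ y ∈ Ioo (U.x 0 (i - 1) 0) (U.x 0 i 0),
    |U.s 0 i - spaceDeriv u y 0| ≤ m

/-- `⟨u - u^m⟩`, the mean over `[0,1]` of the error at time `t`. -/
def meanError (U : NeumannCrystallineFlow W S a b T) (u : ℝ → ℝ → ℝ) (t : ℝ) : ℝ :=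
  ∫ y in (0 : ℝ)..1, (u y t - U.toFun y t)

end NeumannCrystallineFlow

end

/-! The slope error obeys an energy inequality of Grönwall type, the mean error is controlled by a
discrete conservation law, and a Poincaré inequality combines the two into an `H¹` bound.

Slopes. On a face of length `l`, spread the jump of the slope over the face as a discrete curvature
`κ = halfJump / l`. A second order mean value theorem (`exists_dividedDifference_eq`) shows that the
face moves with velocity `G κ`, where `G` is within `O(m)` of the mobility at the slope of the face;
the factors `r_1`, `r_N` amount to even reflection at the end points. Thus the scheme has the form
of the equation `u_t = g u_xx`. Integration by parts and the law of motion of the corners give an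
exact formula for the derivative of `‖u_x - u^m_x‖²` (`hasDerivAt_slopeError`). Up to `O(m)`, half
of this derivative is the integral of `-(u_xx - κ)(g u_xx - G κ)`. Completing the square bounds the
integrand by a multiple of `(g - G)²`, hence of `(u_x - u^m_x)² + m²` (`dissipation_pointwise`,
`faceDissipation_le`). Grönwall then yields `‖u_x - u^m_x‖² = O(m)`. The order `m`, rather than
`m²`, comes from replacing the corner values of `u_t` by face averages.

Means. The mean of `u` changes at the rate `flux b - flux a`, that of `u^m` at the rate of the total
force. The forces approximate the increments of the flux between successive averaged corner slopes
up to `O(m²)` each, and there are at most `c / m` faces (`abs_sum_force_sub_le`,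
`hasDerivAt_meanError`).

Transitions. All this needs adjacent consecutive slopes with jumps at most `m` in every phase. A
face with monotone neighbouring slopes cannot shrink to a point: its velocity would blow up with the
sign that lengthens it, while the velocities at both ends of the monotone run of slopes around it
stay bounded in the relevant direction (`not_collapse_of_increasing`). So vanishing faces have zero
curvature, slopes in a vanishing group alternate between two values, and each pair of consecutive
slopes after a transition was already consecutive before it (`exists_index_of_next`). `isControlled`
propagates this to all phases, and continuity at transition times lets the estimates be chained. -/

noncomputable section

/-! ## Regularity of solutions on the closed rectangle -/

/-- The rectangle `[0,1] × [0,T]`. -/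
def rect (T : ℝ) : Set (ℝ × ℝ) := Icc 0 1 ×ˢ Icc 0 T

lemma uniqueDiffOn_rect {T : ℝ} (hT : 0 < T) : UniqueDiffOn ℝ (rect T) :=
  (uniqueDiffOn_Icc one_pos).prod (uniqueDiffOn_Icc hT)

lemma closure_interior_rect {T : ℝ} (hT : 0 < T) : closure (interior (rect T)) = rect T := by
  rw [rect, interior_prod_eq, interior_Icc, interior_Icc, closure_prod_eq,
    closure_Ioo one_pos.ne, closure_Ioo hT.ne]

lemma HasFDerivWithinAt.slice_left {T : ℝ} {g : ℝ × ℝ → ℝ} {g' : ℝ × ℝ →L[ℝ] ℝ} {x t : ℝ}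
    (hg : HasFDerivWithinAt g g' (rect T) (x, t)) (ht : t ∈ Icc 0 T) :
    HasDerivWithinAt (fun y => g (y, t)) (g' (1, 0)) (Icc 0 1) x := by
  have h : HasDerivWithinAt (fun y : ℝ => (y, t)) ((1 : ℝ), (0 : ℝ)) (Icc 0 1) x :=
    (hasDerivWithinAt_id x _).prodMk (hasDerivWithinAt_const x _ t)
  exact hg.comp_hasDerivWithinAt x h (show MapsTo _ _ _ from fun y hy => mk_mem_prod hy ht)

lemma HasFDerivWithinAt.slice_right {T : ℝ} {g : ℝ × ℝ → ℝ} {g' : ℝ × ℝ →L[ℝ] ℝ} {x t : ℝ}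
    (hg : HasFDerivWithinAt g g' (rect T) (x, t)) (hx : x ∈ Icc (0 : ℝ) 1) :
    HasDerivWithinAt (fun r => g (x, r)) (g' (0, 1)) (Icc 0 T) t := by
  have h : HasDerivWithinAt (fun r : ℝ => (x, r)) ((0 : ℝ), (1 : ℝ)) (Icc 0 T) t :=
    (hasDerivWithinAt_const t _ x).prodMk (hasDerivWithinAt_id t _)
  exact hg.comp_hasDerivWithinAt t h (show MapsTo _ _ _ from fun y hy => mk_mem_prod hx hy)

/-- The derivative within the rectangle of `g` in direction `e`. -/
def dirDeriv (T : ℝ) (g : ℝ × ℝ → ℝ) (e q : ℝ × ℝ) : ℝ := fderivWithin ℝ g (rect T) q e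

lemma contDiffOn_dirDeriv {T : ℝ} (hT : 0 < T) {g : ℝ × ℝ → ℝ} {n m : WithTop ℕ∞}
    (hg : ContDiffOn ℝ n g (rect T)) (hmn : m + 1 ≤ n) (e : ℝ × ℝ) :
    ContDiffOn ℝ m (dirDeriv T g e) (rect T) :=
  (hg.fderivWithin (uniqueDiffOn_rect hT) hmn).clm_apply contDiffOn_const

/-- Symmetry of the second derivative extends to the boundary because the rectangle is the closure
of its interior. -/
lemma dirDeriv_comm {T : ℝ} (hT : 0 < T) {g : ℝ × ℝ → ℝ}
    (hg : ContDiffOn ℝ 2 g (rect T)) (e f : ℝ × ℝ) {q : ℝ × ℝ} (hq : q ∈ rect T) :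
    dirDeriv T (dirDeriv T g e) f q = dirDeriv T (dirDeriv T g f) e q := by
  have hs : IsSymmSndFDerivWithinAt ℝ g (rect T) q :=
    (hg q hq).isSymmSndFDerivWithinAt (by simp) (uniqueDiffOn_rect hT)
      (by rw [closure_interior_rect hT]; exact hq) hq
  have key : ∀ e f : ℝ × ℝ, dirDeriv T (dirDeriv T g e) f q
      = fderivWithin ℝ (fderivWithin ℝ g (rect T)) (rect T) q f e := by
    intro e f
    have hd : DifferentiableWithinAt ℝ (fderivWithin ℝ g (rect T)) (rect T) q :=
      (hg.fderivWithin (m := 1) (uniqueDiffOn_rect hT) (by norm_num)).differentiableOn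
        (by norm_num) q hq
    have := (hd.hasFDerivWithinAt.clm_apply
      (hasFDerivWithinAt_const e q (rect T))).fderivWithin (uniqueDiffOn_rect hT q hq)
    unfold dirDeriv
    rw [this]
    simp
  rw [key, key]
  exact hs f e

/-- The mixed derivative `u_xt`. -/
def mixedDeriv (T : ℝ) (u : ℝ → ℝ → ℝ) (x t : ℝ) : ℝ :=
  dirDeriv T (dirDeriv T (fun p : ℝ × ℝ => u p.1 p.2) (1, 0)) (0, 1) (x, t)

/-- The regularity of a `C³` function on `[0,1] × [0,T]` that is used below, in terms of its
partial derivatives. -/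
structure IsRegularOnRect (T : ℝ) (u : ℝ → ℝ → ℝ) : Prop where
  cont : ContinuousOn (fun q : ℝ × ℝ => u q.1 q.2) (rect T)
  cont_x : ContinuousOn (fun q : ℝ × ℝ => spaceDeriv u q.1 q.2) (rect T)
  cont_xx : ContinuousOn (fun q : ℝ × ℝ => spaceDeriv2 u q.1 q.2) (rect T)
  cont_t : ContinuousOn (fun q : ℝ × ℝ => timeDeriv T u q.1 q.2) (rect T)
  cont_xt : ContinuousOn (fun q : ℝ × ℝ => mixedDeriv T u q.1 q.2) (rect T)
  deriv_x : ∀ x ∈ Ioo (0 : ℝ) 1, ∀ t ∈ Icc 0 T,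
    HasDerivAt (fun y => u y t) (spaceDeriv u x t) x
  deriv_xx : ∀ x ∈ Ioo (0 : ℝ) 1, ∀ t ∈ Icc 0 T,
    HasDerivAt (fun y => spaceDeriv u y t) (spaceDeriv2 u x t) x
  deriv_tx : ∀ x ∈ Ioo (0 : ℝ) 1, ∀ t ∈ Icc 0 T,
    HasDerivAt (fun y => timeDeriv T u y t) (mixedDeriv T u x t) x
  deriv_t : ∀ x ∈ Icc (0 : ℝ) 1, ∀ t ∈ Ioo 0 T,
    HasDerivAt (fun r => u x r) (timeDeriv T u x t) t
  deriv_xt : ∀ x ∈ Icc (0 : ℝ) 1, ∀ t ∈ Ioo 0 T,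
    HasDerivAt (fun r => spaceDeriv u x r) (mixedDeriv T u x t) t
  deriv_curve : ∀ (ξ : ℝ → ℝ) (z t : ℝ), t ∈ Ioo 0 T → ξ t ∈ Ioo (0 : ℝ) 1 →
    HasDerivAt ξ z t →
    HasDerivAt (fun r => u (ξ r) r) (spaceDeriv u (ξ t) t * z + timeDeriv T u (ξ t) t) t

/-- One-variable derivatives are the Fréchet derivative within the rectangle applied to a coordinate
direction, so they inherit its smoothness. Since `mixedDeriv` is by construction the time derivative
of `u_x`, only `deriv_tx` needs the symmetry in `dirDeriv_comm`. -/
lemma ContDiffOn.isRegularOnRect {T : ℝ} (hT : 0 < T) {u : ℝ → ℝ → ℝ}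
    (hu : ContDiffOn ℝ 3 (fun p : ℝ × ℝ => u p.1 p.2) (Icc 0 1 ×ˢ Icc 0 T)) :
    IsRegularOnRect T u := by
  set f : ℝ × ℝ → ℝ := fun p => u p.1 p.2 with hf
  change ContDiffOn ℝ 3 f (rect T) at hu
  set fx := dirDeriv T f (1, 0) with hfx
  set ft := dirDeriv T f (0, 1) with hft
  have cfx : ContDiffOn ℝ 2 fx (rect T) := contDiffOn_dirDeriv hT hu (by norm_num) _
  have cft : ContDiffOn ℝ 2 ft (rect T) := contDiffOn_dirDeriv hT hu (by norm_num) _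
  have cfxx : ContDiffOn ℝ 1 (dirDeriv T fx (1, 0)) (rect T) :=
    contDiffOn_dirDeriv hT cfx (by norm_num) _
  have cfxt : ContDiffOn ℝ 1 (dirDeriv T fx (0, 1)) (rect T) :=
    contDiffOn_dirDeriv hT cfx (by norm_num) _
  have slx : ∀ {g : ℝ × ℝ → ℝ} {n : WithTop ℕ∞}, ContDiffOn ℝ n g (rect T) → n ≠ 0 →
      ∀ x ∈ Icc (0 : ℝ) 1, ∀ t ∈ Icc 0 T,
      HasDerivWithinAt (fun y => g (y, t)) (dirDeriv T g (1, 0) (x, t)) (Icc 0 1) x := by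
    intro g n hg hn x hx t ht
    exact ((hg.differentiableOn hn) (x, t) ⟨hx, ht⟩).hasFDerivWithinAt.slice_left ht
  have slt : ∀ {g : ℝ × ℝ → ℝ} {n : WithTop ℕ∞}, ContDiffOn ℝ n g (rect T) → n ≠ 0 →
      ∀ x ∈ Icc (0 : ℝ) 1, ∀ t ∈ Icc 0 T,
      HasDerivWithinAt (fun r => g (x, r)) (dirDeriv T g (0, 1) (x, t)) (Icc 0 T) t := by
    intro g n hg hn x hx t ht
    exact ((hg.differentiableOn hn) (x, t) ⟨hx, ht⟩).hasFDerivWithinAt.slice_right hx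
  have ex : ∀ x ∈ Icc (0 : ℝ) 1, ∀ t ∈ Icc 0 T, spaceDeriv u x t = fx (x, t) :=
    fun x hx t ht => (slx hu (by norm_num) x hx t ht).derivWithin (uniqueDiffOn_Icc one_pos x hx)
  have et : ∀ x ∈ Icc (0 : ℝ) 1, ∀ t ∈ Icc 0 T, timeDeriv T u x t = ft (x, t) :=
    fun x hx t ht => (slt hu (by norm_num) x hx t ht).derivWithin (uniqueDiffOn_Icc hT t ht)
  have hxx : ∀ x ∈ Icc (0 : ℝ) 1, ∀ t ∈ Icc 0 T,
      HasDerivWithinAt (fun y => spaceDeriv u y t) (dirDeriv T fx (1, 0) (x, t)) (Icc 0 1) x :=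
    fun x hx t ht => (slx cfx (by norm_num) x hx t ht).congr (fun y hy => ex y hy t ht)
      (ex x hx t ht)
  have exx : ∀ x ∈ Icc (0 : ℝ) 1, ∀ t ∈ Icc 0 T,
      spaceDeriv2 u x t = dirDeriv T fx (1, 0) (x, t) :=
    fun x hx t ht => (hxx x hx t ht).derivWithin (uniqueDiffOn_Icc one_pos x hx)
  refine ⟨hu.continuousOn, cfx.continuousOn.congr fun q hq => ex q.1 hq.1 q.2 hq.2,
    cfxx.continuousOn.congr fun q hq => exx q.1 hq.1 q.2 hq.2,
    cft.continuousOn.congr fun q hq => et q.1 hq.1 q.2 hq.2, cfxt.continuousOn,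
    ?_, ?_, ?_, ?_, ?_, ?_⟩
  · intro x hx t ht
    have hx' := Ioo_subset_Icc_self hx
    rw [ex x hx' t ht]
    exact (slx hu (by norm_num) x hx' t ht).hasDerivAt (Icc_mem_nhds hx.1 hx.2)
  · intro x hx t ht
    have hx' := Ioo_subset_Icc_self hx
    rw [exx x hx' t ht]
    exact (hxx x hx' t ht).hasDerivAt (Icc_mem_nhds hx.1 hx.2)
  · intro x hx t ht
    have hx' := Ioo_subset_Icc_self hx
    have e := dirDeriv_comm hT (hu.of_le (by norm_num)) (1, 0) (0, 1)
      (q := (x, t)) ⟨hx', ht⟩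
    have := (slx cft (by norm_num) x hx' t ht).congr (fun y hy => et y hy t ht) (et x hx' t ht)
    rw [mixedDeriv, e]
    exact this.hasDerivAt (Icc_mem_nhds hx.1 hx.2)
  · intro x hx t ht
    have ht' := Ioo_subset_Icc_self ht
    rw [et x hx t ht']
    exact (slt hu (by norm_num) x hx t ht').hasDerivAt (Icc_mem_nhds ht.1 ht.2)
  · intro x hx t ht
    have ht' := Ioo_subset_Icc_self ht
    have := (slt cfx (by norm_num) x hx t ht').congr (fun y hy => ex x hx y hy) (ex x hx t ht')
    exact this.hasDerivAt (Icc_mem_nhds ht.1 ht.2)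
  · intro ξ z t ht hξ hd
    have ht' := Ioo_subset_Icc_self ht
    have hξ' := Ioo_subset_Icc_self hξ
    have hn : rect T ∈ nhds (ξ t, t) :=
      prod_mem_nhds (Icc_mem_nhds hξ.1 hξ.2) (Icc_mem_nhds ht.1 ht.2)
    have hF := ((hu.differentiableOn (by norm_num)) (ξ t, t)
      ⟨hξ', ht'⟩).hasFDerivWithinAt.hasFDerivAt hn
    have h2 : HasDerivAt (fun r => (ξ r, r)) (z, (1 : ℝ)) t := hd.prodMk (hasDerivAt_id t)
    have h3 := HasFDerivAt.comp_hasDerivAt (f := fun r => (ξ r, r)) t hF h2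
    rw [ex _ hξ' t ht', et _ hξ' t ht']
    have e : ((z, 1) : ℝ × ℝ) = z • ((1 : ℝ), (0 : ℝ)) + ((0 : ℝ), (1 : ℝ)) := by simp
    rw [e, map_add, map_smul, smul_eq_mul, mul_comm] at h3
    exact h3

/-! ## Integrals over rectangles -/

lemma ContinuousOn.slice_rect {T : ℝ} {f : ℝ → ℝ → ℝ}
    (hf : ContinuousOn (fun q : ℝ × ℝ => f q.1 q.2) (rect T)) {t : ℝ} (ht : t ∈ Icc 0 T) :
    ContinuousOn (fun y => f y t) (Icc 0 1) :=
  hf.comp (f := fun y : ℝ => (y, t)) (by fun_prop) (fun _ hy => mk_mem_prod hy ht)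

lemma ContinuousOn.exists_bound_rect {T : ℝ} {f : ℝ → ℝ → ℝ}
    (hf : ContinuousOn (fun q : ℝ × ℝ => f q.1 q.2) (rect T)) :
    ∃ B : ℝ, 0 ≤ B ∧ ∀ x ∈ Icc (0 : ℝ) 1, ∀ t ∈ Icc 0 T, |f x t| ≤ B := by
  obtain ⟨B, hB⟩ :=
    (isCompact_Icc.prod isCompact_Icc : IsCompact (rect T)).exists_bound_of_continuousOn hf
  exact ⟨max B 0, le_max_right _ _, fun x hx t ht =>
    (hB (x, t) ⟨hx, ht⟩).trans (le_max_left _ _)⟩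

lemma ContinuousOn.intervalIntegrable_subset {f : ℝ → ℝ} {a b c d : ℝ}
    (hf : ContinuousOn f (Icc a b)) (hc : c ∈ Icc a b) (hd : d ∈ Icc a b) :
    IntervalIntegrable f MeasureTheory.volume c d :=
  (hf.mono (ordConnected_Icc.uIcc_subset hc hd)).intervalIntegrable

lemma ContinuousOn.integral_rect {T : ℝ} {f : ℝ → ℝ → ℝ}
    (hf : ContinuousOn (fun q : ℝ × ℝ => f q.1 q.2) (rect T)) :
    ContinuousOn (fun t => ∫ y in (0 : ℝ)..1, f y t) (Icc 0 T) := by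
  obtain ⟨B, hB0, hB⟩ := hf.exists_bound_rect
  intro t ht
  refine intervalIntegral.continuousWithinAt_of_dominated_interval (bound := fun _ => B)
    ?_ ?_ intervalIntegrable_const ?_
  · filter_upwards [self_mem_nhdsWithin] with r hr
    rw [uIoc_of_le zero_le_one]
    exact ((hf.slice_rect hr).mono Ioc_subset_Icc_self).aestronglyMeasurable measurableSet_Ioc
  · filter_upwards [self_mem_nhdsWithin] with r hr
    refine Filter.Eventually.of_forall fun y hy => ?_
    rw [uIoc_of_le zero_le_one] at hy
    exact hB y (Ioc_subset_Icc_self hy) r hr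
  · refine Filter.Eventually.of_forall fun y hy => ?_
    rw [uIoc_of_le zero_le_one] at hy
    exact (hf.comp (f := fun r : ℝ => (y, r)) (by fun_prop)
      (fun _ hr => mk_mem_prod (Ioc_subset_Icc_self hy) hr)) t ht

lemma hasDerivAt_integral_rect {T : ℝ} {f f' : ℝ → ℝ → ℝ}
    (hf : ContinuousOn (fun q : ℝ × ℝ => f q.1 q.2) (rect T))
    (hf' : ContinuousOn (fun q : ℝ × ℝ => f' q.1 q.2) (rect T))
    (hd : ∀ x ∈ Icc (0 : ℝ) 1, ∀ t ∈ Ioo 0 T, HasDerivAt (fun r => f x r) (f' x t) t)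
    {t : ℝ} (ht : t ∈ Ioo 0 T) :
    HasDerivAt (fun r => ∫ y in (0 : ℝ)..1, f y r) (∫ y in (0 : ℝ)..1, f' y t) t := by
  obtain ⟨B, hB0, hB⟩ := hf'.exists_bound_rect
  have meas : ∀ {g : ℝ → ℝ → ℝ}, ContinuousOn (fun q : ℝ × ℝ => g q.1 q.2) (rect T) →
      ∀ r ∈ Icc 0 T, MeasureTheory.AEStronglyMeasurable (fun y => g y r)
        (MeasureTheory.volume.restrict (uIoc 0 1)) := by
    intro g hg r hr
    rw [uIoc_of_le zero_le_one]
    exact ((hg.slice_rect hr).mono Ioc_subset_Icc_self).aestronglyMeasurable measurableSet_Ioc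
  refine (intervalIntegral.hasDerivAt_integral_of_dominated_loc_of_deriv_le
    (F := fun r y => f y r) (F' := fun r y => f' y r)
    (bound := fun _ => B) (s := Ioo 0 T) (Ioo_mem_nhds ht.1 ht.2) ?_ ?_ ?_ ?_
    intervalIntegrable_const ?_).2
  · filter_upwards [Ioo_mem_nhds ht.1 ht.2] with r hr
    exact meas hf r (Ioo_subset_Icc_self hr)
  · exact (hf.slice_rect (Ioo_subset_Icc_self ht)).intervalIntegrable_of_Icc zero_le_one
  · exact meas hf' t (Ioo_subset_Icc_self ht)
  · refine Filter.Eventually.of_forall fun y hy r hr => ?_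
    rw [uIoc_of_le zero_le_one] at hy
    exact hB y (Ioc_subset_Icc_self hy) r (Ioo_subset_Icc_self hr)
  · refine Filter.Eventually.of_forall fun y hy r hr => ?_
    rw [uIoc_of_le zero_le_one] at hy
    exact hd y (Ioc_subset_Icc_self hy) r hr

/-- The fundamental theorem of calculus on a subinterval of `[0,1]`. -/
lemma integral_eq_sub_of_subset_Icc {f f' : ℝ → ℝ} (hf : ContinuousOn f (Icc 0 1))
    (hf' : ContinuousOn f' (Icc 0 1)) (hd : ∀ x ∈ Ioo (0 : ℝ) 1, HasDerivAt f (f' x) x)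
    {a b : ℝ} (ha : 0 ≤ a) (hab : a ≤ b) (hb : b ≤ 1) :
    ∫ y in a..b, f' y = f b - f a :=
  intervalIntegral.integral_eq_sub_of_hasDerivAt_of_le hab (hf.mono (Icc_subset_Icc ha hb))
    (fun x hx => hd x ⟨ha.trans_lt hx.1, hx.2.trans_le hb⟩)
    (hf'.intervalIntegrable_subset ⟨ha, hab.trans hb⟩ ⟨ha.trans hab, hb⟩)

/-- A Poincaré inequality in one dimension. -/
lemma integral_sq_le_of_deriv {f f' : ℝ → ℝ} {Z : Set ℝ} (hZ : Z.Countable)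
    (hf : ContinuousOn f (Icc 0 1)) (hd : ∀ x ∈ Ioo (0 : ℝ) 1 \ Z, HasDerivAt f (f' x) x)
    (hi : IntervalIntegrable f' MeasureTheory.volume 0 1)
    (hi2 : IntervalIntegrable (fun x => f' x ^ 2) MeasureTheory.volume 0 1) :
    ∫ x in (0 : ℝ)..1, f x ^ 2
      ≤ 2 * (∫ x in (0 : ℝ)..1, f x) ^ 2 + 2 * ∫ x in (0 : ℝ)..1, f' x ^ 2 := by
  set A := ∫ x in (0 : ℝ)..1, |f' x| with hA
  set D := ∫ x in (0 : ℝ)..1, f' x ^ 2 with hD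
  set M := ∫ x in (0 : ℝ)..1, f x with hM
  have hA0 : 0 ≤ A := intervalIntegral.integral_nonneg zero_le_one fun x _ => abs_nonneg _
  have hAD : A ^ 2 ≤ D := by
    -- Cauchy–Schwarz, from the nonnegativity of the variance of `|f'|`.
    have h0 : 0 ≤ ∫ x in (0 : ℝ)..1, (|f' x| - A) ^ 2 :=
      intervalIntegral.integral_nonneg zero_le_one fun x _ => sq_nonneg _
    have e : (fun x => (|f' x| - A) ^ 2) = fun x => f' x ^ 2 - 2 * A * |f' x| + A ^ 2 := by
      funext x
      rw [← sq_abs (f' x)]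
      ring
    rw [e, intervalIntegral.integral_add (hi2.sub (hi.abs.const_mul _)) intervalIntegrable_const,
      intervalIntegral.integral_sub hi2 (hi.abs.const_mul _),
      intervalIntegral.integral_const_mul, intervalIntegral.integral_const] at h0
    simp only [smul_eq_mul, sub_zero, one_mul, ← hA, ← hD] at h0
    nlinarith
  have diff : ∀ x ∈ Icc (0 : ℝ) 1, ∀ y ∈ Icc (0 : ℝ) 1, x ≤ y → |f y - f x| ≤ A := by
    intro x hx y hy hxy
    have hsub : Icc x y ⊆ Icc (0 : ℝ) 1 := Icc_subset_Icc hx.1 hy.2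
    have hi' : IntervalIntegrable f' MeasureTheory.volume x y := by
      apply hi.mono_set
      rw [uIcc_of_le hxy, uIcc_of_le zero_le_one]
      exact hsub
    rw [← MeasureTheory.integral_eq_of_hasDerivAt_off_countable_of_le f f' hxy hZ (hf.mono hsub)
      (fun z hz => hd z ⟨⟨hx.1.trans_lt hz.1.1, hz.1.2.trans_le hy.2⟩, hz.2⟩) hi']
    refine (intervalIntegral.abs_integral_le_integral_abs hxy).trans ?_
    exact intervalIntegral.integral_mono_interval hx.1 hxy hy.2
      (Filter.Eventually.of_forall fun z => abs_nonneg _) hi.abs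
  have diff' : ∀ x ∈ Icc (0 : ℝ) 1, ∀ y ∈ Icc (0 : ℝ) 1, |f x - f y| ≤ A := by
    intro x hx y hy
    rcases le_total x y with h | h
    · rw [abs_sub_comm]
      exact diff x hx y hy h
    · exact diff y hy x hx h
  have hfi : IntervalIntegrable f MeasureTheory.volume 0 1 :=
    hf.intervalIntegrable_of_Icc zero_le_one
  have near : ∀ x ∈ Icc (0 : ℝ) 1, |f x - M| ≤ A := by
    intro x hx
    have e : f x - M = ∫ y in (0 : ℝ)..1, (f x - f y) := by
      rw [intervalIntegral.integral_sub intervalIntegrable_const hfi,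
        intervalIntegral.integral_const]
      simp [hM]
    rw [e]
    refine (intervalIntegral.abs_integral_le_integral_abs zero_le_one).trans ?_
    refine (intervalIntegral.integral_mono_on zero_le_one
      ((intervalIntegrable_const.sub hfi).abs) intervalIntegrable_const
      fun y hy => diff' x hx y hy).trans ?_
    simp
  have hsq : ∀ x ∈ Icc (0 : ℝ) 1, f x ^ 2 ≤ 2 * M ^ 2 + 2 * D := by
    intro x hx
    have h1 : (f x - M) ^ 2 ≤ A ^ 2 :=
      sq_le_sq' (neg_le_of_abs_le (near x hx)) (le_of_abs_le (near x hx))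
    -- `2 M² + 2 (f - M)² - f² = (f - 2 M)²`.
    nlinarith [sq_nonneg (f x - M - M)]
  refine (intervalIntegral.integral_mono_on zero_le_one
    ((hf.pow 2).intervalIntegrable_of_Icc zero_le_one) intervalIntegrable_const hsq).trans ?_
  simp

/-! ## Divided differences and the driving forces of the faces -/

lemma ContDiff.hasDerivAt_deriv_of_three {W : ℝ → ℝ} (hW : ContDiff ℝ 3 W) (y : ℝ) :
    HasDerivAt W (deriv W y) y :=
  (hW.differentiable (by norm_num) y).hasDerivAt

lemma ContDiff.contDiff_deriv_deriv {W : ℝ → ℝ} (hW : ContDiff ℝ 3 W) :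
    ContDiff ℝ 1 (deriv (deriv W)) := by
  have h : ContDiff ℝ 2 (deriv W) := (contDiff_succ_iff_deriv.1 (show ContDiff ℝ (2 + 1) W by
    simpa using hW.of_le (by norm_num))).2.2
  exact (contDiff_succ_iff_deriv.1 (show ContDiff ℝ (1 + 1) (deriv W) by
    simpa using h.of_le (by norm_num))).2.2

lemma ContDiff.hasDerivAt_deriv_deriv {W : ℝ → ℝ} (hW : ContDiff ℝ 3 W) (y : ℝ) :
    HasDerivAt (deriv W) (deriv (deriv W) y) y := by
  have h : ContDiff ℝ 2 (deriv W) := (contDiff_succ_iff_deriv.1 (show ContDiff ℝ (2 + 1) W by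
    simpa using hW.of_le (by norm_num))).2.2
  exact (h.differentiable (by norm_num) y).hasDerivAt

/-- Subtract from `W` its quadratic interpolant at `p`, `q`, `r`, whose leading coefficient `c` is
the second divided difference. The remainder vanishes at three points, so Rolle's theorem applied
twice gives a zero of `W'' - 2 c`. -/
lemma exists_dividedDifference_eq_of_lt {W : ℝ → ℝ} (hW : ContDiff ℝ 3 W) {p q r : ℝ}
    (hpq : p < q) (hqr : q < r) :
    ∃ ξ ∈ Ioo p r, (W r - W q) / (r - q) - (W q - W p) / (q - p)
      = deriv (deriv W) ξ * ((r - p) / 2) := by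
  set A := (W q - W p) / (q - p) with hA
  set c := ((W r - W q) / (r - q) - A) / (r - p) with hc
  have h1 : q - p ≠ 0 := (sub_pos.2 hpq).ne'
  have h2 : r - q ≠ 0 := (sub_pos.2 hqr).ne'
  have h3 : r - p ≠ 0 := (sub_pos.2 (hpq.trans hqr)).ne'
  set f : ℝ → ℝ := fun y => W y - W q - A * (y - q) - c * ((y - p) * (y - q)) with hf
  set f' : ℝ → ℝ := fun y => deriv W y - A - c * ((y - q) + (y - p)) with hf'
  have d1 : ∀ y, HasDerivAt f (f' y) y := by
    intro y
    have e1 := (hasDerivAt_id y).sub_const q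
    have e2 := (hasDerivAt_id y).sub_const p
    have := (((hW.hasDerivAt_deriv_of_three y).sub_const (W q)).sub (e1.const_mul A)).sub
      ((e2.mul e1).const_mul c)
    exact this.congr_deriv (by simp [hf'])
  have d2 : ∀ y, HasDerivAt f' (deriv (deriv W) y - 2 * c) y := by
    intro y
    have e1 := (hasDerivAt_id y).sub_const q
    have e2 := (hasDerivAt_id y).sub_const p
    have := ((hW.hasDerivAt_deriv_deriv y).sub_const A).sub ((e1.add e2).const_mul c)
    exact this.congr_deriv (by ring)
  have fq : f q = 0 := by simp [hf]
  have fp : f p = 0 := by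
    simp only [hf, hA]
    field_simp
    ring
  have fr : f r = 0 := by
    simp only [hf, hc]
    field_simp
    ring
  obtain ⟨y1, hy1, e1⟩ := exists_hasDerivAt_eq_zero hpq
    (fun y _ => (d1 y).continuousAt.continuousWithinAt) (fp.trans fq.symm) (fun y _ => d1 y)
  obtain ⟨y2, hy2, e2⟩ := exists_hasDerivAt_eq_zero hqr
    (fun y _ => (d1 y).continuousAt.continuousWithinAt) (fq.trans fr.symm) (fun y _ => d1 y)
  obtain ⟨y3, hy3, e3⟩ := exists_hasDerivAt_eq_zero (hy1.2.trans hy2.1)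
    (fun y _ => (d2 y).continuousAt.continuousWithinAt) (e1.trans e2.symm) (fun y _ => d2 y)
  refine ⟨y3, ⟨hy1.1.trans hy3.1, hy3.2.trans hy2.2⟩, ?_⟩
  rw [show deriv (deriv W) y3 = 2 * c by linarith, hc]
  field_simp

lemma exists_dividedDifference_eq {W : ℝ → ℝ} (hW : ContDiff ℝ 3 W) {p q r : ℝ}
    (h : LiesBetween p q r) :
    ∃ ξ ∈ Ioo (min p r) (max p r), (W r - W q) / (r - q) - (W q - W p) / (q - p)
      = deriv (deriv W) ξ * ((r - p) / 2) := by
  rcases h with ⟨h1, h2⟩ | ⟨h1, h2⟩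
  · rw [min_eq_left (h1.trans h2).le, max_eq_right (h1.trans h2).le]
    exact exists_dividedDifference_eq_of_lt hW h1 h2
  · rw [min_eq_right (h1.trans h2).le, max_eq_left (h1.trans h2).le]
    obtain ⟨ξ, hξ, e⟩ := exists_dividedDifference_eq_of_lt hW h1 h2
    refine ⟨ξ, hξ, ?_⟩
    have e1 : (W r - W q) / (r - q) = (W q - W r) / (q - r) := by
      rw [← neg_sub (W q), ← neg_sub q, neg_div_neg_eq]
    have e2 : (W q - W p) / (q - p) = (W p - W q) / (p - q) := by
      rw [← neg_sub (W p), ← neg_sub p, neg_div_neg_eq]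
    rw [e1, e2]
    linarith

/-- Two admissible slopes adjacent to the same slope coincide or lie on different sides of it. -/
lemma AdjacentSlopes.eq_or_liesBetween {S : Set ℝ} {p q r : ℝ} (h1 : AdjacentSlopes S p q)
    (h2 : AdjacentSlopes S q r) : p = r ∨ LiesBetween p q r := by
  obtain ⟨hp, hq, hpq, hz1⟩ := h1
  obtain ⟨-, hr, hqr, hz2⟩ := h2
  rcases lt_or_gt_of_ne hpq with a | a <;> rcases lt_or_gt_of_ne hqr with b | b
  · exact Or.inr (Or.inl ⟨a, b⟩)
  · left
    by_contra hne
    rcases lt_or_gt_of_ne hne with c | c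
    · exact hz1 r hr ⟨by rw [min_eq_left a.le]; exact c, by rw [max_eq_right a.le]; exact b⟩
    · exact hz2 p hp ⟨by rw [min_eq_right b.le]; exact c, by rw [max_eq_left b.le]; exact a⟩
  · left
    by_contra hne
    rcases lt_or_gt_of_ne hne with c | c
    · exact hz2 p hp ⟨by rw [min_eq_left b.le]; exact a, by rw [max_eq_right b.le]; exact c⟩
    · exact hz1 r hr ⟨by rw [min_eq_right a.le]; exact b, by rw [max_eq_left a.le]; exact c⟩
  · exact Or.inr (Or.inr ⟨b, a⟩)

lemma AdjacentSlopes.symm {S : Set ℝ} {p q : ℝ} (h : AdjacentSlopes S p q) :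
    AdjacentSlopes S q p :=
  ⟨h.2.1, h.1, h.2.2.1.symm, by rw [min_comm, max_comm]; exact h.2.2.2⟩

/-- Slopes adjacent to the middle one of three successively adjacent slopes are the outer ones. -/
lemma AdjacentSlopes.eq_or_eq {S : Set ℝ} {p q r z : ℝ} (h1 : AdjacentSlopes S p q)
    (h2 : AdjacentSlopes S q r) (hb : LiesBetween p q r) (hz : AdjacentSlopes S q z) :
    z = p ∨ z = r := by
  rcases h1.eq_or_liesBetween hz with e | c
  · exact Or.inl e.symm
  · rcases h2.symm.eq_or_liesBetween hz with e | d
    · exact Or.inr e.symm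
    · exfalso
      rcases hb with ⟨b1, b2⟩ | ⟨b1, b2⟩ <;> rcases c with ⟨c1, c2⟩ | ⟨c1, c2⟩ <;>
        rcases d with ⟨d1, d2⟩ | ⟨d1, d2⟩ <;> linarith

/-- The slopes with the extension beyond the end points replaced by even reflection. -/
def reflSlope (N : ℕ) (s : ℕ → ℝ) (i : ℕ) : ℝ :=
  if i = 0 then s 1 else if i = N + 1 then s N else s i

lemma reflSlope_of_mem {N : ℕ} {s : ℕ → ℝ} {i : ℕ} (hi : i ∈ Icc 1 N) :
    reflSlope N s i = s i := by
  have := hi.1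
  have := hi.2
  rw [reflSlope, if_neg (by omega), if_neg (by omega)]

/-- Half the jump of the (reflected) slope across face `i`. -/
def halfJump (N : ℕ) (s : ℕ → ℝ) (i : ℕ) : ℝ :=
  (reflSlope N s (i + 1) - reflSlope N s (i - 1)) / 2

/-- `√(1 + s_i²) Δ_i r_i`, the product of the velocity and the length of face `i`. -/
def faceForce (W : ℝ → ℝ) (N : ℕ) (s : ℕ → ℝ) (i : ℕ) : ℝ :=
  if N = 1 then 0 else √(1 + s i ^ 2) * slopeJump W s i * faceRatio N s i

lemma faceVelocity_eq (W : ℝ → ℝ) (N : ℕ) (s : ℕ → ℝ) (x : ℕ → ℝ → ℝ) (t : ℝ) (i : ℕ) :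
    faceVelocity W N s x t i = faceForce W N s i / (x i t - x (i - 1) t) := by
  unfold faceVelocity faceForce
  split_ifs
  · simp
  · ring

/-- Consecutive slopes are adjacent. -/
def AdjacentChain (S : Set ℝ) (N : ℕ) (s : ℕ → ℝ) : Prop :=
  ∀ i ∈ Ico 1 N, AdjacentSlopes S (s i) (s (i + 1))

lemma min_max_bound {p q r ξ m : ℝ} (hξ : ξ ∈ Ioo (min p r) (max p r)) (h1 : |q - p| ≤ m)
    (h2 : |r - q| ≤ m) : |ξ - q| ≤ m := by
  obtain ⟨a, b⟩ := hξ
  rw [abs_le] at h1 h2 ⊢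
  constructor
  · rcases min_lt_iff.1 a with h | h <;> linarith
  · rcases lt_max_iff.1 b with h | h <;> linarith

/-- The force on a face is comparable to the jump of the slope across it. -/
lemma IsNeumannPhase.exists_faceForce_eq {W : ℝ → ℝ} (hW : ContDiff ℝ 3 W) {S : Set ℝ}
    {a b t₀ t₁ : ℝ} {v : ℝ → ℝ → ℝ} {N : ℕ} {s : ℕ → ℝ} {x p : ℕ → ℝ → ℝ}
    (h : IsNeumannPhase W S a b t₀ t₁ v N s x p) (hadj : AdjacentChain S N s)
    {i : ℕ} (hi : i ∈ Icc 1 N) :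
    ∃ ξ, (∀ m, 0 ≤ m → (2 ≤ N → ∀ j ∈ Icc 1 (N + 1), |s j - s (j - 1)| ≤ m) → |ξ - s i| ≤ m) ∧
      faceForce W N s i = √(1 + s i ^ 2) * deriv (deriv W) ξ * halfJump N s i := by
  obtain ⟨hi1, hi2⟩ := hi
  by_cases hN : N = 1
  · refine ⟨s i, fun m hm _ => by simpa using hm, ?_⟩
    have : i = 1 := by omega
    subst this hN
    simp [faceForce, halfJump, reflSlope]
  have hN2 : 2 ≤ N := by have := h.one_le; omega
  have close : ∀ ξ ∈ Ioo (min (s (i - 1)) (s (i + 1))) (max (s (i - 1)) (s (i + 1))),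
      ∀ m, 0 ≤ m → (2 ≤ N → ∀ j ∈ Icc 1 (N + 1), |s j - s (j - 1)| ≤ m) → |ξ - s i| ≤ m := by
    intro ξ hξ m _ hm
    refine min_max_bound hξ (hm hN2 i ⟨hi1, by omega⟩) ?_
    have := hm hN2 (i + 1) ⟨by omega, by omega⟩
    simpa using this
  have main : ∀ (hb : LiesBetween (s (i - 1)) (s i) (s (i + 1)))
      (hr : faceRatio N s i * ((s (i + 1) - s (i - 1)) / 2) = halfJump N s i),
      ∃ ξ, (∀ m, 0 ≤ m → (2 ≤ N → ∀ j ∈ Icc 1 (N + 1), |s j - s (j - 1)| ≤ m) →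
        |ξ - s i| ≤ m) ∧
      faceForce W N s i = √(1 + s i ^ 2) * deriv (deriv W) ξ * halfJump N s i := by
    intro hb hr
    obtain ⟨ξ, hξ, e⟩ := exists_dividedDifference_eq hW hb
    refine ⟨ξ, close ξ hξ, ?_⟩
    rw [faceForce, if_neg hN, slopeJump, e, ← hr]
    ring
  have ne_of_between : ∀ {p q r : ℝ}, LiesBetween p q r → r - p ≠ 0 := by
    rintro p q r (⟨h1, h2⟩ | ⟨h1, h2⟩) <;> intro h <;> linarith
  -- At an end face the ratio `r_1` replaces `s 2 - s 0` by `s 2 - s 1`, which is the jump for the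
  -- reflected slopes; `r_N` does the same at the other end.
  rcases eq_or_ne i 1 with rfl | hi1'
  · apply main h.ext_left_between
    have := ne_of_between h.ext_left_between
    simp only [faceRatio, halfJump, reflSlope, if_true]
    simp only [le_refl, tsub_eq_zero_of_le]
    rw [if_neg (by omega), if_neg (by omega)]
    norm_num
    field_simp
  rcases eq_or_ne i N with rfl | hiN
  · apply main h.ext_right_between
    have := ne_of_between h.ext_right_between
    simp only [faceRatio, halfJump, reflSlope, if_true]
    rw [if_neg hi1', if_neg (by omega), if_neg (by omega), if_neg (by omega)]
    field_simp
  have hd : halfJump N s i = (s (i + 1) - s (i - 1)) / 2 := by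
    rw [halfJump, reflSlope_of_mem ⟨by omega, by omega⟩, reflSlope_of_mem ⟨by omega, by omega⟩]
  have hrat : faceRatio N s i = 1 := by rw [faceRatio, if_neg hi1', if_neg hiN]
  have ha1 := hadj (i - 1) ⟨by omega, by omega⟩
  rw [Nat.sub_add_cancel hi1] at ha1
  -- If the outer slopes coincide, force and half jump both vanish and any intermediate point will
  -- do.
  rcases ha1.eq_or_liesBetween (hadj i ⟨hi1, by omega⟩) with e | hb
  · refine ⟨s i, fun m hm _ => by simpa using hm, ?_⟩
    have e1 : (W (s (i + 1)) - W (s i)) / (s (i + 1) - s i)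
        = (W (s i) - W (s (i + 1))) / (s i - s (i + 1)) := by
      rw [← neg_sub (W (s i)), ← neg_sub (s i), neg_div_neg_eq]
    rw [faceForce, if_neg hN, slopeJump, hd, e, e1]
    simp
  · exact main hb (by rw [hrat, hd, one_mul])

/-! ## The limit of a phase at its final time -/

lemma mul_add_intercept_eq {v : ℝ → ℝ} {N : ℕ} {s x p : ℕ → ℝ}
    (hx : ∀ i ∈ Icc 1 N, x (i - 1) ≤ x i)
    (hv : ∀ i ∈ Icc 1 N, ∀ y ∈ Icc (x (i - 1)) (x i), v y = s i * y + p i)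
    {i : ℕ} (hi : i ∈ Ico 1 N) : s i * x i + p i = s (i + 1) * x i + p (i + 1) := by
  have h1 : i ∈ Icc 1 N := Ico_subset_Icc_self hi
  have h2 : i + 1 ∈ Icc 1 N := ⟨by omega, hi.2⟩
  rw [← hv i h1 (x i) ⟨hx i h1, le_rfl⟩, ← hv (i + 1) h2 (x i)]
  have := hx (i + 1) h2
  simp only [Nat.add_sub_cancel] at this ⊢
  exact ⟨le_rfl, this⟩

lemma corners_mono {N : ℕ} {x : ℕ → ℝ} (hx : ∀ i ∈ Icc 1 N, x (i - 1) ≤ x i) {i j : ℕ}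
    (hij : i ≤ j) (hj : j ≤ N) : x i ≤ x j := by
  induction j, hij using Nat.le_induction with
  | base => exact le_rfl
  | succ k hk ih => exact (ih (by omega)).trans (by simpa using hx (k + 1) ⟨by omega, hj⟩)

lemma corners_mem_Icc {N : ℕ} {x : ℕ → ℝ} (hx : ∀ i ∈ Icc 1 N, x (i - 1) ≤ x i) (h0 : x 0 = 0)
    (h1 : x N = 1) {i : ℕ} (hi : i ≤ N) : x i ∈ Icc (0 : ℝ) 1 :=
  ⟨h0 ▸ corners_mono hx (Nat.zero_le i) hi, h1 ▸ corners_mono hx hi le_rfl⟩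

/-- A phase together with the limiting profile at its final time, where faces may have
length zero. -/
structure IsClosedPhase (W : ℝ → ℝ) (a b t₀ t₁ : ℝ) (v : ℝ → ℝ → ℝ)
    (N : ℕ) (s : ℕ → ℝ) (x p : ℕ → ℝ → ℝ) : Prop where
  one_le : 1 ≤ N
  slope_ne : ∀ i ∈ Ico 1 N, s i ≠ s (i + 1)
  first_slope : s 1 = a
  last_slope : s N = b
  x_zero : ∀ t ∈ Icc t₀ t₁, x 0 t = 0
  x_last : ∀ t ∈ Icc t₀ t₁, x N t = 1
  x_lt : ∀ t ∈ Ico t₀ t₁, ∀ i ∈ Icc 1 N, x (i - 1) t < x i t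
  x_le : ∀ t ∈ Icc t₀ t₁, ∀ i ∈ Icc 1 N, x (i - 1) t ≤ x i t
  x_cont : ∀ i ≤ N, ContinuousOn (x i) (Icc t₀ t₁)
  p_cont : ∀ i ∈ Icc 1 N, ContinuousOn (p i) (Icc t₀ t₁)
  profile : ∀ t ∈ Icc t₀ t₁, ∀ i ∈ Icc 1 N, ∀ y ∈ Icc (x (i - 1) t) (x i t),
    v y t = s i * y + p i t
  face_motion : ∀ t ∈ Ioo t₀ t₁, ∀ i ∈ Icc 1 N, HasDerivAt (p i) (faceVelocity W N s x t i) t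
  corner_motion : ∀ t ∈ Ioo t₀ t₁, ∀ i ∈ Ico 1 N,
    HasDerivAt (x i)
      (-((faceVelocity W N s x t (i + 1) - faceVelocity W N s x t i) / (s (i + 1) - s i))) t

lemma continuousOn_update_of_tendsto {f : ℝ → ℝ} {t₀ t₁ L : ℝ}
    (hf : ContinuousOn f (Ico t₀ t₁)) (hL : Filter.Tendsto f (nhdsWithin t₁ (Iio t₁)) (nhds L)) :
    ContinuousOn (Function.update f t₁ L) (Icc t₀ t₁) := by
  rw [continuousOn_update_iff, Icc_sdiff_right]
  exact ⟨hf, fun _ => hL.mono_left (nhdsWithin_mono _ Ico_subset_Iio_self)⟩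

lemma exists_tendsto_of_deriv_sign {f f' : ℝ → ℝ} {t₀ t₁ B : ℝ} (ht : t₀ < t₁)
    (hd : ∀ t ∈ Ioo t₀ t₁, HasDerivAt f (f' t) t) (hB : ∀ t ∈ Ioo t₀ t₁, |f t| ≤ B)
    (hs : (∀ t ∈ Ioo t₀ t₁, 0 ≤ f' t) ∨ (∀ t ∈ Ioo t₀ t₁, f' t ≤ 0)) :
    ∃ L, Filter.Tendsto f (nhdsWithin t₁ (Iio t₁)) (nhds L) := by
  have hc : ContinuousOn f (Ioo t₀ t₁) := fun t h => (hd t h).continuousAt.continuousWithinAt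
  have hdiff : DifferentiableOn ℝ f (interior (Ioo t₀ t₁)) := by
    rw [interior_Ioo]
    exact fun t h => (hd t h).differentiableAt.differentiableWithinAt
  rcases hs with h | h
  · have hm : MonotoneOn f (Ioo t₀ t₁) := monotoneOn_of_deriv_nonneg (convex_Ioo _ _) hc hdiff
      fun t h' => by rw [interior_Ioo] at h'; rw [(hd t h').deriv]; exact h t h'
    refine ⟨_, hm.tendsto_nhdsWithin_Ioo_left (nonempty_Ioo.2 ht) ⟨B, ?_⟩⟩
    rintro _ ⟨t, h', rfl⟩
    exact (abs_le.1 (hB t h')).2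
  · have hm : AntitoneOn f (Ioo t₀ t₁) := antitoneOn_of_deriv_nonpos (convex_Ioo _ _) hc hdiff
      fun t h' => by rw [interior_Ioo] at h'; rw [(hd t h').deriv]; exact h t h'
    refine ⟨_, hm.tendsto_nhdsWithin_Ioo_left (nonempty_Ioo.2 ht) ⟨-B, ?_⟩⟩
    rintro _ ⟨t, h', rfl⟩
    exact (abs_le.1 (hB t h')).1

lemma faceVelocity_congr (W : ℝ → ℝ) (N : ℕ) (s : ℕ → ℝ) {x x' : ℕ → ℝ → ℝ} {t : ℝ}
    (h : ∀ i, x i t = x' i t) (i : ℕ) : faceVelocity W N s x t i = faceVelocity W N s x' t i := by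
  rw [faceVelocity_eq, faceVelocity_eq, h, h]

/-- The velocity is a force depending on the slopes alone, divided by a positive length, so its sign
is constant during the phase and the intercept is monotone. It is bounded because `v` is. No lower
bound on the length is needed. -/
lemma IsNeumannPhase.exists_tendsto_intercept {W : ℝ → ℝ}
    {S : Set ℝ} {a b t₀ t₁ T : ℝ} {v : ℝ → ℝ → ℝ} {N : ℕ} {s : ℕ → ℝ} {x p : ℕ → ℝ → ℝ}
    (h : IsNeumannPhase W S a b t₀ t₁ v N s x p)
    (ht : t₀ < t₁) (h0 : 0 ≤ t₀) (h1 : t₁ ≤ T)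
    (hv : ContinuousOn (fun q : ℝ × ℝ => v q.1 q.2) (rect T)) {i : ℕ} (hi : i ∈ Icc 1 N) :
    ∃ L, Filter.Tendsto (p i) (nhdsWithin t₁ (Iio t₁)) (nhds L) := by
  obtain ⟨B, hB0, hB⟩ := hv.exists_bound_rect
  have hle : ∀ t ∈ Ioo t₀ t₁, ∀ i ∈ Icc 1 N, x (i - 1) t ≤ x i t :=
    fun t ht i hi => (h.x_lt t (Ioo_subset_Ico_self ht) i hi).le
  refine exists_tendsto_of_deriv_sign (B := B + |s i|) ht (fun t ht => h.face_motion t ht i hi)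
    ?_ ?_
  · intro t ht
    have hm := corners_mem_Icc (x := fun i => x i t) (hle t ht)
      (h.x_zero t (Ioo_subset_Ico_self ht)) (h.x_last t (Ioo_subset_Ico_self ht)) hi.2
    have e := h.profile t (Ioo_subset_Ico_self ht) i hi (x i t) ⟨hle t ht i hi, le_rfl⟩
    have e2 : p i t = v (x i t) t - s i * x i t := by linarith
    rw [e2]
    refine (abs_sub _ _).trans (add_le_add (hB _ hm t ⟨h0.trans ht.1.le, ht.2.le.trans h1⟩) ?_)
    rw [abs_mul, abs_of_nonneg hm.1]
    exact mul_le_of_le_one_right (abs_nonneg _) hm.2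
  · rcases le_total 0 (faceForce W N s i) with hK | hK
    · left
      intro t ht
      rw [faceVelocity_eq]
      exact div_nonneg hK (sub_nonneg.2 (hle t ht i hi))
    · right
      intro t ht
      rw [faceVelocity_eq]
      exact div_nonpos_of_nonpos_of_nonneg hK (sub_nonneg.2 (hle t ht i hi))

/-- A corner is the intersection of two lines with fixed distinct slopes, so it converges once their
intercepts do. Continuity of `v` carries the affine profile over to the final time. -/
lemma IsNeumannPhase.exists_isClosedPhase {W : ℝ → ℝ}
    {S : Set ℝ} {a b t₀ t₁ T : ℝ} {v : ℝ → ℝ → ℝ} {N : ℕ} {s : ℕ → ℝ} {x p : ℕ → ℝ → ℝ}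
    (h : IsNeumannPhase W S a b t₀ t₁ v N s x p)
    (ht : t₀ < t₁) (h0 : 0 ≤ t₀) (h1 : t₁ ≤ T)
    (hv : ContinuousOn (fun q : ℝ × ℝ => v q.1 q.2) (rect T)) :
    ∃ x' p' : ℕ → ℝ → ℝ, IsClosedPhase W a b t₀ t₁ v N s x' p' ∧
      ∀ t ∈ Ico t₀ t₁, ∀ i, x' i t = x i t := by
  have hP : ∀ i, ∃ L, i ∈ Icc 1 N → Filter.Tendsto (p i) (nhdsWithin t₁ (Iio t₁)) (nhds L) := by
    intro i
    by_cases hi : i ∈ Icc 1 N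
    · obtain ⟨L, hL⟩ := h.exists_tendsto_intercept ht h0 h1 hv hi
      exact ⟨L, fun _ => hL⟩
    · exact ⟨0, fun h => (hi h).elim⟩
  choose P hP using hP
  have hIco : ∀ᶠ t in nhdsWithin t₁ (Iio t₁), t ∈ Ico t₀ t₁ := Ico_mem_nhdsLT ht
  have hX : ∀ i, ∃ L, i ≤ N → Filter.Tendsto (x i) (nhdsWithin t₁ (Iio t₁)) (nhds L) := by
    intro i
    by_cases hi : i ≤ N
    · rcases Nat.eq_zero_or_pos i with rfl | hi0
      · refine ⟨0, fun _ => tendsto_const_nhds.congr' ?_⟩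
        filter_upwards [hIco] with t ht'
        exact (h.x_zero t ht').symm
      rcases eq_or_lt_of_le hi with rfl | hiN
      · refine ⟨1, fun _ => tendsto_const_nhds.congr' ?_⟩
        filter_upwards [hIco] with t ht'
        exact (h.x_last t ht').symm
      · refine ⟨(P i - P (i + 1)) / (s (i + 1) - s i), fun _ => ?_⟩
        have := ((hP i ⟨hi0, hi⟩).sub (hP (i + 1) ⟨by omega, hiN⟩)).div_const (s (i + 1) - s i)
        refine this.congr' ?_
        filter_upwards [hIco] with t ht'
        have e := mul_add_intercept_eq (v := fun y => v y t) (x := fun i => x i t)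
          (p := fun i => p i t) (fun i hi => (h.x_lt t ht' i hi).le)
          (h.profile t ht') (i := i) ⟨hi0, hiN⟩
        have hne : s (i + 1) - s i ≠ 0 := sub_ne_zero.2 (h.slope_ne i ⟨hi0, hiN⟩).symm
        rw [div_eq_iff hne]
        linarith
    · exact ⟨0, fun h => (hi h).elim⟩
  choose X hX using hX
  have hneBot : (nhdsWithin t₁ (Iio t₁)).NeBot := inferInstance
  have X0 : X 0 = 0 := tendsto_nhds_unique (hX 0 (Nat.zero_le _))
    (tendsto_const_nhds.congr' (by filter_upwards [hIco] with t ht'; exact (h.x_zero t ht').symm))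
  have XN : X N = 1 := tendsto_nhds_unique (hX N le_rfl)
    (tendsto_const_nhds.congr' (by filter_upwards [hIco] with t ht'; exact (h.x_last t ht').symm))
  have Xle : ∀ i ∈ Icc 1 N, X (i - 1) ≤ X i := by
    intro i hi
    refine le_of_tendsto_of_tendsto (hX (i - 1) ((Nat.sub_le _ _).trans hi.2)) (hX i hi.2) ?_
    filter_upwards [hIco] with t ht'
    exact (h.x_lt t ht' i hi).le
  have hXmem : ∀ i ≤ N, X i ∈ Icc (0 : ℝ) 1 := fun i hi => corners_mem_Icc Xle X0 XN hi
  have hprof : ∀ i ∈ Icc 1 N, ∀ y ∈ Icc (X (i - 1)) (X i), v y t₁ = s i * y + P i := by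
    intro i hi y hy
    have hi' : i - 1 ≤ N := (Nat.sub_le _ _).trans hi.2
    -- Clamping `y` to face `i` at time `t` gives points that converge to `y` and at which the
    -- affine formula is available.
    set c : ℝ → ℝ := fun t => max (x (i - 1) t) (min y (x i t)) with hc
    have hcy : Filter.Tendsto c (nhdsWithin t₁ (Iio t₁)) (nhds y) := by
      have := (hX (i - 1) hi').max ((tendsto_const_nhds (x := y)).min (hX i hi.2))
      rwa [min_eq_left hy.2, max_eq_right hy.1] at this
    have hcm : ∀ t ∈ Ico t₀ t₁, c t ∈ Icc (x (i - 1) t) (x i t) := fun t ht' =>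
      ⟨le_max_left _ _, max_le (h.x_lt t ht' i hi).le (min_le_right _ _)⟩
    have hyD : (y, t₁) ∈ rect T :=
      ⟨⟨(hXmem _ hi').1.trans hy.1, hy.2.trans (hXmem _ hi.2).2⟩, ⟨h0.trans ht.le, h1⟩⟩
    have hcD : Filter.Tendsto (fun t => (c t, t)) (nhdsWithin t₁ (Iio t₁))
        (nhdsWithin (y, t₁) (rect T)) := by
      refine tendsto_nhdsWithin_iff.2 ⟨?_, ?_⟩
      · exact hcy.prodMk_nhds (tendsto_nhdsWithin_of_tendsto_nhds Filter.tendsto_id)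
      · filter_upwards [hIco] with t ht'
        have hle : ∀ i ∈ Icc 1 N, x (i - 1) t ≤ x i t := fun i hi => (h.x_lt t ht' i hi).le
        have m1 := corners_mem_Icc (x := fun i => x i t) hle (h.x_zero t ht') (h.x_last t ht') hi'
        have m2 := corners_mem_Icc (x := fun i => x i t) hle (h.x_zero t ht') (h.x_last t ht') hi.2
        exact ⟨⟨m1.1.trans (hcm t ht').1, (hcm t ht').2.trans m2.2⟩,
          ⟨h0.trans ht'.1, ht'.2.le.trans h1⟩⟩
    have l1 : Filter.Tendsto (fun t => v (c t) t) (nhdsWithin t₁ (Iio t₁)) (nhds (v y t₁)) :=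
      (hv (y, t₁) hyD).tendsto.comp hcD
    have l2 : Filter.Tendsto (fun t => s i * c t + p i t) (nhdsWithin t₁ (Iio t₁))
        (nhds (s i * y + P i)) := (hcy.const_mul _).add (hP i hi)
    refine tendsto_nhds_unique l1 (l2.congr' ?_)
    filter_upwards [hIco] with t ht'
    exact (h.profile t ht' i hi (c t) (hcm t ht')).symm
  set x' : ℕ → ℝ → ℝ := fun i => Function.update (x i) t₁ (X i) with hx'
  set p' : ℕ → ℝ → ℝ := fun i => Function.update (p i) t₁ (P i) with hp'
  have ex : ∀ t ∈ Ico t₀ t₁, ∀ i, x' i t = x i t := fun t ht' i =>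
    Function.update_of_ne ht'.2.ne _ _
  have ep : ∀ t ∈ Ico t₀ t₁, ∀ i, p' i t = p i t := fun t ht' i =>
    Function.update_of_ne ht'.2.ne _ _
  have ex1 : ∀ i, x' i t₁ = X i := fun i => Function.update_self _ _ _
  have ep1 : ∀ i, p' i t₁ = P i := fun i => Function.update_self _ _ _
  have split : ∀ t ∈ Icc t₀ t₁, t ∈ Ico t₀ t₁ ∨ t = t₁ := fun t ht' =>
    (lt_or_eq_of_le ht'.2).imp (fun h => ⟨ht'.1, h⟩) id
  refine ⟨x', p', ⟨h.one_le, h.slope_ne, h.first_slope, h.last_slope, ?_, ?_, ?_, ?_, ?_, ?_, ?_,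
    ?_, ?_⟩, ex⟩
  · intro t ht'
    rcases split t ht' with h' | rfl
    · rw [ex t h', h.x_zero t h']
    · rw [ex1, X0]
  · intro t ht'
    rcases split t ht' with h' | rfl
    · rw [ex t h', h.x_last t h']
    · rw [ex1, XN]
  · intro t ht' i hi
    rw [ex t ht', ex t ht']
    exact h.x_lt t ht' i hi
  · intro t ht' i hi
    rcases split t ht' with h' | rfl
    · rw [ex t h', ex t h']
      exact (h.x_lt t h' i hi).le
    · rw [ex1, ex1]
      exact Xle i hi
  · intro i hi
    exact continuousOn_update_of_tendsto (h.x_cont i hi) (hX i hi)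
  · intro i hi
    exact continuousOn_update_of_tendsto (h.p_cont i hi) (hP i hi)
  · intro t ht' i hi y hy
    rcases split t ht' with h' | rfl
    · rw [ex t h', ex t h'] at hy
      rw [ep t h']
      exact h.profile t h' i hi y hy
    · rw [ex1, ex1] at hy
      rw [ep1]
      exact hprof i hi y hy
  · intro t ht' i hi
    have ev : p' i =ᶠ[nhds t] p i := by
      filter_upwards [Ioo_mem_nhds ht'.1 ht'.2] with r hr
      exact ep r (Ioo_subset_Ico_self hr) i
    rw [faceVelocity_congr W N s (ex t (Ioo_subset_Ico_self ht'))]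
    exact (h.face_motion t ht' i hi).congr_of_eventuallyEq ev
  · intro t ht' i hi
    have ev : x' i =ᶠ[nhds t] x i := by
      filter_upwards [Ioo_mem_nhds ht'.1 ht'.2] with r hr
      exact ex r (Ioo_subset_Ico_self hr) i
    rw [faceVelocity_congr W N s (ex t (Ioo_subset_Ico_self ht')),
      faceVelocity_congr W N s (ex t (Ioo_subset_Ico_self ht'))]
    exact (h.corner_motion t ht' i hi).congr_of_eventuallyEq ev

/-! ## Faces of nonzero curvature do not disappear -/

/-- Sum `p (k+1) - p k = -(s (k+1) - s k) x k` over the run of faces, using that the slope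
increments are nonnegative. -/
lemma neg_mul_le_intercept_sub {s x p : ℕ → ℝ} {a b : ℕ} {ξ : ℝ} (hab : a ≤ b)
    (hs : ∀ k ∈ Ico a b, s k ≤ s (k + 1))
    (hrel : ∀ k ∈ Ico a b, s k * x k + p k = s (k + 1) * x k + p (k + 1))
    (hx : ∀ k ∈ Ico a b, x k ≤ ξ) : -((s b - s a) * ξ) ≤ p b - p a := by
  induction b, hab using Nat.le_induction with
  | base => simp
  | succ n hn ih =>
    have h := ih (fun k hk => hs k ⟨hk.1, hk.2.trans n.lt_succ_self⟩)
      (fun k hk => hrel k ⟨hk.1, hk.2.trans n.lt_succ_self⟩)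
      (fun k hk => hx k ⟨hk.1, hk.2.trans n.lt_succ_self⟩)
    have hm : n ∈ Ico a (n + 1) := ⟨hn, n.lt_succ_self⟩
    have := mul_le_mul_of_nonneg_left (hx n hm) (sub_nonneg.2 (hs n hm))
    linarith [hrel n hm]

lemma intercept_sub_le_neg_mul {s x p : ℕ → ℝ} {a b : ℕ} {ξ : ℝ} (hab : a ≤ b)
    (hs : ∀ k ∈ Ico a b, s k ≤ s (k + 1))
    (hrel : ∀ k ∈ Ico a b, s k * x k + p k = s (k + 1) * x k + p (k + 1))
    (hx : ∀ k ∈ Ico a b, ξ ≤ x k) : p b - p a ≤ -((s b - s a) * ξ) := by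
  induction b, hab using Nat.le_induction with
  | base => simp
  | succ n hn ih =>
    have h := ih (fun k hk => hs k ⟨hk.1, hk.2.trans n.lt_succ_self⟩)
      (fun k hk => hrel k ⟨hk.1, hk.2.trans n.lt_succ_self⟩)
      (fun k hk => hx k ⟨hk.1, hk.2.trans n.lt_succ_self⟩)
    have hm : n ∈ Ico a (n + 1) := ⟨hn, n.lt_succ_self⟩
    have := mul_le_mul_of_nonneg_left (hx n hm) (sub_nonneg.2 (hs n hm))
    linarith [hrel n hm]

/-- Covers the two reasons why a velocity stays bounded above at the end of a phase: the face has no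
force, or it survives. -/
lemma eventually_div_le_of_tendsto {l : ℝ → ℝ} {F : Filter ℝ} {K L : ℝ}
    (hl : Filter.Tendsto l F (nhds L)) (h : K = 0 ∨ 0 < L) : ∃ M, ∀ᶠ t in F, K / l t ≤ M := by
  rcases h with rfl | h
  · exact ⟨0, Filter.Eventually.of_forall fun t => by simp⟩
  · have := (tendsto_const_nhds (x := K)).div hl h.ne'
    exact ⟨K / L + 1, this.eventually_le_const (by linarith)⟩

/-- A convex face between two faces of bounded velocity cannot shrink to a point. -/
lemma not_collapse_of_increasing {t₀ t₁ : ℝ} (ht : t₀ < t₁) {s K : ℕ → ℝ} {x p : ℕ → ℝ → ℝ}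
    {a i b : ℕ} {y : ℝ} (hai : a < i) (hib : i < b) (hs : ∀ k ∈ Ico a b, s k < s (k + 1))
    (hl : ∀ t ∈ Ioo t₀ t₁, x (i - 1) t < x i t)
    (hmono : ∀ t ∈ Ioo t₀ t₁, ∀ k l, k ≤ l → l ≤ b → x k t ≤ x l t)
    (hrel : ∀ t ∈ Icc t₀ t₁, ∀ k ∈ Ico a b, s k * x k t + p k t = s (k + 1) * x k t + p (k + 1) t)
    (hd : ∀ t ∈ Ioo t₀ t₁, ∀ k ∈ Icc a b, HasDerivAt (p k) (K k / (x k t - x (k - 1) t)) t)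
    (hx : ∀ k ≤ b, ContinuousOn (x k) (Icc t₀ t₁))
    (hp : ∀ k ∈ Icc a b, ContinuousOn (p k) (Icc t₀ t₁))
    (hy : ∀ k ∈ Ico a b, x k t₁ = y) (hKa : K a = 0 ∨ x (a - 1) t₁ < x a t₁)
    (hKb : K b = 0 ∨ x (b - 1) t₁ < x b t₁) (hKi : 0 < K i) : False := by
  have hsai : ∀ k ∈ Ico a i, s k ≤ s (k + 1) := fun k hk => (hs k ⟨hk.1, hk.2.trans hib⟩).le
  have hsib : ∀ k ∈ Ico i b, s k ≤ s (k + 1) := fun k hk => (hs k ⟨hai.le.trans hk.1, hk.2⟩).le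
  have smono : ∀ k l, a ≤ k → k < l → l ≤ b → s k < s l := by
    intro k l hak hkl
    induction l, hkl using Nat.le_induction with
    | base => intro h; exact hs k ⟨hak, h⟩
    | succ n hn ih =>
      intro h
      exact (ih (by omega)).trans (hs n ⟨hak.trans ((Nat.le_succ k).trans hn), h⟩)
  have s1 : 0 < s i - s a := sub_pos.2 (smono a i le_rfl hai hib.le)
  have s2 : 0 < s b - s i := sub_pos.2 (smono i b hai.le hib le_rfl)
  -- Up to the factor `(s i - s a)(s b - s i)`, this is the length that face `i` would have if it
  -- were cut off directly by the lines of faces `a` and `b`.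
  set h : ℝ → ℝ := fun t => (s b - s i) * (p i t - p a t) - (s i - s a) * (p b t - p i t) with hh
  have ma : a ∈ Icc a b := ⟨le_rfl, (hai.trans hib).le⟩
  have mi : i ∈ Icc a b := ⟨hai.le, hib.le⟩
  have mb : b ∈ Icc a b := ⟨(hai.trans hib).le, le_rfl⟩
  -- The corners from `a` to `i - 1` lie to the left of face `i` and those from `i` to `b - 1` to
  -- its right, so `h` dominates a positive multiple of the actual length.
  have hpos : ∀ t ∈ Ioo t₀ t₁, 0 < h t := by
    intro t ht'
    have r := hrel t (Ioo_subset_Icc_self ht')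
    have e1 := neg_mul_le_intercept_sub (x := fun k => x k t) (p := fun k => p k t)
      (ξ := x (i - 1) t) hai.le hsai (fun k hk => r k ⟨hk.1, hk.2.trans hib⟩)
      (fun k hk => hmono t ht' k (i - 1) (by have := hk.2; omega) (by omega))
    have e2 := intercept_sub_le_neg_mul (x := fun k => x k t) (p := fun k => p k t)
      (ξ := x i t) hib.le hsib (fun k hk => r k ⟨hai.le.trans hk.1, hk.2⟩)
      (fun k hk => hmono t ht' i k hk.1 hk.2.le)
    have e3 := mul_le_mul_of_nonneg_left e1 s2.le
    have e4 := mul_le_mul_of_nonneg_left e2 s1.le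
    have e5 := mul_pos (mul_pos s1 s2) (sub_pos.2 (hl t ht'))
    simp only [hh]
    linarith
  -- At the final time all corners of the run sit at `y`, so the same sums give the opposite
  -- inequality.
  have hlim : h t₁ ≤ 0 := by
    have r := hrel t₁ (right_mem_Icc.2 ht.le)
    have e1 := intercept_sub_le_neg_mul (x := fun k => x k t₁) (p := fun k => p k t₁)
      (ξ := y) hai.le hsai (fun k hk => r k ⟨hk.1, hk.2.trans hib⟩)
      (fun k hk => (hy k ⟨hk.1, hk.2.trans hib⟩).ge)
    have e2 := neg_mul_le_intercept_sub (x := fun k => x k t₁) (p := fun k => p k t₁)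
      (ξ := y) hib.le hsib (fun k hk => r k ⟨hai.le.trans hk.1, hk.2⟩)
      (fun k hk => (hy k ⟨hai.le.trans hk.1, hk.2⟩).le)
    have e3 := mul_le_mul_of_nonneg_left e1 s2.le
    have e4 := mul_le_mul_of_nonneg_left e2 s1.le
    simp only [hh]
    linarith
  have tx : ∀ k ≤ b, Filter.Tendsto (x k) (nhdsWithin t₁ (Iio t₁)) (nhds (x k t₁)) := by
    intro k hk
    have := ((hx k hk) t₁ (right_mem_Icc.2 ht.le)).mono Ico_subset_Icc_self
    rwa [ContinuousWithinAt, nhdsWithin_Ico_eq_nhdsLT ht] at this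
  have tl : ∀ k ≤ b, Filter.Tendsto (fun t => x k t - x (k - 1) t) (nhdsWithin t₁ (Iio t₁))
      (nhds (x k t₁ - x (k - 1) t₁)) :=
    fun k hk => (tx k hk).sub (tx (k - 1) ((Nat.sub_le _ _).trans hk))
  obtain ⟨Ma, hMa⟩ := eventually_div_le_of_tendsto (tl a ma.2)
    (hKa.imp id fun h => sub_pos.2 h)
  obtain ⟨Mb, hMb⟩ := eventually_div_le_of_tendsto (tl b mb.2)
    (hKb.imp id fun h => sub_pos.2 h)
  have hIoo : ∀ᶠ t in nhdsWithin t₁ (Iio t₁), t ∈ Ioo t₀ t₁ := Ioo_mem_nhdsLT ht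
  have tli : Filter.Tendsto (fun t => x i t - x (i - 1) t) (nhdsWithin t₁ (Iio t₁))
      (nhdsWithin 0 (Ioi 0)) := by
    refine tendsto_nhdsWithin_iff.2 ⟨?_, ?_⟩
    · have := tl i mi.2
      rwa [hy i ⟨hai.le, hib⟩, hy (i - 1) ⟨by omega, by omega⟩, sub_self] at this
    · filter_upwards [hIoo] with t ht'
      exact sub_pos.2 (hl t ht')
  have tKi : Filter.Tendsto (fun t => K i / (x i t - x (i - 1) t)) (nhdsWithin t₁ (Iio t₁))
      Filter.atTop := by
    simp_rw [div_eq_mul_inv]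
    exact (tendsto_inv_nhdsGT_zero.comp tli).const_mul_atTop hKi
  -- `h' = (s b - s a) p_i' - (s b - s i) p_a' - (s i - s a) p_b'`, so beyond this threshold `h` is
  -- strictly increasing, which contradicts its passing from positive to nonpositive.
  have hbig := tKi.eventually_gt_atTop (((s b - s i) * Ma + (s i - s a) * Mb) / (s b - s a))
  obtain ⟨t₂, ht₂, hev⟩ := (mem_nhdsLT_iff_exists_Ioo_subset' ht).1
    (hMa.and (hMb.and (hbig.and hIoo)))
  set t₃ := (max t₀ t₂ + t₁) / 2 with ht₃
  have hmax : max t₀ t₂ < t₁ := max_lt ht ht₂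
  have h31 : t₃ < t₁ := by linarith
  have h3m : max t₀ t₂ < t₃ := by linarith
  have h30 : t₀ < t₃ := (le_max_left _ _).trans_lt h3m
  have h32 : t₂ < t₃ := (le_max_right _ _).trans_lt h3m
  have hsm : StrictMonoOn h (Icc t₃ t₁) := by
    refine strictMonoOn_of_deriv_pos (convex_Icc _ _) ?_ ?_
    · have c : ∀ k ∈ Icc a b, ContinuousOn (p k) (Icc t₃ t₁) := fun k hk =>
        (hp k hk).mono (Icc_subset_Icc_left h30.le)
      exact (continuousOn_const.mul ((c i mi).sub (c a ma))).sub
        (continuousOn_const.mul ((c b mb).sub (c i mi)))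
    · intro t ht'
      rw [interior_Icc] at ht'
      obtain ⟨ea, eb, ei, hI⟩ := hev ⟨h32.trans ht'.1, ht'.2⟩
      have D := (((hd t hI i mi).sub (hd t hI a ma)).const_mul (s b - s i)).sub
        (((hd t hI b mb).sub (hd t hI i mi)).const_mul (s i - s a))
      have D' : HasDerivAt h _ t := D
      rw [D'.deriv]
      have e1 := mul_le_mul_of_nonneg_left ea s2.le
      have e2 := mul_le_mul_of_nonneg_left eb s1.le
      rw [div_lt_iff₀ (by linarith)] at ei
      linarith
  have := hsm (left_mem_Icc.2 h31.le) (right_mem_Icc.2 h31.le) h31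
  linarith [hpos t₃ ⟨h30, h31⟩]

/-- Among faces that shrink to a common point between two surviving faces, none is convex. -/
lemma not_increasing_of_collapse {t₀ t₁ : ℝ} (ht : t₀ < t₁) {s K G : ℕ → ℝ} {x p : ℕ → ℝ → ℝ}
    {j j' : ℕ} {y : ℝ}
    (hs : ∀ k ∈ Ioo j j', s (k - 1) = s (k + 1) ∨ LiesBetween (s (k - 1)) (s k) (s (k + 1)))
    (hG : ∀ k ∈ Ioo j j', 0 < G k ∧ K k = G k * (s (k + 1) - s (k - 1)))
    (hl : ∀ t ∈ Ioo t₀ t₁, ∀ k ∈ Ioo j j', x (k - 1) t < x k t)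
    (hmono : ∀ t ∈ Ioo t₀ t₁, ∀ k l, k ≤ l → l ≤ j' → x k t ≤ x l t)
    (hrel : ∀ t ∈ Icc t₀ t₁, ∀ k ∈ Ico j j',
      s k * x k t + p k t = s (k + 1) * x k t + p (k + 1) t)
    (hd : ∀ t ∈ Ioo t₀ t₁, ∀ k ∈ Icc j j', HasDerivAt (p k) (K k / (x k t - x (k - 1) t)) t)
    (hx : ∀ k ≤ j', ContinuousOn (x k) (Icc t₀ t₁))
    (hp : ∀ k ∈ Icc j j', ContinuousOn (p k) (Icc t₀ t₁))
    (hy : ∀ k ∈ Ico j j', x k t₁ = y) (hj : x (j - 1) t₁ < x j t₁)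
    (hj' : x (j' - 1) t₁ < x j' t₁) {i : ℕ} (hi : i ∈ Ioo j j') :
    ¬ (s (i - 1) < s i ∧ s i < s (i + 1)) := by
  rintro ⟨hi1, hi2⟩
  obtain ⟨hji, hij'⟩ := hi
  classical
  -- Faces `a` and `b` bound the maximal run of increasing slopes around face `i`, within the range
  -- from `j` to `j'`.
  have hb : ∃ b, i + 1 ≤ b ∧ (b = j' ∨ s (b + 1) ≤ s b) := ⟨j', hij', Or.inl rfl⟩
  obtain ⟨hb1, hb2⟩ := Nat.find_spec hb
  set b := Nat.find hb with hbdef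
  have hbj : b ≤ j' := Nat.find_min' hb ⟨hij', Or.inl rfl⟩
  have hbmin : ∀ k, i + 1 ≤ k → k < b → s k < s (k + 1) := by
    intro k hk hkb
    have := Nat.find_min hb hkb
    push Not at this
    exact (this hk).2
  set Q : ℕ → Prop := fun a => a = j ∨ s a ≤ s (a - 1) with hQ
  set a := Nat.findGreatest (fun a => j ≤ a ∧ Q a) (i - 1) with hadef
  have ha : j ≤ a ∧ Q a := Nat.findGreatest_spec (P := fun a => j ≤ a ∧ Q a) (m := j)
    (by omega) ⟨le_rfl, Or.inl rfl⟩
  have hai : a ≤ i - 1 := Nat.findGreatest_le _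
  have hamax : ∀ k, a < k → k ≤ i - 1 → s (k - 1) < s k := by
    intro k hk hki
    have := Nat.findGreatest_is_greatest hk hki
    simp only [hQ] at this
    push Not at this
    exact (this (ha.1.trans hk.le)).2
  have hinc : ∀ k ∈ Ico a b, s k < s (k + 1) := by
    intro k hk
    rcases lt_trichotomy k i with h | rfl | h
    · rcases eq_or_lt_of_le (Nat.le_sub_one_of_lt h) with e | e
      · rw [e, Nat.sub_add_cancel (by omega)]
        exact hi1
      · simpa using hamax (k + 1) (by have := hk.1; omega) (by omega)
    · exact hi2
    · exact hbmin k h hk.2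
  -- Where the run stops strictly inside the range, the slopes turn back, so the force is zero.
  -- Otherwise the run stops at a surviving face. Either way the velocity there is bounded above.
  have hzero : ∀ k ∈ Ioo j j', ¬ LiesBetween (s (k - 1)) (s k) (s (k + 1)) → K k = 0 := by
    intro k hk hn
    rw [(hG k hk).2, (hs k hk).resolve_right hn, sub_self, mul_zero]
  refine not_collapse_of_increasing ht (K := K) (x := x) (p := p) (a := a) (i := i) (b := b)
    (y := y) (by omega) hb1 hinc (fun t ht' => hl t ht' i ⟨hji, hij'⟩)
    (fun t ht' k l hkl hlb => hmono t ht' k l hkl (hlb.trans hbj))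
    (fun t ht' k hk => hrel t ht' k ⟨ha.1.trans hk.1, hk.2.trans_le hbj⟩)
    (fun t ht' k hk => hd t ht' k ⟨ha.1.trans hk.1, hk.2.trans hbj⟩)
    (fun k hk => hx k (hk.trans hbj))
    (fun k hk => hp k ⟨ha.1.trans hk.1, hk.2.trans hbj⟩)
    (fun k hk => hy k ⟨ha.1.trans hk.1, hk.2.trans_le hbj⟩) ?_ ?_ ?_
  · rcases ha.2 with e | e
    · right
      rwa [e]
    · rcases eq_or_lt_of_le ha.1 with e' | e'
      · right
        rwa [← e']
      left
      refine hzero a ⟨e', by omega⟩ ?_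
      have := hinc a ⟨le_rfl, by omega⟩
      rintro (⟨h1, h2⟩ | ⟨h1, h2⟩) <;> linarith
  · rcases hb2 with e | e
    · right
      rwa [e]
    · rcases eq_or_lt_of_le hbj with e' | e'
      · right
        rwa [e']
      left
      refine hzero b ⟨by omega, e'⟩ ?_
      have := hinc (b - 1) ⟨by omega, by omega⟩
      rw [Nat.sub_add_cancel (by omega)] at this
      rintro (⟨h1, h2⟩ | ⟨h1, h2⟩) <;> linarith
  · rw [(hG i ⟨hji, hij'⟩).2]
    exact mul_pos (hG i ⟨hji, hij'⟩).1 (by linarith)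

/-- Faces that shrink to a common point between two surviving faces have zero curvature. -/
lemma alternating_of_collapse {t₀ t₁ : ℝ} (ht : t₀ < t₁) {s K G : ℕ → ℝ} {x p : ℕ → ℝ → ℝ}
    {j j' : ℕ} {y : ℝ}
    (hs : ∀ k ∈ Ioo j j', s (k - 1) = s (k + 1) ∨ LiesBetween (s (k - 1)) (s k) (s (k + 1)))
    (hG : ∀ k ∈ Ioo j j', 0 < G k ∧ K k = G k * (s (k + 1) - s (k - 1)))
    (hl : ∀ t ∈ Ioo t₀ t₁, ∀ k ∈ Ioo j j', x (k - 1) t < x k t)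
    (hmono : ∀ t ∈ Ioo t₀ t₁, ∀ k l, k ≤ l → l ≤ j' → x k t ≤ x l t)
    (hrel : ∀ t ∈ Icc t₀ t₁, ∀ k ∈ Ico j j',
      s k * x k t + p k t = s (k + 1) * x k t + p (k + 1) t)
    (hd : ∀ t ∈ Ioo t₀ t₁, ∀ k ∈ Icc j j', HasDerivAt (p k) (K k / (x k t - x (k - 1) t)) t)
    (hx : ∀ k ≤ j', ContinuousOn (x k) (Icc t₀ t₁))
    (hp : ∀ k ∈ Icc j j', ContinuousOn (p k) (Icc t₀ t₁))
    (hy : ∀ k ∈ Ico j j', x k t₁ = y) (hj : x (j - 1) t₁ < x j t₁)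
    (hj' : x (j' - 1) t₁ < x j' t₁) {i : ℕ} (hi : i ∈ Ioo j j') : s (i - 1) = s (i + 1) := by
  rcases hs i hi with h | h | h
  · exact h
  · exact (not_increasing_of_collapse ht hs hG hl hmono hrel hd hx hp hy hj hj' hi h).elim
  -- The concave case is the convex one for the reflected profile `-v`.
  · refine (not_increasing_of_collapse ht (s := fun k => -s k) (K := fun k => -K k) (G := G)
      (x := x) (p := fun k t => -p k t) ?_ ?_ hl hmono ?_ ?_ hx (fun k hk => (hp k hk).neg) hy hj
      hj' hi ⟨neg_lt_neg h.2, neg_lt_neg h.1⟩).elim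
    · intro k hk
      refine (hs k hk).imp (fun e => by rw [e]) ?_
      rintro (⟨h1, h2⟩ | ⟨h1, h2⟩)
      · exact Or.inr ⟨neg_lt_neg h2, neg_lt_neg h1⟩
      · exact Or.inl ⟨neg_lt_neg h2, neg_lt_neg h1⟩
    · intro k hk
      refine ⟨(hG k hk).1, ?_⟩
      rw [(hG k hk).2]
      ring
    · intro t ht' k hk
      have := hrel t ht' k hk
      linarith
    · intro t ht' k hk
      rw [neg_div]
      exact (hd t ht' k hk).neg

/-- The slopes take only the two values `s j` and `s (j + 1)`, alternately, and the first is
excluded at `j'`. -/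
lemma eq_succ_of_alternating {s : ℕ → ℝ} {j j' : ℕ} (hjj : j < j')
    (h : ∀ i ∈ Ioo j j', s (i - 1) = s (i + 1)) (hne : s j ≠ s j') : s j' = s (j + 1) := by
  have key : ∀ i, j ≤ i → i < j' → (s i = s j ∧ s (i + 1) = s (j + 1)) ∨
      (s i = s (j + 1) ∧ s (i + 1) = s j) := by
    intro i hi
    induction i, hi using Nat.le_induction with
    | base => exact fun _ => Or.inl ⟨rfl, rfl⟩
    | succ n hn ih =>
      intro hlt
      have e := h (n + 1) ⟨by omega, hlt⟩
      simp only [Nat.add_sub_cancel] at e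
      rcases ih (by omega) with ⟨h1, h2⟩ | ⟨h1, h2⟩
      · exact Or.inr ⟨h2, e ▸ h1⟩
      · exact Or.inl ⟨h2, e ▸ h1⟩
  have := key (j' - 1) (by omega) (by omega)
  rw [Nat.sub_add_cancel (by omega)] at this
  rcases this with h | h
  · exact h.2
  · exact (hne h.2.symm).elim

/-! ## Passage from one phase to the next -/

/-- Faces may have length zero here. Face `j` is the last one that starts to the left of `y`, and
`j'` the first that ends to its right; faces strictly between them have collapsed onto `y`. If `y`
is interior to a face, then `j = j'`. -/
lemma exists_adjacent_faces {N : ℕ} {X : ℕ → ℝ} (hX : ∀ i ∈ Icc 1 N, X (i - 1) ≤ X i)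
    (h0 : X 0 = 0) (h1 : X N = 1) {y : ℝ} (hy : y ∈ Ioo (0 : ℝ) 1) :
    ∃ j j', 1 ≤ j ∧ j ≤ j' ∧ j' ≤ N ∧ X (j - 1) < y ∧ y ≤ X j ∧ X (j' - 1) ≤ y ∧ y < X j' ∧
      ∀ k ∈ Ico j j', X k = y := by
  classical
  have hN : 1 ≤ N := by
    rcases Nat.eq_zero_or_pos N with rfl | h
    · rw [h0] at h1
      norm_num at h1
    · exact h
  set j := Nat.findGreatest (fun i => 1 ≤ i ∧ X (i - 1) < y) N with hj
  obtain ⟨hj1, hjy⟩ := Nat.findGreatest_spec (P := fun i => 1 ≤ i ∧ X (i - 1) < y) hN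
    ⟨le_rfl, by simpa [h0] using hy.1⟩
  have hjN : j ≤ N := Nat.findGreatest_le _
  have hyj : y ≤ X j := by
    rcases eq_or_lt_of_le hjN with e | e
    · rw [e, h1]
      exact hy.2.le
    · have := Nat.findGreatest_is_greatest (Nat.lt_succ_self j) e
      simpa using this
  have hex : ∃ i, 1 ≤ i ∧ y < X i := ⟨N, hN, h1 ▸ hy.2⟩
  obtain ⟨hf1, hfy⟩ := Nat.find_spec hex
  set j' := Nat.find hex with hj'
  have hfN : j' ≤ N := Nat.find_min' hex ⟨hN, h1 ▸ hy.2⟩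
  have hyf : X (j' - 1) ≤ y := by
    rcases eq_or_lt_of_le hf1 with e | e
    · rw [← e]
      simpa [h0] using hy.1.le
    · have := Nat.find_min hex (show j' - 1 < j' by omega)
      push Not at this
      exact this (by omega)
  refine ⟨j, j', hj1, ?_, hfN, hjy, hyj, hyf, hfy, ?_⟩
  · by_contra hlt
    have := corners_mono hX (show j' ≤ j - 1 by omega) (by omega)
    linarith
  · intro k hk
    have e1 := corners_mono hX hk.1 (by have := hk.2; omega)
    have e2 := corners_mono hX (show k ≤ j' - 1 by have := hk.2; omega) (by omega)
    linarith

lemma slope_eq_of_eq_affine {s q s' q' y z : ℝ} (hyz : y ≠ z) (h1 : s * y + q = s' * y + q')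
    (h2 : s * z + q = s' * z + q') : s = s' := by
  have : (s - s') * (y - z) = 0 := by linarith
  rcases mul_eq_zero.1 this with h | h
  · linarith
  · exact (hyz (by linarith)).elim

/-- At a transition consecutive slopes remain consecutive: faces disappear only in groups of zero
curvature. -/
lemma IsClosedPhase.exists_index_of_next {W : ℝ → ℝ} {S : Set ℝ} {a b t₀ t₁ t₂ : ℝ}
    {v : ℝ → ℝ → ℝ} {N N' : ℕ} {s s' : ℕ → ℝ} {x p x' p' : ℕ → ℝ → ℝ}
    (h : IsClosedPhase W a b t₀ t₁ v N s x p) (hadj : AdjacentChain S N s)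
    (hG : ∀ k ∈ Icc 1 N, ∃ G > 0, faceForce W N s k = G * halfJump N s k)
    (ht : t₀ < t₁) (ht' : t₁ < t₂) (h' : IsNeumannPhase W S a b t₁ t₂ v N' s' x' p')
    {i : ℕ} (hi : i ∈ Ico 1 N') :
    ∃ j ∈ Ico 1 N, x j t₁ = x' i t₁ ∧ s' i = s j ∧ s' (i + 1) = s (j + 1) := by
  have m1 : t₁ ∈ Icc t₀ t₁ := right_mem_Icc.2 ht.le
  have m1' : t₁ ∈ Ico t₁ t₂ := left_mem_Ico.2 ht'
  have hle' : ∀ i ∈ Icc 1 N', x' (i - 1) t₁ ≤ x' i t₁ := fun i hi => (h'.x_lt t₁ m1' i hi).le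
  have hi1 : i ∈ Icc 1 N' := Ico_subset_Icc_self hi
  have hi2 : i + 1 ∈ Icc 1 N' := ⟨by omega, hi.2⟩
  have lt1 := h'.x_lt t₁ m1' i hi1
  have lt2 : x' i t₁ < x' (i + 1) t₁ := by simpa using h'.x_lt t₁ m1' (i + 1) hi2
  have hy : x' i t₁ ∈ Ioo (0 : ℝ) 1 := by
    constructor
    · exact (corners_mem_Icc (x := fun i => x' i t₁) hle' (h'.x_zero t₁ m1') (h'.x_last t₁ m1')
        ((Nat.sub_le i 1).trans hi1.2)).1.trans_lt lt1
    · exact lt2.trans_le (corners_mem_Icc (x := fun i => x' i t₁) hle' (h'.x_zero t₁ m1')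
        (h'.x_last t₁ m1') hi2.2).2
  set y := x' i t₁ with hydef
  obtain ⟨j, j', hj1, hjj, hjN, ly, yj, j'y, ly', hk⟩ :=
    exists_adjacent_faces (X := fun i => x i t₁) (h.x_le t₁ m1) (h.x_zero t₁ m1)
      (h.x_last t₁ m1) hy
  have mj : j ∈ Icc 1 N := ⟨hj1, hjj.trans hjN⟩
  have mj' : j' ∈ Icc 1 N := ⟨hj1.trans hjj, hjN⟩
  have e1 : s' i = s j := by
    -- Old face `j` and new face `i` overlap on `[z, y]`, and two affine formulas for the same
    -- profile have the same slope.
    set z := max (x' (i - 1) t₁) (x (j - 1) t₁) with hz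
    have hzy : z < y := max_lt lt1 ly
    have a1 := h'.profile t₁ m1' i hi1 y ⟨lt1.le, le_rfl⟩
    have a2 := h'.profile t₁ m1' i hi1 z ⟨le_max_left _ _, hzy.le⟩
    have b1 := h.profile t₁ m1 j mj y ⟨ly.le, yj⟩
    have b2 := h.profile t₁ m1 j mj z ⟨le_max_right _ _, hzy.le.trans yj⟩
    exact slope_eq_of_eq_affine hzy.ne (a2.symm.trans b2) (a1.symm.trans b1)
  have e2 : s' (i + 1) = s j' := by
    set z := min (x' (i + 1) t₁) (x j' t₁) with hz
    have hzy : y < z := lt_min lt2 ly'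
    have a1 := h'.profile t₁ m1' (i + 1) hi2 y ⟨by simp [hydef], lt2.le⟩
    have a2 := h'.profile t₁ m1' (i + 1) hi2 z ⟨by simpa using hzy.le, min_le_left _ _⟩
    have b1 := h.profile t₁ m1 j' mj' y ⟨j'y, ly'.le⟩
    have b2 := h.profile t₁ m1 j' mj' z ⟨j'y.trans hzy.le, min_le_right _ _⟩
    exact slope_eq_of_eq_affine hzy.ne (a1.symm.trans b1) (a2.symm.trans b2)
  -- A true corner remains at `y`. This gives `j < j'` and rules out that the alternating slopes
  -- return to `s j`.
  have hne : s j ≠ s j' := by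
    rw [← e1, ← e2]
    exact h'.slope_ne i hi
  have hlt : j < j' := lt_of_le_of_ne hjj fun e => hne (by rw [e])
  have inner : ∀ k ∈ Ioo j j', k ∈ Ioo 1 N := fun k hk => by
    have := hk.1
    have := hk.2
    exact ⟨by omega, by omega⟩
  have hG' : ∀ k, ∃ G, k ∈ Ioo j j' →
      0 < G ∧ faceForce W N s k = G * (s (k + 1) - s (k - 1)) := by
    intro k
    by_cases hkm : k ∈ Ioo j j'
    · have hk1 := (inner k hkm).1
      have hk2 := (inner k hkm).2
      obtain ⟨G, hG0, e⟩ := hG k ⟨hk1.le, hk2.le⟩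
      refine ⟨G / 2, fun _ => ⟨half_pos hG0, ?_⟩⟩
      rw [e, halfJump, reflSlope_of_mem ⟨by omega, by omega⟩,
        reflSlope_of_mem ⟨by omega, by omega⟩]
      ring
    · exact ⟨0, fun h => (hkm h).elim⟩
  choose G hG' using hG'
  have halt : ∀ i ∈ Ioo j j', s (i - 1) = s (i + 1) := by
    intro i hi
    refine alternating_of_collapse (K := faceForce W N s) (G := G) (x := x) (p := p)
      (y := y) ht ?_ hG' ?_ ?_ ?_ ?_ ?_ ?_ hk ?_ ?_ hi
    · intro k hk
      have := inner k hk
      have a1 := hadj (k - 1) ⟨by have := this.1; omega, by have := this.2; omega⟩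
      rw [Nat.sub_add_cancel this.1.le] at a1
      exact a1.eq_or_liesBetween (hadj k ⟨this.1.le, this.2⟩)
    · intro t ht k hk
      exact h.x_lt t (Ioo_subset_Ico_self ht) k (Ioo_subset_Icc_self (inner k hk))
    · intro t ht k l hkl hl
      exact corners_mono (x := fun i => x i t) (h.x_le t (Ioo_subset_Icc_self ht)) hkl
        (hl.trans hjN)
    · intro t ht k hk
      exact mul_add_intercept_eq (v := fun y => v y t) (x := fun i => x i t) (p := fun i => p i t)
        (h.x_le t ht) (h.profile t ht) ⟨hj1.trans hk.1, hk.2.trans_le hjN⟩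
    · intro t ht k hk
      have := h.face_motion t ht k ⟨hj1.trans hk.1, hk.2.trans hjN⟩
      rwa [faceVelocity_eq] at this
    · exact fun k hk => h.x_cont k (hk.trans hjN)
    · exact fun k hk => h.p_cont k ⟨hj1.trans hk.1, hk.2.trans hjN⟩
    · exact ly.trans_le yj
    · exact j'y.trans_lt ly'
  refine ⟨j, ⟨hj1, hlt.trans_le hjN⟩, hk j ⟨le_rfl, hlt⟩, e1, ?_⟩
  rw [e2]
  exact eq_succ_of_alternating hlt halt hne

/-- The interior corners of the new profile have distinct positions, each of them the position of an
old interior corner, so they inject into the old ones. -/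
lemma IsClosedPhase.card_le_of_next {W : ℝ → ℝ} {S : Set ℝ} {a b t₀ t₁ t₂ : ℝ}
    {v : ℝ → ℝ → ℝ} {N N' : ℕ} {s s' : ℕ → ℝ} {x p x' p' : ℕ → ℝ → ℝ}
    (h : IsClosedPhase W a b t₀ t₁ v N s x p) (ht' : t₁ < t₂)
    (h' : IsNeumannPhase W S a b t₁ t₂ v N' s' x' p')
    (hidx : ∀ i ∈ Ico 1 N', ∃ j ∈ Ico 1 N,
      x j t₁ = x' i t₁ ∧ s' i = s j ∧ s' (i + 1) = s (j + 1)) : N' ≤ N := by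
  have m1' : t₁ ∈ Ico t₁ t₂ := left_mem_Ico.2 ht'
  have hidx' : ∀ i, ∃ j, i ∈ Ico 1 N' → j ∈ Ico 1 N ∧ x j t₁ = x' i t₁ := by
    intro i
    by_cases hi : i ∈ Ico 1 N'
    · obtain ⟨j, hj, e, -⟩ := hidx i hi
      exact ⟨j, fun _ => ⟨hj, e⟩⟩
    · exact ⟨0, fun h => (hi h).elim⟩
  choose f hf using hidx'
  have lt_of_lt : ∀ i ∈ Ico 1 N', ∀ k ∈ Ico 1 N', i < k → x' i t₁ < x' k t₁ := by
    intro i hi k hk hik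
    have e1 := corners_mono (x := fun i => x' i t₁)
      (fun i hi => (h'.x_lt t₁ m1' i hi).le) (show i ≤ k - 1 by omega)
      (by have := hk.2; omega)
    exact e1.trans_lt (h'.x_lt t₁ m1' k (Ico_subset_Icc_self hk))
  have := Finset.card_le_card_of_injOn (s := Finset.Ico 1 N') (t := Finset.Ico 1 N) f
    (fun i hi => by
      have := (hf i (by simpa using hi)).1
      simpa using this)
    (fun i hi k hk e => by
      have hi' : i ∈ Ico 1 N' := by simpa using hi
      have hk' : k ∈ Ico 1 N' := by simpa using hk
      have e' : x' i t₁ = x' k t₁ := by rw [← (hf i hi').2, ← (hf k hk').2, e]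
      rcases lt_trichotomy i k with hl | hl | hl
      · exact ((lt_of_lt i hi' k hk' hl).ne e').elim
      · exact hl
      · exact ((lt_of_lt k hk' i hi' hl).ne' e').elim)
  rw [Nat.card_Ico, Nat.card_Ico] at this
  have := h.one_le
  omega

/-! ### Persistence of the initial properties through all phases -/

/-- The properties of the initial data that persist: consecutive slopes are adjacent and differ by
at most `m`, the slopes are bounded by `R`, and the number of faces is at most `n`. -/
structure IsControlled (S : Set ℝ) (n : ℕ) (m R : ℝ) (N : ℕ) (s : ℕ → ℝ) : Prop where
  adjacent : AdjacentChain S N s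
  jumps : 2 ≤ N → ∀ j ∈ Icc 1 (N + 1), |s j - s (j - 1)| ≤ m
  bound : ∀ i ∈ Icc 1 N, |s i| ≤ R
  card_le : N ≤ n

lemma IsControlled.exists_force_pos {W : ℝ → ℝ} (hW : ContDiff ℝ 3 W)
    (hconv : ∀ y : ℝ, 0 < deriv (deriv W) y) {S : Set ℝ} {n : ℕ} {m R : ℝ}
    {a b t₀ t₁ : ℝ} {v : ℝ → ℝ → ℝ} {N : ℕ} {s : ℕ → ℝ} {x p : ℕ → ℝ → ℝ}
    (hc : IsControlled S n m R N s)
    (h : IsNeumannPhase W S a b t₀ t₁ v N s x p) {i : ℕ} (hi : i ∈ Icc 1 N) :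
    ∃ G > 0, faceForce W N s i = G * halfJump N s i := by
  obtain ⟨ξ, -, e⟩ := h.exists_faceForce_eq hW hc.adjacent hi
  exact ⟨_, mul_pos (Real.sqrt_pos.2 (by positivity)) (hconv ξ), e⟩

namespace NeumannCrystallineFlow

variable {W : ℝ → ℝ} {S : Set ℝ} {a b T : ℝ}

lemma τ_mono (U : NeumannCrystallineFlow W S a b T) {k l : ℕ} (hkl : k ≤ l)
    (hl : l ≤ U.numPhases) : U.τ k ≤ U.τ l := by
  induction l, hkl using Nat.le_induction with
  | base => exact le_rfl
  | succ n hn ih => exact (ih (by omega)).trans (U.τ_lt n hl).le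

lemma τ_nonneg (U : NeumannCrystallineFlow W S a b T) {k : ℕ} (hk : k ≤ U.numPhases) :
    0 ≤ U.τ k := U.τ_zero.symm.le.trans (U.τ_mono (Nat.zero_le k) hk)

lemma τ_le (U : NeumannCrystallineFlow W S a b T) {k : ℕ} (hk : k ≤ U.numPhases) :
    U.τ k ≤ T := (U.τ_mono hk le_rfl).trans U.τ_last.le

lemma exists_closedPhase (U : NeumannCrystallineFlow W S a b T) {k : ℕ} (hk : k < U.numPhases) :
    ∃ x p, IsClosedPhase W a b (U.τ k) (U.τ (k + 1)) U.toFun (U.N k) (U.s k) x p ∧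
      ∀ t ∈ Ico (U.τ k) (U.τ (k + 1)), ∀ i, x i t = U.x k i t :=
  (U.phase k hk).exists_isClosedPhase (U.τ_lt k hk) (U.τ_nonneg hk.le) (U.τ_le hk) U.continuousOn

/-- Induction over the phases, since consecutive pairs of slopes are inherited. The extension slopes
are chosen anew in each phase and need a separate argument. -/
lemma isControlled (U : NeumannCrystallineFlow W S a b T) (hW : ContDiff ℝ 3 W)
    (hconv : ∀ y : ℝ, 0 < deriv (deriv W) y) {m R : ℝ} (hm : U.InitialJumpsLE m)
    (hR : ∀ i ∈ Set.Icc 1 (U.N 0), |U.s 0 i| ≤ R) {k : ℕ} (hk : k < U.numPhases) :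
    IsControlled S (U.N 0) m R (U.N k) (U.s k) := by
  have hpos : 0 < U.numPhases := by omega
  have h0 := U.phase 0 hpos
  have hN0 := h0.one_le
  -- Initially `a` lies strictly between two slopes adjacent to it. These are its only admissible
  -- neighbours, so every later extension slope is one of them; likewise for `b`.
  have ha : ∀ q, AdjacentSlopes S a q → |q - a| ≤ m := by
    intro q hq
    rw [← h0.first_slope] at hq ⊢
    rcases (U.initial_adjacent 0 (Nat.zero_le _)).eq_or_eq (U.initial_adjacent 1 hN0)
      h0.ext_left_between hq with rfl | rfl
    · rw [abs_sub_comm]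
      exact hm 1 ⟨le_rfl, by omega⟩
    · exact hm 2 ⟨by omega, by omega⟩
  have hb : ∀ q, AdjacentSlopes S b q → |q - b| ≤ m := by
    intro q hq
    rw [← h0.last_slope] at hq ⊢
    have h1 := U.initial_adjacent (U.N 0 - 1) (by omega)
    rw [Nat.sub_add_cancel hN0] at h1
    rcases h1.eq_or_eq (U.initial_adjacent (U.N 0) le_rfl) h0.ext_right_between hq with rfl | rfl
    · rw [abs_sub_comm]
      exact hm (U.N 0) ⟨hN0, by omega⟩
    · simpa using hm (U.N 0 + 1) ⟨by omega, le_rfl⟩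
  induction k with
  | zero =>
    exact ⟨fun i hi => U.initial_adjacent i hi.2.le, fun _ => hm, hR, le_rfl⟩
  | succ k ih =>
    have hk' : k < U.numPhases := by omega
    have c := ih hk'
    obtain ⟨x, p, hcl, -⟩ := U.exists_closedPhase hk'
    have hn := U.phase (k + 1) hk
    have idx := fun i hi => hcl.exists_index_of_next (i := i) c.adjacent
      (fun k hk => c.exists_force_pos hW hconv (U.phase _ hk') hk)
      (U.τ_lt k hk') (U.τ_lt (k + 1) hk) hn hi
    refine ⟨?_, ?_, ?_, (hcl.card_le_of_next (U.τ_lt (k + 1) hk) hn idx).trans c.card_le⟩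
    · intro i hi
      obtain ⟨j, hj, -, e1, e2⟩ := idx i hi
      rw [e1, e2]
      exact c.adjacent j hj
    · intro hN j hj
      rcases eq_or_ne j 1 with rfl | hj1
      · have := hn.ext_left.symm
        rw [hn.first_slope] at this
        rw [abs_sub_comm, hn.first_slope]
        exact ha _ this
      rcases eq_or_ne j (U.N (k + 1) + 1) with rfl | hjN
      · have := hn.ext_right
        rw [hn.last_slope] at this
        rw [Nat.add_sub_cancel, hn.last_slope]
        exact hb _ this
      · obtain ⟨hj2, hj3⟩ := hj
        obtain ⟨i, hi, -, e1, e2⟩ := idx (j - 1) ⟨by omega, by omega⟩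
        rw [Nat.sub_add_cancel hj2] at e2
        rw [e1, e2]
        obtain ⟨hi1, hi2⟩ := hi
        simpa using c.jumps (by omega) (i + 1) ⟨by omega, by omega⟩
    · intro i hi
      rcases eq_or_ne i 1 with rfl | hi1
      · rw [hn.first_slope, ← (U.phase k hk').first_slope]
        exact c.bound 1 ⟨le_rfl, (U.phase k hk').one_le⟩
      · obtain ⟨hi2, hi3⟩ := hi
        obtain ⟨j, hj, -, -, e2⟩ := idx (i - 1) ⟨by omega, by omega⟩
        rw [Nat.sub_add_cancel hi2] at e2
        rw [e2]
        exact c.bound (j + 1) ⟨by omega, hj.2⟩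

end NeumannCrystallineFlow

/-! ## Consistency of the scheme -/

/-- The mobility `√(1 + p²) W''(p)`. -/
def mobility (W : ℝ → ℝ) (p : ℝ) : ℝ := √(1 + p ^ 2) * deriv (deriv W) p

/-- The flux, a primitive of the mobility. -/
def flux (W : ℝ → ℝ) (p : ℝ) : ℝ := ∫ q in (0 : ℝ)..p, mobility W q

lemma contDiff_mobility {W : ℝ → ℝ} (hW : ContDiff ℝ 3 W) : ContDiff ℝ 1 (mobility W) := by
  have h : ContDiff ℝ 1 fun p : ℝ => √(1 + p ^ 2) :=
    (contDiff_const.add (contDiff_id.pow 2)).sqrt fun p => by positivity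
  exact h.mul hW.contDiff_deriv_deriv

lemma hasDerivAt_flux {W : ℝ → ℝ} (hW : ContDiff ℝ 3 W) (p : ℝ) :
    HasDerivAt (flux W) (mobility W p) p := by
  have hc := (contDiff_mobility hW).continuous
  exact intervalIntegral.integral_hasDerivAt_right (hc.intervalIntegrable _ _)
    (hc.stronglyMeasurableAtFilter _ _) hc.continuousAt

lemma ContDiff.exists_lipschitz_Icc {f : ℝ → ℝ} (hf : ContDiff ℝ 1 f) (ρ : ℝ) :
    ∃ L, 0 ≤ L ∧ ∀ x ∈ Icc (-ρ) ρ, ∀ y ∈ Icc (-ρ) ρ, |f x - f y| ≤ L * |x - y| := by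
  obtain ⟨L, hL⟩ := isCompact_Icc.exists_bound_of_continuousOn
    (s := Icc (-ρ) ρ) (hf.continuous_deriv le_rfl).continuousOn
  refine ⟨max L 0, le_max_right _ _, fun x hx y hy => ?_⟩
  exact (convex_Icc (-ρ) ρ).norm_image_sub_le_of_norm_deriv_le (f := f)
    (fun z _ => hf.differentiable (by norm_num) z)
    (fun z hz => (hL z hz).trans (le_max_left _ _)) hy hx

lemma one_le_sqrt_one_add_sq (s : ℝ) : 1 ≤ √(1 + s ^ 2) :=
  Real.one_le_sqrt.2 (by nlinarith [sq_nonneg s])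

/-- Bounds on the coefficients of the scheme and of the equation for slopes in `[-ρ, ρ]`. -/
lemma exists_coefficient_bounds {W : ℝ → ℝ} (hW : ContDiff ℝ 3 W)
    (hconv : ∀ y : ℝ, 0 < deriv (deriv W) y) (ρ : ℝ) :
    ∃ γ L : ℝ, 0 < γ ∧ 0 ≤ L ∧
      (∀ p ∈ Icc (-ρ) ρ, ∀ q ∈ Icc (-ρ) ρ, |mobility W p - mobility W q| ≤ L * |p - q|) ∧
      ∀ s ∈ Icc (-ρ) ρ, ∀ ξ ∈ Icc (-ρ) ρ, γ ≤ √(1 + s ^ 2) * deriv (deriv W) ξ ∧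
        |√(1 + s ^ 2) * deriv (deriv W) ξ - mobility W s| ≤ L * |ξ - s| := by
  obtain ⟨L₁, hL₁, h1⟩ := (contDiff_mobility hW).exists_lipschitz_Icc ρ
  obtain ⟨L₂, hL₂, h2⟩ := hW.contDiff_deriv_deriv.exists_lipschitz_Icc ρ
  have hγ : ∃ γ, 0 < γ ∧ ∀ ξ ∈ Icc (-ρ) ρ, γ ≤ deriv (deriv W) ξ := by
    rcases (Icc (-ρ) ρ).eq_empty_or_nonempty with he | hne
    · exact ⟨1, one_pos, fun ξ hξ => by simp [he] at hξ⟩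
    · obtain ⟨z, -, hz⟩ := isCompact_Icc.exists_isMinOn hne
        hW.contDiff_deriv_deriv.continuous.continuousOn
      exact ⟨_, hconv z, fun ξ hξ => hz hξ⟩
  obtain ⟨γ, hγ0, hγ⟩ := hγ
  refine ⟨γ, max L₁ (√(1 + ρ ^ 2) * L₂), hγ0, hL₁.trans (le_max_left _ _), ?_, ?_⟩
  · intro p hp q hq
    exact (h1 p hp q hq).trans (mul_le_mul_of_nonneg_right (le_max_left _ _) (abs_nonneg _))
  · intro s hs ξ hξ
    constructor
    · exact (hγ ξ hξ).trans (le_mul_of_one_le_left (hconv ξ).le (one_le_sqrt_one_add_sq s))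
    · rw [mobility, ← mul_sub, abs_mul, abs_of_nonneg (Real.sqrt_nonneg _)]
      have e : √(1 + s ^ 2) ≤ √(1 + ρ ^ 2) :=
        Real.sqrt_le_sqrt (by nlinarith [sq_le_sq' hs.1 hs.2])
      calc √(1 + s ^ 2) * |deriv (deriv W) ξ - deriv (deriv W) s|
          ≤ √(1 + ρ ^ 2) * (L₂ * |ξ - s|) :=
            mul_le_mul e (h2 ξ hξ s hs) (abs_nonneg _) (Real.sqrt_nonneg _)
        _ = √(1 + ρ ^ 2) * L₂ * |ξ - s| := by ring
        _ ≤ _ := mul_le_mul_of_nonneg_right (le_max_right _ _) (abs_nonneg _)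

lemma mem_Icc_of_abs_sub_le {s ξ m R ρ : ℝ} (hs : |s| ≤ R) (hξ : |ξ - s| ≤ m) (hρ : R + m ≤ ρ) :
    ξ ∈ Icc (-ρ) ρ := by
  rw [abs_le] at hs hξ
  exact ⟨by linarith, by linarith⟩

lemma IsControlled.abs_reflSlope_sub_le {S : Set ℝ} {n : ℕ} {m R : ℝ} {N : ℕ} {s : ℕ → ℝ}
    (hc : IsControlled S n m R N s) (hm : 0 ≤ m) (hN : 1 ≤ N) {i : ℕ} (hi : i ≤ N) :
    |reflSlope N s (i + 1) - reflSlope N s i| ≤ m := by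
  rcases Nat.eq_zero_or_pos i with rfl | h0
  · rw [reflSlope_of_mem ⟨le_rfl, hN⟩]
    simpa [reflSlope] using hm
  rcases eq_or_lt_of_le hi with rfl | hlt
  · rw [reflSlope_of_mem (i := i) ⟨h0, le_rfl⟩]
    simpa [reflSlope] using hm
  · rw [reflSlope_of_mem ⟨by omega, hlt⟩, reflSlope_of_mem ⟨h0, hi⟩]
    simpa using hc.jumps (by omega) (i + 1) ⟨by omega, by omega⟩

lemma IsControlled.abs_halfJump_le {S : Set ℝ} {n : ℕ} {m R : ℝ} {N : ℕ} {s : ℕ → ℝ}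
    (hc : IsControlled S n m R N s) (hm : 0 ≤ m) {i : ℕ} (hi : i < N) :
    |halfJump N s (i + 1)| ≤ m := by
  have h1 := hc.abs_reflSlope_sub_le hm (by omega) (show i + 1 ≤ N from hi)
  have h2 := hc.abs_reflSlope_sub_le hm (by omega) hi.le
  rw [abs_le] at h1 h2 ⊢
  rw [halfJump, Nat.add_sub_cancel]
  constructor <;> linarith

/-- The mean of the reflected slopes at corner `i`. -/
def cornerSlope (N : ℕ) (s : ℕ → ℝ) (i : ℕ) : ℝ :=
  (reflSlope N s i + reflSlope N s (i + 1)) / 2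

lemma cornerSlope_zero {N : ℕ} (hN : 1 ≤ N) (s : ℕ → ℝ) : cornerSlope N s 0 = s 1 := by
  rw [cornerSlope, reflSlope_of_mem (i := 0 + 1) ⟨le_rfl, hN⟩]
  simp [reflSlope]

lemma cornerSlope_last {N : ℕ} (hN : 1 ≤ N) (s : ℕ → ℝ) : cornerSlope N s N = s N := by
  rw [cornerSlope, reflSlope_of_mem (i := N) ⟨hN, le_rfl⟩]
  simp [reflSlope]

lemma cornerSlope_sub (N : ℕ) (s : ℕ → ℝ) (i : ℕ) :
    cornerSlope N s (i + 1) - cornerSlope N s i = halfJump N s (i + 1) := by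
  rw [cornerSlope, cornerSlope, halfJump, Nat.add_sub_cancel]
  ring

/-- The mean value inequality for the flux minus the linear function whose slope is the mobility at
`s`. -/
lemma flux_sub_close {W : ℝ → ℝ} (hW : ContDiff ℝ 3 W) {L m ρ s μ ν : ℝ} (hL : 0 ≤ L)
    (hlip : ∀ p ∈ Icc (-ρ) ρ, ∀ q ∈ Icc (-ρ) ρ, |mobility W p - mobility W q| ≤ L * |p - q|)
    (hs : s ∈ Icc (-ρ) ρ) (hsub : Icc (s - m) (s + m) ⊆ Icc (-ρ) ρ)
    (hμ : μ ∈ Icc (s - m) (s + m)) (hν : ν ∈ Icc (s - m) (s + m)) :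
    |flux W μ - flux W ν - mobility W s * (μ - ν)| ≤ L * m * |μ - ν| := by
  have := (convex_Icc (s - m) (s + m)).norm_image_sub_le_of_norm_hasDerivWithin_le
    (f := fun y => flux W y - mobility W s * y) (f' := fun y => mobility W y - mobility W s * 1)
    (C := L * m)
    (fun y _ => ((hasDerivAt_flux hW y).sub ((hasDerivAt_id y).const_mul _)).hasDerivWithinAt)
    (fun y hy => by
      rw [mul_one]
      refine (hlip y (hsub hy) s hs).trans (mul_le_mul_of_nonneg_left ?_ hL)
      rw [abs_le]
      exact ⟨by linarith [hy.1], by linarith [hy.2]⟩) hν hμ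
  rw [Real.norm_eq_abs, Real.norm_eq_abs] at this
  convert this using 2
  ring

/-- The total force on the faces approximates the difference of the fluxes at the end points. -/
lemma IsControlled.abs_sum_force_sub_le {W : ℝ → ℝ} (hW : ContDiff ℝ 3 W) {γ L ρ : ℝ}
    (hL : 0 ≤ L)
    (hlip : ∀ p ∈ Icc (-ρ) ρ, ∀ q ∈ Icc (-ρ) ρ, |mobility W p - mobility W q| ≤ L * |p - q|)
    (hcoef : ∀ s ∈ Icc (-ρ) ρ, ∀ ξ ∈ Icc (-ρ) ρ, γ ≤ √(1 + s ^ 2) * deriv (deriv W) ξ ∧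
        |√(1 + s ^ 2) * deriv (deriv W) ξ - mobility W s| ≤ L * |ξ - s|)
    {S : Set ℝ} {n : ℕ} {m R a b t₀ t₁ : ℝ} {v : ℝ → ℝ → ℝ} {N : ℕ} {s : ℕ → ℝ}
    {x p : ℕ → ℝ → ℝ} (hm : 0 ≤ m) (hρ : R + m ≤ ρ) (hc : IsControlled S n m R N s)
    (h : IsNeumannPhase W S a b t₀ t₁ v N s x p) :
    |∑ i ∈ Finset.range N, faceForce W N s (i + 1) - (flux W b - flux W a)|
      ≤ N * (2 * L * m ^ 2) := by
  -- Thanks to the reflection the averaged corner slopes start at `a` and end at `b`, and their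
  -- increments are exactly the half jumps in the forces.
  have tel : flux W b - flux W a
      = ∑ i ∈ Finset.range N, (flux W (cornerSlope N s (i + 1)) - flux W (cornerSlope N s i)) := by
    rw [Finset.sum_range_sub (fun i => flux W (cornerSlope N s i)), cornerSlope_zero h.one_le,
      cornerSlope_last h.one_le, h.first_slope, h.last_slope]
  rw [tel, ← Finset.sum_sub_distrib]
  refine (Finset.abs_sum_le_sum_abs _ _).trans ?_
  have key : ∀ i ∈ Finset.range N, |faceForce W N s (i + 1)
      - (flux W (cornerSlope N s (i + 1)) - flux W (cornerSlope N s i))| ≤ 2 * L * m ^ 2 := by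
    intro i hi
    have hiN : i < N := Finset.mem_range.1 hi
    have mi : i + 1 ∈ Icc 1 N := ⟨by omega, hiN⟩
    obtain ⟨ξ, hξ, e⟩ := h.exists_faceForce_eq hW hc.adjacent mi
    have hξm := hξ m hm hc.jumps
    have hs := mem_Icc_of_abs_sub_le (hc.bound _ mi) (by simpa using hm : |s (i + 1) - s (i + 1)| ≤ m) hρ
    have hξρ := mem_Icc_of_abs_sub_le (hc.bound _ mi) hξm hρ
    have hd := hc.abs_halfJump_le hm hiN
    have r1 := abs_le.1 (hc.abs_reflSlope_sub_le hm h.one_le (show i + 1 ≤ N from hiN))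
    have r2 := abs_le.1 (hc.abs_reflSlope_sub_le hm h.one_le hiN.le)
    have er := reflSlope_of_mem (s := s) mi
    have hμ : cornerSlope N s (i + 1) ∈ Icc (s (i + 1) - m) (s (i + 1) + m) := by
      rw [cornerSlope, er]
      rw [er] at r1
      exact ⟨by linarith, by linarith⟩
    have hν : cornerSlope N s i ∈ Icc (s (i + 1) - m) (s (i + 1) + m) := by
      rw [cornerSlope, er]
      rw [er] at r2
      exact ⟨by linarith, by linarith⟩
    have f1 := flux_sub_close hW hL hlip hs
      (fun y hy => mem_Icc_of_abs_sub_le (hc.bound _ mi)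
        (abs_le.2 ⟨by linarith [hy.1], by linarith [hy.2]⟩) hρ) hμ hν
    rw [cornerSlope_sub] at f1
    have f2 : |faceForce W N s (i + 1) - mobility W (s (i + 1)) * halfJump N s (i + 1)|
        ≤ L * m * |halfJump N s (i + 1)| := by
      rw [e, ← sub_mul, abs_mul]
      exact mul_le_mul_of_nonneg_right (((hcoef _ hs ξ hξρ).2).trans
        (mul_le_mul_of_nonneg_left hξm hL)) (abs_nonneg _)
    have f3 : L * m * |halfJump N s (i + 1)| ≤ L * m * m :=
      mul_le_mul_of_nonneg_left hd (mul_nonneg hL hm)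
    rw [abs_le] at f1 f2 ⊢
    constructor <;> linarith
  refine (Finset.sum_le_sum key).trans ?_
  simp

/-! ## Evolution of the means -/

lemma IsNeumannSolution.timeDeriv_eq {W : ℝ → ℝ} {a b T : ℝ} {u : ℝ → ℝ → ℝ}
    (h : IsNeumannSolution W a b T u) {x t : ℝ} (hx : x ∈ Icc (0 : ℝ) 1) (ht : t ∈ Icc 0 T) :
    timeDeriv T u x t = mobility W (spaceDeriv u x t) * spaceDeriv2 u x t := by
  have := h.equation x hx t ht
  rw [div_eq_iff (Real.sqrt_pos.2 (by positivity)).ne'] at this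
  rw [this, mobility]
  ring

/-- The equation in divergence form: `u_t` is the space derivative of `flux W u_x`. -/
lemma IsNeumannSolution.hasDerivAt_integral {W : ℝ → ℝ} (hW : ContDiff ℝ 3 W) {a b T : ℝ}
    {u : ℝ → ℝ → ℝ} (hT : 0 < T) (h : IsNeumannSolution W a b T u) {t : ℝ} (ht : t ∈ Ioo 0 T) :
    HasDerivAt (fun r => ∫ y in (0 : ℝ)..1, u y r) (flux W b - flux W a) t := by
  have hr := h.contDiffOn.isRegularOnRect hT
  have ht' := Ioo_subset_Icc_self ht
  have e : ∫ y in (0 : ℝ)..1, timeDeriv T u y t = flux W b - flux W a := by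
    rw [integral_eq_sub_of_subset_Icc (f := fun y => flux W (spaceDeriv u y t)) ?_
      (hr.cont_t.slice_rect ht') ?_ le_rfl zero_le_one le_rfl, h.left_slope t ht',
      h.right_slope t ht']
    · exact (continuous_iff_continuousAt.2 fun p => (hasDerivAt_flux hW p).continuousAt).comp_continuousOn
        (hr.cont_x.slice_rect ht')
    · intro x hx
      rw [h.timeDeriv_eq (Ioo_subset_Icc_self hx) ht']
      exact (hasDerivAt_flux hW _).comp x (hr.deriv_xx x hx t ht')
  rw [← e]
  exact hasDerivAt_integral_rect hr.cont hr.cont_t hr.deriv_t ht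

/-- The velocity of corner `i`; the two end points of `[0,1]` are at rest. -/
def cornerVelocity (W : ℝ → ℝ) (N : ℕ) (s : ℕ → ℝ) (x : ℕ → ℝ → ℝ) (t : ℝ) (i : ℕ) : ℝ :=
  if i = 0 ∨ i = N then 0
  else -((faceVelocity W N s x t (i + 1) - faceVelocity W N s x t i) / (s (i + 1) - s i))

namespace IsClosedPhase

variable {W : ℝ → ℝ} {a b t₀ t₁ : ℝ} {v : ℝ → ℝ → ℝ} {N : ℕ} {s : ℕ → ℝ} {x p : ℕ → ℝ → ℝ}

lemma hasDerivAt_corner (h : IsClosedPhase W a b t₀ t₁ v N s x p) {t : ℝ} (ht : t ∈ Ioo t₀ t₁)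
    {i : ℕ} (hi : i ≤ N) : HasDerivAt (x i) (cornerVelocity W N s x t i) t := by
  have hnhds : ∀ᶠ r in nhds t, r ∈ Icc t₀ t₁ := Icc_mem_nhds ht.1 ht.2
  rcases eq_or_ne i 0 with rfl | h0
  · rw [cornerVelocity, if_pos (Or.inl rfl)]
    refine (hasDerivAt_const t (0 : ℝ)).congr_of_eventuallyEq ?_
    filter_upwards [hnhds] with r hr
    exact h.x_zero r hr
  rcases eq_or_ne i N with rfl | hN
  · rw [cornerVelocity, if_pos (Or.inr rfl)]
    refine (hasDerivAt_const t (1 : ℝ)).congr_of_eventuallyEq ?_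
    filter_upwards [hnhds] with r hr
    exact h.x_last r hr
  · rw [cornerVelocity, if_neg (by tauto)]
    exact h.corner_motion t ht i ⟨by omega, by omega⟩

lemma corner_mem (h : IsClosedPhase W a b t₀ t₁ v N s x p) {t : ℝ} (ht : t ∈ Icc t₀ t₁)
    {i : ℕ} (hi : i ≤ N) : x i t ∈ Icc (0 : ℝ) 1 :=
  corners_mem_Icc (x := fun i => x i t) (h.x_le t ht) (h.x_zero t ht) (h.x_last t ht) hi

lemma corner_le_succ (h : IsClosedPhase W a b t₀ t₁ v N s x p) {t : ℝ} (ht : t ∈ Icc t₀ t₁)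
    {i : ℕ} (hi : i < N) : x i t ≤ x (i + 1) t := by
  simpa using h.x_le t ht (i + 1) ⟨by omega, hi⟩

lemma integral_eq_sum (h : IsClosedPhase W a b t₀ t₁ v N s x p) {t : ℝ} (ht : t ∈ Icc t₀ t₁)
    {f : ℝ → ℝ}
    (hf : ∀ i < N, IntervalIntegrable f MeasureTheory.volume (x i t) (x (i + 1) t)) :
    ∫ y in (0 : ℝ)..1, f y = ∑ i ∈ Finset.range N, ∫ y in x i t..x (i + 1) t, f y := by
  rw [intervalIntegral.sum_integral_adjacent_intervals (a := fun i => x i t) hf, h.x_zero t ht,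
    h.x_last t ht]

lemma integral_profile (h : IsClosedPhase W a b t₀ t₁ v N s x p) {t : ℝ} (ht : t ∈ Icc t₀ t₁) :
    ∫ y in (0 : ℝ)..1, v y t = ∑ i ∈ Finset.range N,
      (s (i + 1) * ((x (i + 1) t ^ 2 - x i t ^ 2) / 2)
        + p (i + 1) t * (x (i + 1) t - x i t)) := by
  have hprof : ∀ i < N, EqOn (fun y => v y t) (fun y => s (i + 1) * y + p (i + 1) t)
      (uIcc (x i t) (x (i + 1) t)) := by
    intro i hi y hy
    rw [uIcc_of_le (h.corner_le_succ ht hi)] at hy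
    exact h.profile t ht (i + 1) ⟨by omega, hi⟩ y (by simpa using hy)
  have hlin : ∀ i : ℕ, Continuous fun y => s (i + 1) * y + p (i + 1) t := fun i => by fun_prop
  rw [h.integral_eq_sum ht (f := fun y => v y t) fun i hi =>
    ((hlin i).intervalIntegrable _ _).congr fun y hy =>
      (hprof i hi (uIoc_subset_uIcc hy)).symm]
  refine Finset.sum_congr rfl fun i hi => ?_
  rw [intervalIntegral.integral_congr (hprof i (Finset.mem_range.1 hi)),
    intervalIntegral.integral_add (by apply Continuous.intervalIntegrable; fun_prop)
      intervalIntegrable_const, intervalIntegral.integral_const_mul, integral_id,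
    intervalIntegral.integral_const, smul_eq_mul, mul_comm (p _ _)]

/-- The derivative of the mean of the discrete solution is the total force. -/
lemma hasDerivAt_integral (h : IsClosedPhase W a b t₀ t₁ v N s x p) {t : ℝ}
    (ht : t ∈ Ioo t₀ t₁) :
    HasDerivAt (fun r => ∫ y in (0 : ℝ)..1, v y r)
      (∑ i ∈ Finset.range N, faceForce W N s (i + 1)) t := by
  have ht' := Ioo_subset_Icc_self ht
  set z := cornerVelocity W N s x t with hz
  -- Leibniz rule on one face: its force plus the boundary terms of its moving ends. These telescope
  -- because `v` is continuous across corners, and the two ends of `[0,1]` are at rest.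
  have hterm : ∀ i ∈ Finset.range N, HasDerivAt (fun r =>
      s (i + 1) * ((x (i + 1) r ^ 2 - x i r ^ 2) / 2) + p (i + 1) r * (x (i + 1) r - x i r))
      (faceForce W N s (i + 1) + (z (i + 1) * v (x (i + 1) t) t - z i * v (x i t) t)) t := by
    intro i hi
    have hiN := Finset.mem_range.1 hi
    have mi : i + 1 ∈ Icc 1 N := ⟨by omega, hiN⟩
    have d1 := h.hasDerivAt_corner ht (show i + 1 ≤ N from hiN)
    have d0 := h.hasDerivAt_corner ht hiN.le
    have dp := h.face_motion t ht (i + 1) mi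
    have hle := h.corner_le_succ ht' hiN
    have lt := h.x_lt t (Ioo_subset_Ico_self ht) (i + 1) mi
    rw [Nat.add_sub_cancel] at lt
    have e1 := h.profile t ht' (i + 1) mi (x (i + 1) t) ⟨by simpa using hle, le_rfl⟩
    have e0 := h.profile t ht' (i + 1) mi (x i t) ⟨by simp, hle⟩
    have D := ((((d1.pow 2).sub (d0.pow 2)).div_const 2).const_mul (s (i + 1))).add
      (dp.mul (d1.sub d0))
    refine D.congr_deriv ?_
    rw [e1, e0, faceVelocity_eq, Nat.add_sub_cancel, Pi.sub_apply]
    have : x (i + 1) t - x i t ≠ 0 := (sub_pos.2 lt).ne'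
    rw [div_mul_cancel₀ _ this]
    simp only [hz]
    norm_num
    ring
  have D := HasDerivAt.fun_sum hterm
  rw [Finset.sum_add_distrib, Finset.sum_range_sub (fun i => z i * v (x i t) t)] at D
  have z0 : z 0 = 0 := by simp [hz, cornerVelocity]
  have zN : z N = 0 := by simp [hz, cornerVelocity]
  rw [z0, zN, zero_mul, zero_mul, sub_zero, add_zero] at D
  refine D.congr_of_eventuallyEq ?_
  filter_upwards [Icc_mem_nhds ht.1 ht.2] with r hr
  exact h.integral_profile hr

end IsClosedPhase

/-! ## The energy of the error in a phase -/

/-- `‖u_x - u^m_x‖²` in `L²`, in terms of the corners and slopes of `u^m`. -/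
def slopeError (u : ℝ → ℝ → ℝ) (N : ℕ) (s : ℕ → ℝ) (x : ℕ → ℝ → ℝ) (t : ℝ) : ℝ :=
  ∑ i ∈ Finset.range N, ∫ y in x i t..x (i + 1) t, (spaceDeriv u y t - s (i + 1)) ^ 2

/-- The contribution of face `i + 1` to half the time derivative of `slopeError`. -/
def faceDissipation (W : ℝ → ℝ) (T : ℝ) (u : ℝ → ℝ → ℝ) (N : ℕ) (s : ℕ → ℝ) (x : ℕ → ℝ → ℝ)
    (t : ℝ) (i : ℕ) : ℝ :=
  -(∫ y in x i t..x (i + 1) t, spaceDeriv2 u y t * timeDeriv T u y t)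
    + (timeDeriv T u (x (i + 1) t) t * (reflSlope N s (i + 2) - reflSlope N s (i + 1))
      + timeDeriv T u (x i t) t * (reflSlope N s (i + 1) - reflSlope N s i)) / 2
    + faceVelocity W N s x t (i + 1)
      * ((∫ y in x i t..x (i + 1) t, spaceDeriv2 u y t) - halfJump N s (i + 1))

namespace IsClosedPhase

variable {W : ℝ → ℝ} {a b t₀ t₁ : ℝ} {v : ℝ → ℝ → ℝ} {N : ℕ} {s : ℕ → ℝ} {x p : ℕ → ℝ → ℝ}
  {T : ℝ} {u : ℝ → ℝ → ℝ}

/-- Expanding the square leaves one integral over a fixed interval and values of `u` at corners, so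
no integral over a moving interval has to be differentiated. -/
lemma slopeError_eq (h : IsClosedPhase W a b t₀ t₁ v N s x p) (hr : IsRegularOnRect T u)
    (hsub : Icc t₀ t₁ ⊆ Icc 0 T) {t : ℝ} (ht : t ∈ Icc t₀ t₁) :
    slopeError u N s x t = (∫ y in (0 : ℝ)..1, spaceDeriv u y t ^ 2)
      + ∑ i ∈ Finset.range N, (-2 * s (i + 1) * (u (x (i + 1) t) t - u (x i t) t)
        + s (i + 1) ^ 2 * (x (i + 1) t - x i t)) := by
  have cx := hr.cont_x.slice_rect (hsub ht)
  rw [h.integral_eq_sum ht (f := fun y => spaceDeriv u y t ^ 2) fun i hi =>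
    (cx.pow 2).intervalIntegrable_subset (h.corner_mem ht hi.le) (h.corner_mem ht hi),
    ← Finset.sum_add_distrib, slopeError]
  refine Finset.sum_congr rfl fun i hi => ?_
  have hiN := Finset.mem_range.1 hi
  have m0 := h.corner_mem ht hiN.le
  have m1 := h.corner_mem ht (show i + 1 ≤ N from hiN)
  have e : (fun y => (spaceDeriv u y t - s (i + 1)) ^ 2)
      = fun y => spaceDeriv u y t ^ 2 + (-2 * s (i + 1) * spaceDeriv u y t + s (i + 1) ^ 2) := by
    funext y
    ring
  have i1 := cx.intervalIntegrable_subset m0 m1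
  have i2 : IntervalIntegrable (fun y => spaceDeriv u y t ^ 2) MeasureTheory.volume
      (x i t) (x (i + 1) t) := (cx.pow 2).intervalIntegrable_subset m0 m1
  rw [e, intervalIntegral.integral_add i2
    ((i1.const_mul _).add intervalIntegrable_const),
    intervalIntegral.integral_add (i1.const_mul _) intervalIntegrable_const,
    intervalIntegral.integral_const_mul, intervalIntegral.integral_const,
    integral_eq_sub_of_subset_Icc (f := fun y => u y t) (hr.cont.slice_rect (hsub ht)) cx
      (fun x hx => hr.deriv_x x hx t (hsub ht)) m0.1 (h.corner_le_succ ht hiN) m1.2,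
    smul_eq_mul, mul_comm (x (i + 1) t - x i t)]

lemma continuousOn_slopeError (h : IsClosedPhase W a b t₀ t₁ v N s x p)
    (hr : IsRegularOnRect T u) (hsub : Icc t₀ t₁ ⊆ Icc 0 T) :
    ContinuousOn (slopeError u N s x) (Icc t₀ t₁) := by
  have cu : ∀ i ≤ N, ContinuousOn (fun t => u (x i t) t) (Icc t₀ t₁) := fun i hi =>
    hr.cont.comp (f := fun t => (x i t, t)) ((h.x_cont i hi).prodMk continuousOn_id)
      fun t ht => mk_mem_prod (h.corner_mem ht hi) (hsub ht)
  have c : ContinuousOn (fun t => (∫ y in (0 : ℝ)..1, spaceDeriv u y t ^ 2)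
      + ∑ i ∈ Finset.range N, (-2 * s (i + 1) * (u (x (i + 1) t) t - u (x i t) t)
        + s (i + 1) ^ 2 * (x (i + 1) t - x i t))) (Icc t₀ t₁) := by
    refine (ContinuousOn.mono (ContinuousOn.integral_rect
      (f := fun y t => spaceDeriv u y t ^ 2) (hr.cont_x.pow 2)) hsub).add
      (continuousOn_finsetSum _ fun i hi => ?_)
    have hiN := Finset.mem_range.1 hi
    exact (continuousOn_const.mul ((cu _ hiN).sub (cu _ hiN.le))).add
      (continuousOn_const.mul ((h.x_cont _ hiN).sub (h.x_cont _ hiN.le)))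
  exact c.congr fun t ht => h.slopeError_eq hr hsub ht

/-- Interior corners are handled by the chain rule. At `0` and `1` the corner is fixed and the time
derivative alone suffices, so no differentiability of `u` beyond the interval is required. -/
lemma hasDerivAt_comp_corner (h : IsClosedPhase W a b t₀ t₁ v N s x p)
    (hr : IsRegularOnRect T u) {t : ℝ} (ht : t ∈ Ioo t₀ t₁) (htT : t ∈ Ioo 0 T) {i : ℕ} (hi : i ≤ N) :
    HasDerivAt (fun r => u (x i r) r)
      (spaceDeriv u (x i t) t * cornerVelocity W N s x t i + timeDeriv T u (x i t) t) t := by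
  have hnhds : ∀ᶠ r in nhds t, r ∈ Icc t₀ t₁ := Icc_mem_nhds ht.1 ht.2
  have ht' := Ioo_subset_Icc_self ht
  have end_case : ∀ c ∈ Icc (0 : ℝ) 1, (∀ r ∈ Icc t₀ t₁, x i r = c) → (i = 0 ∨ i = N) →
      HasDerivAt (fun r => u (x i r) r)
      (spaceDeriv u (x i t) t * cornerVelocity W N s x t i + timeDeriv T u (x i t) t) t := by
    intro c hc hxc hi
    rw [cornerVelocity, if_pos hi, mul_zero, zero_add, hxc t ht']
    refine (hr.deriv_t c hc t htT).congr_of_eventuallyEq ?_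
    filter_upwards [hnhds] with r hr
    rw [hxc r hr]
  rcases eq_or_ne i 0 with rfl | h0
  · exact end_case 0 ⟨le_rfl, zero_le_one⟩ h.x_zero (Or.inl rfl)
  rcases eq_or_ne i N with rfl | hN
  · exact end_case 1 ⟨zero_le_one, le_rfl⟩ h.x_last (Or.inr rfl)
  have l1 := h.x_lt t (Ioo_subset_Ico_self ht) i ⟨by omega, hi⟩
  have l2 := h.x_lt t (Ioo_subset_Ico_self ht) (i + 1) ⟨by omega, by omega⟩
  rw [Nat.add_sub_cancel] at l2
  exact hr.deriv_curve (x i) _ t htT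
    ⟨(h.corner_mem ht' (show i - 1 ≤ N by omega)).1.trans_lt l1,
      l2.trans_le (h.corner_mem ht' (show i + 1 ≤ N by omega)).2⟩ (h.hasDerivAt_corner ht hi)

/-- The energy identity. -/
lemma hasDerivAt_slopeError (h : IsClosedPhase W a b t₀ t₁ v N s x p)
    (hu : IsNeumannSolution W a b T u) (hr : IsRegularOnRect T u)
    (hsub : Icc t₀ t₁ ⊆ Icc 0 T) {t : ℝ} (ht : t ∈ Ioo t₀ t₁) (htT : t ∈ Ioo 0 T) :
    HasDerivAt (slopeError u N s x)
      (2 * ∑ i ∈ Finset.range N, faceDissipation W T u N s x t i) t := by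
  have ht' := Ioo_subset_Icc_self ht
  set z := cornerVelocity W N s x t with hz
  set ux : ℕ → ℝ := fun i => spaceDeriv u (x i t) t with hux
  set ut : ℕ → ℝ := fun i => timeDeriv T u (x i t) t with hut
  set σ := reflSlope N s with hσ
  set V := faceVelocity W N s x t with hV
  set μ := cornerSlope N s with hμ
  have D1 : HasDerivAt (fun r => ∫ y in (0 : ℝ)..1, spaceDeriv u y r ^ 2)
      (∫ y in (0 : ℝ)..1, 2 * spaceDeriv u y t * mixedDeriv T u y t) t := by
    refine hasDerivAt_integral_rect (f := fun y r => spaceDeriv u y r ^ 2)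
      (f' := fun y r => 2 * spaceDeriv u y r * mixedDeriv T u y r) (hr.cont_x.pow 2)
      ((continuousOn_const.mul hr.cont_x).mul hr.cont_xt) ?_ htT
    intro y hy r hr'
    have := (hr.deriv_xt y hy r hr').pow 2
    exact this.congr_deriv (by norm_num)
  have D2 : HasDerivAt (fun r => ∑ i ∈ Finset.range N,
      (-2 * s (i + 1) * (u (x (i + 1) r) r - u (x i r) r)
        + s (i + 1) ^ 2 * (x (i + 1) r - x i r)))
      (∑ i ∈ Finset.range N, (-2 * s (i + 1) * ((ux (i + 1) * z (i + 1) + ut (i + 1))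
        - (ux i * z i + ut i)) + s (i + 1) ^ 2 * (z (i + 1) - z i))) t := by
    refine HasDerivAt.fun_sum fun i hi => ?_
    have hiN := Finset.mem_range.1 hi
    exact (((h.hasDerivAt_comp_corner hr ht htT (show i + 1 ≤ N from hiN)).sub
      (h.hasDerivAt_comp_corner hr ht htT hiN.le)).const_mul _).add
      (((h.hasDerivAt_corner ht (show i + 1 ≤ N from hiN)).sub
        (h.hasDerivAt_corner ht hiN.le)).const_mul _)
  have D : HasDerivAt (slopeError u N s x) _ t := (D1.add D2).congr_of_eventuallyEq (by
    filter_upwards [Icc_mem_nhds ht.1 ht.2] with r hr'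
    exact h.slopeError_eq hr hsub hr')
  refine D.congr_deriv ?_
  have cx := hr.cont_x.slice_rect (hsub ht')
  have cxx := hr.cont_xx.slice_rect (hsub ht')
  have ct := hr.cont_t.slice_rect (hsub ht')
  have cxt := hr.cont_xt.slice_rect (hsub ht')
  -- Integration by parts moves the space derivative off `u_t`.
  have parts : ∀ i < N, ∫ y in x i t..x (i + 1) t, 2 * spaceDeriv u y t * mixedDeriv T u y t
      = 2 * (ux (i + 1) * ut (i + 1) - ux i * ut i
        - ∫ y in x i t..x (i + 1) t, spaceDeriv2 u y t * timeDeriv T u y t) := by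
    intro i hiN
    have m0 := h.corner_mem ht' hiN.le
    have m1 := h.corner_mem ht' (show i + 1 ≤ N from hiN)
    have e := integral_eq_sub_of_subset_Icc
      (f := fun y => spaceDeriv u y t * timeDeriv T u y t)
      (f' := fun y => spaceDeriv2 u y t * timeDeriv T u y t
        + spaceDeriv u y t * mixedDeriv T u y t) (cx.mul ct) ((cxx.mul ct).add (cx.mul cxt))
      (fun x hx => (hr.deriv_xx x hx t (hsub ht')).mul (hr.deriv_tx x hx t (hsub ht')))
      m0.1 (h.corner_le_succ ht' hiN) m1.2
    have i1 : IntervalIntegrable (fun y => spaceDeriv2 u y t * timeDeriv T u y t)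
        MeasureTheory.volume (x i t) (x (i + 1) t) :=
      (cxx.mul ct).intervalIntegrable_subset m0 m1
    have i2 : IntervalIntegrable (fun y => spaceDeriv u y t * mixedDeriv T u y t)
        MeasureTheory.volume (x i t) (x (i + 1) t) :=
      (cx.mul cxt).intervalIntegrable_subset m0 m1
    rw [intervalIntegral.integral_add i1 i2] at e
    simp_rw [mul_assoc]
    rw [intervalIntegral.integral_const_mul]
    linarith
  have ends0 : σ 0 = a ∧ σ 1 = a ∧ μ 0 = a ∧ ux 0 = a ∧ z 0 = 0 := by
    refine ⟨?_, ?_, ?_, ?_, ?_⟩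
    · simp [hσ, reflSlope, h.first_slope]
    · rw [hσ, reflSlope_of_mem ⟨le_rfl, h.one_le⟩, h.first_slope]
    · rw [hμ, cornerSlope_zero h.one_le, h.first_slope]
    · simp only [hux]
      rw [h.x_zero t ht', hu.left_slope t (hsub ht')]
    · simp [hz, cornerVelocity]
  have endsN : σ N = b ∧ σ (N + 1) = b ∧ μ N = b ∧ ux N = b ∧ z N = 0 := by
    refine ⟨?_, ?_, ?_, ?_, ?_⟩
    · rw [hσ, reflSlope_of_mem ⟨h.one_le, le_rfl⟩, h.last_slope]
    · simp [hσ, reflSlope, h.last_slope]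
    · rw [hμ, cornerSlope_last h.one_le, h.last_slope]
    · simp only [hux]
      rw [h.x_last t ht', hu.right_slope t (hsub ht')]
    · simp [hz, cornerVelocity]
  -- The first factor is the law of motion of an interior corner. At `i = 0` there is no such law,
  -- but the second factor vanishes by the Neumann condition.
  have cornerRel : ∀ i < N, ((σ (i + 1) - σ i) * z i + (V (i + 1) - V i)) * (ux i - μ i) = 0 := by
    intro i hiN
    rcases Nat.eq_zero_or_pos i with rfl | h0
    · rw [ends0.2.2.1, ends0.2.2.2.1, sub_self, mul_zero]
    · have hne : s (i + 1) - s i ≠ 0 := sub_ne_zero.2 (h.slope_ne i ⟨h0, hiN⟩).symm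
      rw [hσ, reflSlope_of_mem ⟨by omega, hiN⟩, reflSlope_of_mem ⟨h0, hiN.le⟩, hz, cornerVelocity,
        if_neg (by omega)]
      field_simp
      ring
  have jump : ∀ i, halfJump N s (i + 1) = μ (i + 1) - μ i := fun i => (cornerSlope_sub N s i).symm
  have fxx : ∀ i < N, ∫ y in x i t..x (i + 1) t, spaceDeriv2 u y t = ux (i + 1) - ux i := by
    intro i hiN
    exact integral_eq_sub_of_subset_Icc (f := fun y => spaceDeriv u y t) cx cxx
      (fun x hx => hr.deriv_xx x hx t (hsub ht')) (h.corner_mem ht' hiN.le).1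
      (h.corner_le_succ ht' hiN) (h.corner_mem ht' (show i + 1 ≤ N from hiN)).2
  -- Summation by parts: twice the increments of `B` turn the summands of the dissipation into those
  -- of the derivative, modulo `cornerRel`. `B` vanishes at both ends, where `u_x`, the slopes and
  -- their averages agree and corners are at rest.
  set B : ℕ → ℝ := fun i => ux i * ut i - σ i * (ux i * z i + ut i) + σ i ^ 2 * z i / 2
    - ut i * (σ (i + 1) - σ i) / 2 - V i * (ux i - μ i) with hB
  have tel : ∑ i ∈ Finset.range N, (B (i + 1) - B i) = 0 := by
    rw [Finset.sum_range_sub B]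
    simp only [hB]
    rw [ends0.1, ends0.2.1, ends0.2.2.1, ends0.2.2.2.1, ends0.2.2.2.2, endsN.1, endsN.2.1,
      endsN.2.2.1, endsN.2.2.2.1, endsN.2.2.2.2]
    ring
  rw [h.integral_eq_sum ht' (f := fun y => 2 * spaceDeriv u y t * mixedDeriv T u y t)
    fun i hi => ((continuousOn_const.mul cx).mul cxt).intervalIntegrable_subset
      (h.corner_mem ht' hi.le) (h.corner_mem ht' hi), ← Finset.sum_add_distrib]
  rw [← add_zero (2 * ∑ i ∈ Finset.range N, faceDissipation W T u N s x t i),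
    show (0 : ℝ) = 2 * ∑ i ∈ Finset.range N, (B (i + 1) - B i) by rw [tel, mul_zero],
    ← mul_add, ← Finset.sum_add_distrib, Finset.mul_sum]
  refine Finset.sum_congr rfl fun i hi => ?_
  have hiN := Finset.mem_range.1 hi
  have hs : s (i + 1) = σ (i + 1) := (reflSlope_of_mem ⟨by omega, hiN⟩).symm
  have mu : μ i = (σ i + σ (i + 1)) / 2 := rfl
  have rel := cornerRel i hiN
  rw [parts i hiN, faceDissipation, fxx i hiN, jump, hs]
  simp only [hB]
  change _ = 2 * (-_ + (ut (i + 1) * (σ (i + 2) - σ (i + 1)) + ut i * (σ (i + 1) - σ i)) / 2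
    + V (i + 1) * _ + _)
  rw [mu] at rel ⊢
  linear_combination 2 * rel

end IsClosedPhase

/-! ## Estimate of the dissipation -/

/-- The pointwise inequality behind the estimate of the dissipation. -/
lemma dissipation_pointwise {g G q κ γ : ℝ} (hγ : 0 < γ) (hG : γ ≤ G) :
    -(q * (g * q)) + κ * (g * q) + G * κ * q - G * κ ^ 2 ≤ (g - G) ^ 2 * q ^ 2 / (4 * γ) := by
  have hG0 : 0 < G := hγ.trans_le hG
  rw [le_div_iff₀ (by positivity)]
  set e := (g - G) * q with he
  set w := q - κ with hw
  have e1 : -(q * (g * q)) + κ * (g * q) + G * κ * q - G * κ ^ 2 = -(G * w ^ 2) - e * w := by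
    rw [he, hw]
    ring
  have e2 : (g - G) ^ 2 * q ^ 2 = e ^ 2 := by
    rw [he]
    ring
  rw [e1, e2]
  -- `-e w ≤ e² / (4 γ) + γ w²`, and the last term is absorbed since `γ ≤ G`.
  nlinarith [sq_nonneg (e + 2 * γ * w), mul_nonneg (mul_nonneg (sub_nonneg.2 hG) hγ.le) (sq_nonneg w)]

lemma abs_mul_sub_integral_le {f f' : ℝ → ℝ} {α β c B : ℝ} (hf : ContinuousOn f (Icc 0 1))
    (hf' : ContinuousOn f' (Icc 0 1)) (hd : ∀ x ∈ Ioo (0 : ℝ) 1, HasDerivAt f (f' x) x)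
    (hB : ∀ x ∈ Icc (0 : ℝ) 1, |f' x| ≤ B) (hα : 0 ≤ α) (hαβ : α ≤ β) (hβ : β ≤ 1)
    (hc : c ∈ Icc α β) : |(β - α) * f c - ∫ y in α..β, f y| ≤ B * (β - α) * (β - α) := by
  have lip : ∀ y ∈ Icc (0 : ℝ) 1, ∀ z ∈ Icc (0 : ℝ) 1, y ≤ z → |f z - f y| ≤ B * |z - y| := by
    intro y hy z hz hyz
    rw [← integral_eq_sub_of_subset_Icc hf hf' hd hy.1 hyz hz.2, ← Real.norm_eq_abs]
    refine intervalIntegral.norm_integral_le_of_norm_le_const fun w hw => ?_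
    rw [uIoc_of_le hyz] at hw
    exact hB w ⟨hy.1.trans hw.1.le, hw.2.trans hz.2⟩
  have hB0 : 0 ≤ B := (abs_nonneg _).trans (hB 0 ⟨le_rfl, zero_le_one⟩)
  have lip' : ∀ y ∈ Icc α β, |f c - f y| ≤ B * (β - α) := by
    intro y hy
    have my : y ∈ Icc (0 : ℝ) 1 := ⟨hα.trans hy.1, hy.2.trans hβ⟩
    have mc : c ∈ Icc (0 : ℝ) 1 := ⟨hα.trans hc.1, hc.2.trans hβ⟩
    have d : |c - y| ≤ β - α := abs_le.2 ⟨by linarith [hc.1, hy.2], by linarith [hc.2, hy.1]⟩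
    refine le_trans ?_ (mul_le_mul_of_nonneg_left d hB0)
    rcases le_total y c with h | h
    · exact lip y my c mc h
    · rw [abs_sub_comm, abs_sub_comm c]
      exact lip c mc y my h
  have hi : IntervalIntegrable f MeasureTheory.volume α β :=
    hf.intervalIntegrable_subset ⟨hα, hαβ.trans hβ⟩ ⟨hα.trans hαβ, hβ⟩
  have e : (β - α) * f c - ∫ y in α..β, f y = ∫ y in α..β, (f c - f y) := by
    rw [intervalIntegral.integral_sub intervalIntegrable_const hi, intervalIntegral.integral_const,
      smul_eq_mul]
  rw [e, ← Real.norm_eq_abs]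
  refine (intervalIntegral.norm_integral_le_of_norm_le_const (C := B * (β - α))
    fun w hw => ?_).trans ?_
  · rw [uIoc_of_le hαβ] at hw
    exact lip' w (Ioc_subset_Icc_self hw)
  · rw [abs_of_nonneg (sub_nonneg.2 hαβ)]

/-- After the corner values of `u_t` are replaced by its average over the face, at a cost of `m B`
times the length, the dissipation is a single integral to which `dissipation_pointwise` applies with
`q = u_xx` and `g` the mobility at `u_x`. -/
lemma IsControlled.faceDissipation_le {W : ℝ → ℝ} (hW : ContDiff ℝ 3 W) {γ L ρ : ℝ}
    (hγ : 0 < γ) (hL : 0 ≤ L)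
    (hlip : ∀ p ∈ Icc (-ρ) ρ, ∀ q ∈ Icc (-ρ) ρ, |mobility W p - mobility W q| ≤ L * |p - q|)
    (hcoef : ∀ s ∈ Icc (-ρ) ρ, ∀ ξ ∈ Icc (-ρ) ρ, γ ≤ √(1 + s ^ 2) * deriv (deriv W) ξ ∧
        |√(1 + s ^ 2) * deriv (deriv W) ξ - mobility W s| ≤ L * |ξ - s|)
    {S : Set ℝ} {n : ℕ} {m R a b t₀ t₁ t₀' t₁' T Q B : ℝ} {u v : ℝ → ℝ → ℝ} {N : ℕ} {s : ℕ → ℝ}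
    {x p x' p' : ℕ → ℝ → ℝ} (hm : 0 ≤ m) (hρ : R + m ≤ ρ) (hc : IsControlled S n m R N s)
    (h' : IsNeumannPhase W S a b t₀' t₁' v N s x' p')
    (h : IsClosedPhase W a b t₀ t₁ v N s x p)
    (hu : IsNeumannSolution W a b T u) (hr : IsRegularOnRect T u)
    (hsub : Icc t₀ t₁ ⊆ Icc 0 T) {t : ℝ} (ht : t ∈ Ioo t₀ t₁)
    (hux : ∀ y ∈ Icc (0 : ℝ) 1, spaceDeriv u y t ∈ Icc (-ρ) ρ)
    (hQ : ∀ y ∈ Icc (0 : ℝ) 1, |spaceDeriv2 u y t| ≤ Q)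
    (hB : ∀ y ∈ Icc (0 : ℝ) 1, |mixedDeriv T u y t| ≤ B) {i : ℕ} (hi : i < N) :
    faceDissipation W T u N s x t i
      ≤ L ^ 2 * Q ^ 2 / (2 * γ) * (∫ y in x i t..x (i + 1) t, (spaceDeriv u y t - s (i + 1)) ^ 2)
        + (L ^ 2 * Q ^ 2 / (2 * γ) * m ^ 2 + m * B) * (x (i + 1) t - x i t) := by
  have ht' := Ioo_subset_Icc_self ht
  have mi : i + 1 ∈ Icc 1 N := ⟨by omega, hi⟩
  obtain ⟨ξ, hξ, eF⟩ := h'.exists_faceForce_eq hW hc.adjacent mi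
  have hξm := hξ m hm hc.jumps
  have hs := mem_Icc_of_abs_sub_le (hc.bound _ mi)
    (by simpa using hm : |s (i + 1) - s (i + 1)| ≤ m) hρ
  have hξρ := mem_Icc_of_abs_sub_le (hc.bound _ mi) hξm hρ
  obtain ⟨hGγ, hGL⟩ := hcoef _ hs ξ hξρ
  set G := √(1 + s (i + 1) ^ 2) * deriv (deriv W) ξ with hG
  have lt := h.x_lt t (Ioo_subset_Ico_self ht) (i + 1) mi
  rw [Nat.add_sub_cancel] at lt
  have m0 := h.corner_mem ht' hi.le
  have m1 := h.corner_mem ht' (show i + 1 ≤ N from hi)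
  set α := x i t with hα
  set β := x (i + 1) t with hβ
  have hl : 0 < β - α := sub_pos.2 lt
  set d := halfJump N s (i + 1) with hd
  -- The discrete curvature; the face velocity becomes `G κ`, in analogy with `u_t = g u_xx`.
  set κ := d / (β - α) with hκ
  have hκd : κ * (β - α) = d := div_mul_cancel₀ _ hl.ne'
  have hv : faceVelocity W N s x t (i + 1) = G * κ := by
    rw [faceVelocity_eq, eF, Nat.add_sub_cancel, hκ, mul_div_assoc]
  have cx := hr.cont_x.slice_rect (hsub ht')
  have cxx := hr.cont_xx.slice_rect (hsub ht')
  have ct := hr.cont_t.slice_rect (hsub ht')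
  have cxt := hr.cont_xt.slice_rect (hsub ht')
  set I := ∫ y in α..β, timeDeriv T u y t with hI
  -- the error made in replacing the corner values of `u_t` by the mean over the face
  have err : (timeDeriv T u β t * (reflSlope N s (i + 2) - reflSlope N s (i + 1))
      + timeDeriv T u α t * (reflSlope N s (i + 1) - reflSlope N s i)) / 2
      ≤ κ * I + m * B * (β - α) := by
    have r1 := hc.abs_reflSlope_sub_le hm h.one_le (show i + 1 ≤ N from hi)
    have r2 := hc.abs_reflSlope_sub_le hm h.one_le hi.le
    have a1 := abs_mul_sub_integral_le ct cxt (fun x hx => hr.deriv_tx x hx t (hsub ht')) hB m0.1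
      lt.le m1.2 (right_mem_Icc.2 lt.le)
    have a0 := abs_mul_sub_integral_le ct cxt (fun x hx => hr.deriv_tx x hx t (hsub ht')) hB m0.1
      lt.le m1.2 (left_mem_Icc.2 lt.le)
    set j1 := reflSlope N s (i + 2) - reflSlope N s (i + 1) with hj1
    set j0 := reflSlope N s (i + 1) - reflSlope N s i with hj0
    have hdj : d = (j1 + j0) / 2 := by
      rw [hd, halfJump, hj1, hj0, Nat.add_sub_cancel]
      ring
    have p1 : j1 * ((β - α) * timeDeriv T u β t - I) ≤ m * (B * (β - α) * (β - α)) :=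
      (le_abs_self _).trans (by
        rw [abs_mul]
        exact mul_le_mul r1 a1 (abs_nonneg _) hm)
    have p0 : j0 * ((β - α) * timeDeriv T u α t - I) ≤ m * (B * (β - α) * (β - α)) :=
      (le_abs_self _).trans (by
        rw [abs_mul]
        exact mul_le_mul r2 a0 (abs_nonneg _) hm)
    have : (timeDeriv T u β t * j1 + timeDeriv T u α t * j0) / 2 * (β - α)
        ≤ (κ * I + m * B * (β - α)) * (β - α) := by
      have e : κ * I * (β - α) = (j1 + j0) / 2 * I := by
        rw [← hdj, ← hκd]
        ring
      nlinarith
    exact le_of_mul_le_mul_right this hl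
  have cF : ContinuousOn (fun y => -(spaceDeriv2 u y t * timeDeriv T u y t)
      + κ * timeDeriv T u y t + G * κ * spaceDeriv2 u y t - G * κ ^ 2) (Icc 0 1) :=
    (((cxx.mul ct).neg.add (continuousOn_const.mul ct)).add (continuousOn_const.mul cxx)).sub
      continuousOn_const
  have i1 : IntervalIntegrable (fun y => -(spaceDeriv2 u y t * timeDeriv T u y t))
      MeasureTheory.volume α β := (cxx.mul ct).neg.intervalIntegrable_subset m0 m1
  have i2 := ct.intervalIntegrable_subset m0 m1
  have i3 := cxx.intervalIntegrable_subset m0 m1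
  have intF : ∫ y in α..β, (-(spaceDeriv2 u y t * timeDeriv T u y t)
      + κ * timeDeriv T u y t + G * κ * spaceDeriv2 u y t - G * κ ^ 2)
      = -(∫ y in α..β, spaceDeriv2 u y t * timeDeriv T u y t) + κ * I
        + G * κ * (∫ y in α..β, spaceDeriv2 u y t) - G * κ * d := by
    rw [intervalIntegral.integral_sub ((i1.add (i2.const_mul _)).add (i3.const_mul _))
      intervalIntegrable_const,
      intervalIntegral.integral_add (i1.add (i2.const_mul _)) (i3.const_mul _),
      intervalIntegral.integral_add i1 (i2.const_mul _), intervalIntegral.integral_neg,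
      intervalIntegral.integral_const_mul, intervalIntegral.integral_const_mul,
      intervalIntegral.integral_const, smul_eq_mul, ← hκd]
    ring
  set C := L ^ 2 * Q ^ 2 / (2 * γ) with hC
  have i4 : IntervalIntegrable (fun y => (spaceDeriv u y t - s (i + 1)) ^ 2)
      MeasureTheory.volume α β :=
    ((cx.sub continuousOn_const).pow 2).intervalIntegrable_subset m0 m1
  have bound : ∫ y in α..β, (-(spaceDeriv2 u y t * timeDeriv T u y t)
      + κ * timeDeriv T u y t + G * κ * spaceDeriv2 u y t - G * κ ^ 2)
      ≤ ∫ y in α..β, (C * (spaceDeriv u y t - s (i + 1)) ^ 2 + C * m ^ 2) := by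
    refine intervalIntegral.integral_mono_on lt.le (cF.intervalIntegrable_subset m0 m1)
      ((i4.const_mul _).add intervalIntegrable_const) fun y hy => ?_
    have hy' : y ∈ Icc (0 : ℝ) 1 := ⟨m0.1.trans hy.1, hy.2.trans m1.2⟩
    rw [hu.timeDeriv_eq hy' (hsub ht')]
    refine (dissipation_pointwise hγ hGγ).trans ?_
    set q := spaceDeriv2 u y t with hq
    set w := spaceDeriv u y t - s (i + 1) with hw
    -- Compare both sides with the mobility at the slope of the face; `ξ` is within `m` of that
    -- slope.
    have b1 : |mobility W (spaceDeriv u y t) - G| ≤ L * |w| + L * m := by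
      have c1 := hlip _ (hux y hy') _ hs
      have c2 := hGL.trans (mul_le_mul_of_nonneg_left hξm hL)
      rw [abs_le] at c1 c2 ⊢
      constructor <;> linarith
    have b2 : (mobility W (spaceDeriv u y t) - G) ^ 2 ≤ 2 * L ^ 2 * (w ^ 2 + m ^ 2) := by
      have c1 : (mobility W (spaceDeriv u y t) - G) ^ 2 ≤ (L * |w| + L * m) ^ 2 :=
        sq_le_sq' (neg_le_of_abs_le b1) (le_of_abs_le b1)
      have c2 : (L * |w| + L * m) ^ 2 ≤ 2 * L ^ 2 * (w ^ 2 + m ^ 2) := by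
        rw [← sq_abs w]
        nlinarith [sq_nonneg (L * |w| - L * m)]
      exact c1.trans c2
    have b3 : q ^ 2 ≤ Q ^ 2 := sq_le_sq' (neg_le_of_abs_le (hQ y hy')) (le_of_abs_le (hQ y hy'))
    have b4 : (mobility W (spaceDeriv u y t) - G) ^ 2 * q ^ 2
        ≤ 2 * L ^ 2 * (w ^ 2 + m ^ 2) * Q ^ 2 :=
      mul_le_mul b2 b3 (sq_nonneg _) (by positivity)
    rw [div_le_iff₀ (by positivity), hC]
    refine b4.trans (le_of_eq ?_)
    field_simp
    ring
  rw [intF, intervalIntegral.integral_add (i4.const_mul _) intervalIntegrable_const,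
    intervalIntegral.integral_const_mul, intervalIntegral.integral_const, smul_eq_mul] at bound
  rw [faceDissipation, hv]
  change -(∫ y in α..β, _) + (timeDeriv T u β t * _ + timeDeriv T u α t * _) / 2
    + G * κ * ((∫ y in α..β, _) - d) ≤ _
  linarith

/-! ## The `H¹` norm of the error -/

namespace IsClosedPhase

variable {W : ℝ → ℝ} {a b t₀ t₁ : ℝ} {v : ℝ → ℝ → ℝ} {N : ℕ} {s : ℕ → ℝ} {x p : ℕ → ℝ → ℝ}
  {T : ℝ} {u : ℝ → ℝ → ℝ}

lemma hasDerivAt_error (h : IsClosedPhase W a b t₀ t₁ v N s x p) (hr : IsRegularOnRect T u)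
    (hsub : Icc t₀ t₁ ⊆ Icc 0 T) {t : ℝ} (ht : t ∈ Icc t₀ t₁) {i : ℕ} (hi : i < N) {y : ℝ}
    (hy : y ∈ Ioo (x i t) (x (i + 1) t)) :
    HasDerivAt (fun y => u y t - v y t) (spaceDeriv u y t - s (i + 1)) y := by
  have hy1 : y ∈ Ioo (0 : ℝ) 1 := ⟨(h.corner_mem ht hi.le).1.trans_lt hy.1,
    hy.2.trans_le (h.corner_mem ht (show i + 1 ≤ N from hi)).2⟩
  have hv : HasDerivAt (fun y => v y t) (s (i + 1)) y := by
    have : HasDerivAt (fun y => s (i + 1) * y + p (i + 1) t) (s (i + 1)) y := by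
      simpa using ((hasDerivAt_id y).const_mul (s (i + 1))).add_const (p (i + 1) t)
    refine this.congr_of_eventuallyEq ?_
    filter_upwards [Ioo_mem_nhds hy.1 hy.2] with z hz
    exact h.profile t ht (i + 1) ⟨by omega, hi⟩ z (by simpa using Ioo_subset_Icc_self hz)
  exact (hr.deriv_x y hy1 t (hsub ht)).sub hv

lemma derivWithin_error (h : IsClosedPhase W a b t₀ t₁ v N s x p) (hr : IsRegularOnRect T u)
    (hsub : Icc t₀ t₁ ⊆ Icc 0 T) {t : ℝ} (ht : t ∈ Icc t₀ t₁) {i : ℕ} (hi : i < N) :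
    EqOn (fun y => spaceDeriv u y t - s (i + 1))
      (fun y => derivWithin (fun y => u y t - v y t) (Icc 0 1) y)
      (uIoo (x i t) (x (i + 1) t)) := by
  intro y hy
  rw [uIoo_of_le (h.corner_le_succ ht hi)] at hy
  have hy1 : y ∈ Icc (0 : ℝ) 1 := ⟨(h.corner_mem ht hi.le).1.trans hy.1.le,
    hy.2.le.trans (h.corner_mem ht (show i + 1 ≤ N from hi)).2⟩
  exact ((h.hasDerivAt_error hr hsub ht hi hy).hasDerivWithinAt.derivWithin
    (uniqueDiffOn_Icc one_pos y hy1)).symm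

lemma intervalIntegrable_of_faces (h : IsClosedPhase W a b t₀ t₁ v N s x p) {t : ℝ}
    (ht : t ∈ Icc t₀ t₁) {f : ℝ → ℝ}
    (hf : ∀ i < N, IntervalIntegrable f MeasureTheory.volume (x i t) (x (i + 1) t)) :
    IntervalIntegrable f MeasureTheory.volume 0 1 := by
  have := IntervalIntegrable.trans_iterate (a := fun i => x i t) hf
  rwa [h.x_zero t ht, h.x_last t ht] at this

lemma intervalIntegrable_derivWithin_error (h : IsClosedPhase W a b t₀ t₁ v N s x p)
    (hr : IsRegularOnRect T u) (hsub : Icc t₀ t₁ ⊆ Icc 0 T) {t : ℝ} (ht : t ∈ Icc t₀ t₁)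
    {i : ℕ} (hi : i < N) :
    IntervalIntegrable (derivWithin (fun y => u y t - v y t) (Icc 0 1)) MeasureTheory.volume
      (x i t) (x (i + 1) t) :=
  IntervalIntegrable.congr_uIoo
    (((hr.cont_x.slice_rect (hsub ht)).sub continuousOn_const).intervalIntegrable_subset
      (h.corner_mem ht hi.le) (h.corner_mem ht hi)) (h.derivWithin_error hr hsub ht hi)

lemma intervalIntegrable_derivWithin_error_sq (h : IsClosedPhase W a b t₀ t₁ v N s x p)
    (hr : IsRegularOnRect T u) (hsub : Icc t₀ t₁ ⊆ Icc 0 T) {t : ℝ} (ht : t ∈ Icc t₀ t₁)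
    {i : ℕ} (hi : i < N) :
    IntervalIntegrable (fun y => derivWithin (fun y => u y t - v y t) (Icc 0 1) y ^ 2)
      MeasureTheory.volume (x i t) (x (i + 1) t) :=
  IntervalIntegrable.congr_uIoo
    ((((hr.cont_x.slice_rect (hsub ht)).sub continuousOn_const).pow 2).intervalIntegrable_subset
      (h.corner_mem ht hi.le) (h.corner_mem ht hi))
    fun _ hy => congrArg (· ^ 2) (h.derivWithin_error hr hsub ht hi hy)

lemma integral_derivWithin_sq (h : IsClosedPhase W a b t₀ t₁ v N s x p)
    (hr : IsRegularOnRect T u) (hsub : Icc t₀ t₁ ⊆ Icc 0 T) {t : ℝ} (ht : t ∈ Icc t₀ t₁) :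
    ∫ y in (0 : ℝ)..1, derivWithin (fun y => u y t - v y t) (Icc 0 1) y ^ 2
      = slopeError u N s x t := by
  rw [h.integral_eq_sum ht fun i hi => h.intervalIntegrable_derivWithin_error_sq hr hsub ht hi,
    slopeError]
  refine Finset.sum_congr rfl fun i hi => ?_
  exact (intervalIntegral.integral_congr_uIoo fun y hy => congrArg (· ^ 2)
    (h.derivWithin_error hr hsub ht (Finset.mem_range.1 hi) hy)).symm

/-- The Poincaré inequality, whose exceptional set is the finite set of corners, contributes two
multiples of the slope error and the `H¹` norm itself a third. -/
lemma h1Norm_error_le (h : IsClosedPhase W a b t₀ t₁ v N s x p)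
    (hr : IsRegularOnRect T u) (hv : ContinuousOn (fun q : ℝ × ℝ => v q.1 q.2) (rect T))
    (hsub : Icc t₀ t₁ ⊆ Icc 0 T) {t : ℝ} (ht : t ∈ Icc t₀ t₁) :
    h1Norm (fun y => u y t - v y t)
      ≤ √(2 * (∫ y in (0 : ℝ)..1, (u y t - v y t)) ^ 2 + 3 * slopeError u N s x t) := by
  have key := integral_sq_le_of_deriv (f := fun y => u y t - v y t)
    (f' := derivWithin (fun y => u y t - v y t) (Icc 0 1))
    (Z := (fun i => x i t) '' Iic N) ((finite_Iic N).image _).countable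
    ((hr.cont.slice_rect (hsub ht)).sub (hv.slice_rect (hsub ht))) ?_
    (h.intervalIntegrable_of_faces ht fun i hi =>
      h.intervalIntegrable_derivWithin_error hr hsub ht hi)
    (h.intervalIntegrable_of_faces ht fun i hi =>
      h.intervalIntegrable_derivWithin_error_sq hr hsub ht hi)
  · rw [h.integral_derivWithin_sq hr hsub ht] at key
    rw [h1Norm, h.integral_derivWithin_sq hr hsub ht]
    exact Real.sqrt_le_sqrt (by linarith)
  · rintro y ⟨hy, hyZ⟩
    obtain ⟨j, j', hj1, hjj, hjN, l1, l2, l3, l4, hk⟩ := exists_adjacent_faces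
      (X := fun i => x i t) (h.x_le t ht) (h.x_zero t ht) (h.x_last t ht) hy
    have hne : y ≠ x j t := fun e => hyZ ⟨j, hjj.trans hjN, e.symm⟩
    have hy' : y ∈ Ioo (x (j - 1) t) (x (j - 1 + 1) t) := by
      rw [Nat.sub_add_cancel hj1]
      exact ⟨l1, lt_of_le_of_ne l2 hne⟩
    have hjN' : j - 1 < N := by omega
    have d := h.hasDerivAt_error hr hsub ht hjN' hy'
    have e := h.derivWithin_error hr hsub ht hjN'
      (show y ∈ uIoo (x (j - 1) t) (x (j - 1 + 1) t) by
        rw [uIoo_of_le (h.corner_le_succ ht hjN')]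
        exact hy')
    simp only at e
    rw [← e]
    exact d

end IsClosedPhase

/-! ### Grönwall estimates across the phases -/

/-- Grönwall's inequality as the monotonicity of one fixed function of time. In this form it chains
over the phases without any accumulation of constants. -/
lemma antitoneOn_of_deriv_le {E E' : ℝ → ℝ} {t₀ t₁ A B : ℝ} (hA : 0 < A)
    (hE : ContinuousOn E (Icc t₀ t₁)) (hd : ∀ t ∈ Ioo t₀ t₁, HasDerivAt E (E' t) t)
    (hle : ∀ t ∈ Ioo t₀ t₁, E' t ≤ A * E t + B) :
    AntitoneOn (fun t => (E t + B / A) * Real.exp (-(A * t))) (Icc t₀ t₁) := by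
  have D : ∀ t ∈ Ioo t₀ t₁, HasDerivAt (fun t => (E t + B / A) * Real.exp (-(A * t)))
      ((E' t - (A * E t + B)) * Real.exp (-(A * t))) t := by
    intro t ht
    have d1 : HasDerivAt (fun t => -(A * t)) (-A) t := by
      simpa using (hasDerivAt_id t).const_mul (-A)
    refine (((hd t ht).add_const (B / A)).mul d1.exp).congr_deriv ?_
    field_simp
    ring
  refine antitoneOn_of_deriv_nonpos (convex_Icc _ _) ?_ ?_ ?_
  · exact (hE.add continuousOn_const).mul (Continuous.continuousOn (by fun_prop))
  · intro t ht
    rw [interior_Icc] at ht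
    exact (D t ht).differentiableAt.differentiableWithinAt
  · intro t ht
    rw [interior_Icc] at ht
    rw [(D t ht).deriv]
    exact mul_nonpos_of_nonpos_of_nonneg (sub_nonpos.2 (hle t ht)) (Real.exp_pos _).le

namespace NeumannCrystallineFlow

variable {W : ℝ → ℝ} {S : Set ℝ} {a b T : ℝ}

lemma exists_phase (U : NeumannCrystallineFlow W S a b T) (hT : 0 < T) {t : ℝ}
    (ht : t ∈ Icc 0 T) : ∃ k < U.numPhases, t ∈ Icc (U.τ k) (U.τ (k + 1)) := by
  have hpos : U.numPhases ≠ 0 := fun e => by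
    have := U.τ_last
    rw [e, U.τ_zero] at this
    exact hT.ne this
  have key : ∀ n, t ≤ U.τ (n + 1) → ∃ k ≤ n, t ∈ Icc (U.τ k) (U.τ (k + 1)) := by
    intro n
    induction n with
    | zero => exact fun h => ⟨0, le_rfl, by rw [U.τ_zero]; exact ht.1, h⟩
    | succ n ih =>
      intro h
      rcases le_total t (U.τ (n + 1)) with h' | h'
      · obtain ⟨k, hk, hm⟩ := ih h'
        exact ⟨k, hk.trans n.le_succ, hm⟩
      · exact ⟨n + 1, le_rfl, h', h⟩
  obtain ⟨k, hk, hm⟩ := key (U.numPhases - 1) (by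
    rw [Nat.sub_add_cancel (Nat.one_le_iff_ne_zero.2 hpos), U.τ_last]
    exact ht.2)
  exact ⟨k, by omega, hm⟩

/-- Closed phase intervals share their end points, so monotonicity on each of them gives a bound by
the initial value. -/
lemma le_initial_of_antitoneOn (U : NeumannCrystallineFlow W S a b T) (hT : 0 < T) {φ : ℝ → ℝ}
    (hφ : ∀ k < U.numPhases, AntitoneOn φ (Icc (U.τ k) (U.τ (k + 1)))) {t : ℝ}
    (ht : t ∈ Icc 0 T) : φ t ≤ φ 0 := by
  have key : ∀ k ≤ U.numPhases, φ (U.τ k) ≤ φ 0 := by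
    intro k
    induction k with
    | zero => exact fun _ => by rw [U.τ_zero]
    | succ k ih =>
      intro hk
      have hlt := (U.τ_lt k hk).le
      exact (hφ k hk (left_mem_Icc.2 hlt) (right_mem_Icc.2 hlt) hlt).trans (ih (by omega))
  obtain ⟨k, hk, hm⟩ := U.exists_phase hT ht
  exact (hφ k hk (left_mem_Icc.2 (U.τ_lt k hk).le) hm hm.1).trans (key k hk.le)

lemma Icc_τ_subset (U : NeumannCrystallineFlow W S a b T) {k : ℕ} (hk : k < U.numPhases) :
    Icc (U.τ k) (U.τ (k + 1)) ⊆ Icc 0 T :=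
  Icc_subset_Icc (U.τ_nonneg hk.le) (U.τ_le hk)

lemma Ioo_τ_subset (U : NeumannCrystallineFlow W S a b T) {k : ℕ} (hk : k < U.numPhases) :
    Ioo (U.τ k) (U.τ (k + 1)) ⊆ Ioo 0 T :=
  Ioo_subset_Ioo (U.τ_nonneg hk.le) (U.τ_le hk)

lemma meanError_eq (U : NeumannCrystallineFlow W S a b T) {u : ℝ → ℝ → ℝ}
    (hu : ContinuousOn (fun q : ℝ × ℝ => u q.1 q.2) (rect T)) {t : ℝ} (ht : t ∈ Icc 0 T) :
    U.meanError u t = (∫ y in (0 : ℝ)..1, u y t) - ∫ y in (0 : ℝ)..1, U.toFun y t :=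
  intervalIntegral.integral_sub
    ((hu.slice_rect ht).intervalIntegrable_of_Icc zero_le_one)
    ((ContinuousOn.slice_rect (f := U.toFun) U.continuousOn ht).intervalIntegrable_of_Icc
      zero_le_one)

lemma continuousOn_meanError (U : NeumannCrystallineFlow W S a b T) {u : ℝ → ℝ → ℝ}
    (hu : ContinuousOn (fun q : ℝ × ℝ => u q.1 q.2) (rect T)) :
    ContinuousOn (U.meanError u) (Icc 0 T) :=
  ContinuousOn.integral_rect (f := fun y t => u y t - U.toFun y t) (hu.sub U.continuousOn)

/-- There is at least one face. The resulting bound on `m` makes all constants and slope ranges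
uniform. -/
lemma step_le (U : NeumannCrystallineFlow W S a b T) {m c : ℝ} (hm : 0 < m)
    (hpos : 0 < U.numPhases) (hN : (U.N 0 : ℝ) ≤ c / m) : m ≤ c := by
  have h1 : (1 : ℝ) ≤ U.N 0 := by exact_mod_cast (U.phase 0 hpos).one_le
  have := h1.trans hN
  rwa [le_div_iff₀ hm, one_mul] at this

/-- In each phase the mean of the error changes at a rate of order `m`. -/
lemma hasDerivAt_meanError (hW : ContDiff ℝ 3 W) (hconv : ∀ y : ℝ, 0 < deriv (deriv W) y)
    {γ L ρ : ℝ} (hL : 0 ≤ L)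
    (hlip : ∀ p ∈ Icc (-ρ) ρ, ∀ q ∈ Icc (-ρ) ρ, |mobility W p - mobility W q| ≤ L * |p - q|)
    (hcoef : ∀ s ∈ Icc (-ρ) ρ, ∀ ξ ∈ Icc (-ρ) ρ, γ ≤ √(1 + s ^ 2) * deriv (deriv W) ξ ∧
        |√(1 + s ^ 2) * deriv (deriv W) ξ - mobility W s| ≤ L * |ξ - s|)
    (hT : 0 < T) {u : ℝ → ℝ → ℝ} (hu : IsNeumannSolution W a b T u)
    (U : NeumannCrystallineFlow W S a b T) {m c R : ℝ} (hm : 0 < m) (hρ : R + m ≤ ρ)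
    (hJ : U.InitialJumpsLE m) (hN : (U.N 0 : ℝ) ≤ c / m)
    (hR : ∀ i ∈ Set.Icc 1 (U.N 0), |U.s 0 i| ≤ R) {k : ℕ} (hk : k < U.numPhases) {t : ℝ}
    (ht : t ∈ Ioo (U.τ k) (U.τ (k + 1))) :
    ∃ d : ℝ, HasDerivAt (U.meanError u) d t ∧ |d| ≤ 2 * L * c * m := by
  have hr := hu.contDiffOn.isRegularOnRect hT
  have hc := U.isControlled hW hconv hJ hR hk
  obtain ⟨x, p, h, -⟩ := U.exists_closedPhase hk
  have htT := U.Ioo_τ_subset hk ht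
  have D := (hu.hasDerivAt_integral hW hT htT).sub (h.hasDerivAt_integral ht)
  refine ⟨_, D.congr_of_eventuallyEq ?_, ?_⟩
  · filter_upwards [Icc_mem_nhds htT.1 htT.2] with r hr'
    exact U.meanError_eq hr.cont hr'
  · rw [abs_sub_comm]
    refine (hc.abs_sum_force_sub_le hW hL hlip hcoef hm.le hρ (U.phase k hk)).trans ?_
    have h1 : (U.N k : ℝ) ≤ c / m := le_trans (by exact_mod_cast hc.card_le) hN
    calc (U.N k : ℝ) * (2 * L * m ^ 2) ≤ c / m * (2 * L * m ^ 2) :=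
          mul_le_mul_of_nonneg_right h1 (by positivity)
      _ = 2 * L * c * m := by field_simp

/-- Both the mean error and its negative, minus `K t`, decrease in every phase. -/
lemma abs_meanError_le (hT : 0 < T) {u : ℝ → ℝ → ℝ}
    (hu : ContinuousOn (fun q : ℝ × ℝ => u q.1 q.2) (rect T))
    (U : NeumannCrystallineFlow W S a b T) {K : ℝ}
    (hd : ∀ k < U.numPhases, ∀ t ∈ Ioo (U.τ k) (U.τ (k + 1)),
      ∃ d : ℝ, HasDerivAt (U.meanError u) d t ∧ |d| ≤ K) {t : ℝ} (ht : t ∈ Icc 0 T) :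
    |U.meanError u t| ≤ |U.meanError u 0| + K * t := by
  have hc := U.continuousOn_meanError hu
  have hid : ∀ t, HasDerivAt (fun t : ℝ => K * t) K t := fun t => by
    simpa using (hasDerivAt_id t).const_mul K
  have h1 : U.meanError u t - K * t ≤ U.meanError u 0 - K * 0 := by
    refine U.le_initial_of_antitoneOn hT (φ := fun t => U.meanError u t - K * t) ?_ ht
    intro k hk
    refine antitoneOn_of_deriv_nonpos (convex_Icc _ _)
      ((hc.mono (U.Icc_τ_subset hk)).sub (Continuous.continuousOn (by fun_prop))) ?_ ?_
    · intro t ht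
      rw [interior_Icc] at ht
      obtain ⟨d, hd, -⟩ := hd k hk t ht
      exact (hd.sub (hid t)).differentiableAt.differentiableWithinAt
    · intro t ht
      rw [interior_Icc] at ht
      obtain ⟨d, hd, hK⟩ := hd k hk t ht
      have e : deriv (fun t => U.meanError u t - K * t) t = d - K := (hd.sub (hid t)).deriv
      rw [e]
      linarith [(abs_le.1 hK).2]
  have h2 : -U.meanError u t - K * t ≤ -U.meanError u 0 - K * 0 := by
    refine U.le_initial_of_antitoneOn hT (φ := fun t => -U.meanError u t - K * t) ?_ ht
    intro k hk
    refine antitoneOn_of_deriv_nonpos (convex_Icc _ _)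
      ((hc.mono (U.Icc_τ_subset hk)).neg.sub (Continuous.continuousOn (by fun_prop))) ?_ ?_
    · intro t ht
      rw [interior_Icc] at ht
      obtain ⟨d, hd, -⟩ := hd k hk t ht
      exact (hd.neg.sub (hid t)).differentiableAt.differentiableWithinAt
    · intro t ht
      rw [interior_Icc] at ht
      obtain ⟨d, hd, hK⟩ := hd k hk t ht
      have e : deriv (fun t => -U.meanError u t - K * t) t = -d - K := (hd.neg.sub (hid t)).deriv
      rw [e]
      linarith [(abs_le.1 hK).1]
  rw [abs_le]
  constructor
  · linarith [le_abs_self (U.meanError u 0), neg_abs_le (U.meanError u 0)]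
  · linarith [le_abs_self (U.meanError u 0), neg_abs_le (U.meanError u 0)]

/-- The error of the slopes in `L²`, squared. -/
def slopeErrorSq (U : NeumannCrystallineFlow W S a b T) (u : ℝ → ℝ → ℝ) (t : ℝ) : ℝ :=
  ∫ y in (0 : ℝ)..1, derivWithin (fun y => u y t - U.toFun y t) (Icc 0 1) y ^ 2

lemma slopeErrorSq_zero_le (hT : 0 < T) {u : ℝ → ℝ → ℝ} (hr : IsRegularOnRect T u)
    (U : NeumannCrystallineFlow W S a b T) {m : ℝ} (hS : U.InitialSlopesClose u m)
    (hpos : 0 < U.numPhases) : U.slopeErrorSq u 0 ≤ m ^ 2 := by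
  obtain ⟨x, p, h, hx⟩ := U.exists_closedPhase hpos
  have h01 := U.τ_lt 0 hpos
  have m0 : (0 : ℝ) ∈ Icc (U.τ 0) (U.τ (0 + 1)) := by
    rw [U.τ_zero] at h01 ⊢
    exact left_mem_Icc.2 h01.le
  have m0' : (0 : ℝ) ∈ Ico (U.τ 0) (U.τ (0 + 1)) := by
    rw [U.τ_zero] at h01 ⊢
    exact left_mem_Ico.2 h01
  rw [slopeErrorSq, h.integral_derivWithin_sq hr (U.Icc_τ_subset hpos) m0, slopeError]
  have cx := hr.cont_x.slice_rect (left_mem_Icc.2 hT.le)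
  have face : ∀ i ∈ Finset.range (U.N 0),
      ∫ y in x i 0..x (i + 1) 0, (spaceDeriv u y 0 - U.s 0 (i + 1)) ^ 2
        ≤ m ^ 2 * (x (i + 1) 0 - x i 0) := by
    intro i hi
    have hiN := Finset.mem_range.1 hi
    have hle := h.corner_le_succ m0 hiN
    refine (intervalIntegral.integral_mono_on_of_le_Ioo hle
      (((cx.sub continuousOn_const).pow 2).intervalIntegrable_subset (h.corner_mem m0 hiN.le)
        (h.corner_mem m0 hiN)) (intervalIntegrable_const (c := m ^ 2)) ?_).trans ?_
    · intro y hy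
      have := hS (i + 1) ⟨by omega, hiN⟩ y (by
        rw [Nat.add_sub_cancel, ← hx 0 m0', ← hx 0 m0']
        exact hy)
      rw [abs_sub_comm] at this
      exact sq_le_sq' (neg_le_of_abs_le this) (le_of_abs_le this)
    · rw [intervalIntegral.integral_const, smul_eq_mul, mul_comm]
  refine (Finset.sum_le_sum face).trans ?_
  rw [← Finset.mul_sum, Finset.sum_range_sub (fun i => x i 0), h.x_last 0 m0, h.x_zero 0 m0]
  simp

/-- Gronwall's estimate for the error of the slopes. -/
lemma slopeErrorSq_le (hW : ContDiff ℝ 3 W) (hconv : ∀ y : ℝ, 0 < deriv (deriv W) y)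
    {γ L ρ : ℝ} (hγ : 0 < γ) (hL : 0 ≤ L)
    (hlip : ∀ p ∈ Icc (-ρ) ρ, ∀ q ∈ Icc (-ρ) ρ, |mobility W p - mobility W q| ≤ L * |p - q|)
    (hcoef : ∀ s ∈ Icc (-ρ) ρ, ∀ ξ ∈ Icc (-ρ) ρ, γ ≤ √(1 + s ^ 2) * deriv (deriv W) ξ ∧
        |√(1 + s ^ 2) * deriv (deriv W) ξ - mobility W s| ≤ L * |ξ - s|)
    (hT : 0 < T) {u : ℝ → ℝ → ℝ} (hu : IsNeumannSolution W a b T u)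
    {Q B : ℝ} (hB0 : 0 ≤ B)
    (hux : ∀ y ∈ Icc (0 : ℝ) 1, ∀ t ∈ Icc 0 T, spaceDeriv u y t ∈ Icc (-ρ) ρ)
    (hQ : ∀ y ∈ Icc (0 : ℝ) 1, ∀ t ∈ Icc 0 T, |spaceDeriv2 u y t| ≤ Q)
    (hB : ∀ y ∈ Icc (0 : ℝ) 1, ∀ t ∈ Icc 0 T, |mixedDeriv T u y t| ≤ B)
    (U : NeumannCrystallineFlow W S a b T) {m R : ℝ} (hm : 0 < m) (hρ : R + m ≤ ρ)
    (hJ : U.InitialJumpsLE m) (hS : U.InitialSlopesClose u m)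
    (hR : ∀ i ∈ Set.Icc 1 (U.N 0), |U.s 0 i| ≤ R) {t : ℝ} (ht : t ∈ Icc 0 T) :
    U.slopeErrorSq u t ≤ (m ^ 2 + 2 * (L ^ 2 * Q ^ 2 / (2 * γ) * m ^ 2 + m * B))
      * Real.exp ((2 * (L ^ 2 * Q ^ 2 / (2 * γ)) + 1) * T) := by
  have hr := hu.contDiffOn.isRegularOnRect hT
  set C := L ^ 2 * Q ^ 2 / (2 * γ) with hC
  have hC0 : 0 ≤ C := by positivity
  -- The factor `2` is that of the energy identity; the summand `1` allows division by `A`, with `D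
  -- / A ≤ D`.
  set A := 2 * C + 1 with hA
  have hA1 : 1 ≤ A := by linarith
  set D := 2 * (C * m ^ 2 + m * B) with hD
  have hD0 : 0 ≤ D := by positivity
  obtain ⟨k₀, hk₀, -⟩ := U.exists_phase hT ht
  have key := U.le_initial_of_antitoneOn hT
    (φ := fun t => (U.slopeErrorSq u t + D / A) * Real.exp (-(A * t))) ?_ ht
  · have h0 := U.slopeErrorSq_zero_le hT hr hS (by omega)
    have hDA : D / A ≤ D := div_le_self hD0 hA1
    have hDA0 : 0 ≤ D / A := by positivity
    simp only [mul_zero, neg_zero, Real.exp_zero, mul_one] at key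
    have e : U.slopeErrorSq u t + D / A
        = (U.slopeErrorSq u t + D / A) * Real.exp (-(A * t)) * Real.exp (A * t) := by
      rw [mul_assoc, ← Real.exp_add, neg_add_cancel, Real.exp_zero, mul_one]
    calc U.slopeErrorSq u t ≤ U.slopeErrorSq u t + D / A := by linarith
      _ ≤ (U.slopeErrorSq u 0 + D / A) * Real.exp (A * t) := by
          rw [e]
          exact mul_le_mul_of_nonneg_right key (Real.exp_pos _).le
      _ ≤ (m ^ 2 + D) * Real.exp (A * t) :=
          mul_le_mul_of_nonneg_right (by linarith) (Real.exp_pos _).le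
      _ ≤ (m ^ 2 + D) * Real.exp (A * T) :=
          mul_le_mul_of_nonneg_left (Real.exp_le_exp.2
            (mul_le_mul_of_nonneg_left ht.2 (by linarith))) (by positivity)
  · intro k hk
    have hc := U.isControlled hW hconv hJ hR hk
    obtain ⟨x, p, h, -⟩ := U.exists_closedPhase hk
    have hsub := U.Icc_τ_subset hk
    have anti := antitoneOn_of_deriv_le (A := A) (B := D) (by linarith)
      (h.continuousOn_slopeError hr hsub)
      (fun t ht => h.hasDerivAt_slopeError hu hr hsub ht (U.Ioo_τ_subset hk ht)) ?_
    · refine anti.congr fun t ht => ?_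
      rw [slopeErrorSq, h.integral_derivWithin_sq hr hsub ht]
    · intro t ht
      have ht' := Ioo_subset_Icc_self ht
      have tT := hsub ht'
      have pos : 0 ≤ slopeError u (U.N k) (U.s k) x t :=
        Finset.sum_nonneg fun i hi => intervalIntegral.integral_nonneg
          (h.corner_le_succ ht' (Finset.mem_range.1 hi)) fun y _ => sq_nonneg _
      have hsum := Finset.sum_le_sum fun i hi =>
        hc.faceDissipation_le hW hγ hL hlip hcoef hm.le hρ (U.phase k hk) h hu hr hsub ht
          (fun y hy => hux y hy t tT) (fun y hy => hQ y hy t tT) (fun y hy => hB y hy t tT)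
          (Finset.mem_range.1 hi)
      -- The lengths of the faces add up to `1`, so the `O(m)` errors do not grow with the number of
      -- faces.
      rw [Finset.sum_add_distrib, ← Finset.mul_sum, ← Finset.mul_sum,
        Finset.sum_range_sub (fun i => x i t), h.x_last t ht', h.x_zero t ht'] at hsum
      change _ ≤ C * slopeError u (U.N k) (U.s k) x t + (C * m ^ 2 + m * B) * (1 - 0) at hsum
      rw [hA, hD]
      linarith

end NeumannCrystallineFlow

end

/-! ### Choice of the constants -/

theorem mainTheorem3 (W : ℝ → ℝ) (hW : ContDiff ℝ 3 W)
    (hconv : ∀ y : ℝ, 0 < deriv (deriv W) y) (c : ℝ) :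
    (∀ R : ℝ, ∃ C : ℝ, ∀ (T a b : ℝ) (u : ℝ → ℝ → ℝ), 0 < T → IsNeumannSolution W a b T u →
      ∀ (S : Set ℝ) (U : NeumannCrystallineFlow W S a b T) (m : ℝ), 0 < m →
        U.InitialJumpsLE m → (U.N 0 : ℝ) ≤ c / m →
        (∀ i ∈ Set.Icc 1 (U.N 0), |U.s 0 i| ≤ R) →
        ∀ k < U.numPhases, ∀ t ∈ Set.Ioo (U.τ k) (U.τ (k + 1)),
          ∃ d : ℝ, HasDerivAt (fun r => U.meanError u r) d t ∧ |d| ≤ C * m) ∧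
    (∀ (c₀ T a b : ℝ) (u : ℝ → ℝ → ℝ), 0 < T → IsNeumannSolution W a b T u →
      ∃ C : ℝ, ∀ (S : Set ℝ) (U : NeumannCrystallineFlow W S a b T) (m : ℝ), 0 < m →
        U.InitialSlopesClose u m → U.InitialJumpsLE m → (U.N 0 : ℝ) ≤ c / m →
        |U.meanError u 0| ≤ c₀ * m ^ (1 / 2 : ℝ) →
        ∀ t ∈ Set.Icc 0 T, h1Norm (fun y => u y t - U.toFun y t) ≤ C * m ^ (1 / 2 : ℝ)) := by
  constructor
  · intro R
    obtain ⟨γ, L, hγ, hL, hlip, hcoef⟩ := exists_coefficient_bounds hW hconv (R + c)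
    refine ⟨2 * L * c, fun T a b u hT hu S U m hm hJ hN hR k hk t ht => ?_⟩
    have hmc := U.step_le hm (by omega) hN
    exact U.hasDerivAt_meanError hW hconv hL hlip hcoef hT hu hm (by linarith) hJ hN hR hk ht
  · intro c₀ T a b u hT hu
    have hr := hu.contDiffOn.isRegularOnRect hT
    obtain ⟨R₀, hR₀, hux⟩ := hr.cont_x.exists_bound_rect
    obtain ⟨Q, -, hQ⟩ := hr.cont_xx.exists_bound_rect
    obtain ⟨B, hB0, hB⟩ := hr.cont_xt.exists_bound_rect
    -- The discrete slopes are within `m ≤ c` of values of `u_x`, and intermediate points such as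
    -- `ξ` are within another `m` of them.
    obtain ⟨γ, L, hγ, hL, hlip, hcoef⟩ := exists_coefficient_bounds hW hconv (R₀ + c + c)
    set A := L ^ 2 * Q ^ 2 / (2 * γ) with hA
    have hA0 : 0 ≤ A := by positivity
    set c₁ := c₀ + 2 * L * c * √c * T with hc₁
    set c₂ := (c + 2 * (A * c + B)) * Real.exp ((2 * A + 1) * T) with hc₂
    refine ⟨√(2 * c₁ ^ 2 + 3 * c₂), fun S U m hm hS hJ hN h0 t ht => ?_⟩
    rw [← Real.sqrt_eq_rpow] at h0 ⊢
    obtain ⟨k, hk, htk⟩ := U.exists_phase hT ht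
    have hpos : 0 < U.numPhases := by omega
    have hmc := U.step_le hm hpos hN
    have hc0 : 0 < c := hm.trans_le hmc
    -- The bound on the initial slopes, a hypothesis in the first part, here follows from their
    -- closeness to `u_x`.
    have hR : ∀ i ∈ Set.Icc 1 (U.N 0), |U.s 0 i| ≤ R₀ + c := by
      intro i hi
      have h00 : (0 : ℝ) ∈ Ico (U.τ 0) (U.τ (0 + 1)) := by
        have := U.τ_lt 0 hpos
        rw [U.τ_zero] at this ⊢
        exact left_mem_Ico.2 this
      have hp := U.phase 0 hpos
      have hle : ∀ i ∈ Icc 1 (U.N 0), U.x 0 (i - 1) 0 ≤ U.x 0 i 0 :=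
        fun i hi => (hp.x_lt 0 h00 i hi).le
      have m1 := corners_mem_Icc (x := fun i => U.x 0 i 0) hle (hp.x_zero 0 h00)
        (hp.x_last 0 h00) ((Nat.sub_le i 1).trans hi.2)
      have m2 := corners_mem_Icc (x := fun i => U.x 0 i 0) hle (hp.x_zero 0 h00)
        (hp.x_last 0 h00) hi.2
      obtain ⟨y, hy⟩ := nonempty_Ioo.2 (hp.x_lt 0 h00 i hi)
      have e1 := hS i hi y hy
      have e2 := hux y ⟨m1.1.trans hy.1.le, hy.2.le.trans m2.2⟩ 0 (left_mem_Icc.2 hT.le)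
      rw [abs_le] at e1 e2 ⊢
      constructor <;> linarith
    have hρ : R₀ + c + m ≤ R₀ + c + c := by linarith
    have hsq : √m * √m = m := Real.mul_self_sqrt hm.le
    have hsm : √m ≤ √c := Real.sqrt_le_sqrt hmc
    have hsm0 : 0 ≤ √m := Real.sqrt_nonneg _
    have mean : |U.meanError u t| ≤ c₁ * √m := by
      have e := U.abs_meanError_le hT hr.cont
        (fun k hk t ht => U.hasDerivAt_meanError hW hconv hL hlip hcoef hT hu hm hρ hJ hN hR hk ht)
        ht
      -- The drift of the mean is of order `m`; only `√m` is needed, and `m ≤ √c √m`.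
      have e1 : 2 * L * c * m * t ≤ 2 * L * c * (√c * √m) * T := by
        refine mul_le_mul ?_ ht.2 ht.1 (by positivity)
        refine mul_le_mul_of_nonneg_left ?_ (by positivity)
        calc m = √m * √m := hsq.symm
          _ ≤ √c * √m := mul_le_mul_of_nonneg_right hsm hsm0
      rw [hc₁]
      linarith
    have slope : U.slopeErrorSq u t ≤ c₂ * m := by
      have e := U.slopeErrorSq_le hW hconv hγ hL hlip hcoef hT hu hB0
        (fun y hy t ht => by
          have := abs_le.1 (hux y hy t ht)
          exact ⟨by linarith, by linarith⟩) hQ hB hm hρ hJ hS hR ht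
      refine e.trans ?_
      rw [hc₂, mul_right_comm]
      refine mul_le_mul_of_nonneg_right ?_ (Real.exp_pos _).le
      have e1 : m ^ 2 ≤ c * m := by nlinarith
      have e2 : A * m ^ 2 ≤ A * (c * m) := mul_le_mul_of_nonneg_left e1 hA0
      linarith
    obtain ⟨x, p, h, -⟩ := U.exists_closedPhase hk
    have hsub := U.Icc_τ_subset hk
    refine (h.h1Norm_error_le hr U.continuousOn hsub htk).trans ?_
    have eM : (∫ y in (0 : ℝ)..1, (u y t - U.toFun y t)) ^ 2 ≤ c₁ ^ 2 * m := by
      have : U.meanError u t ^ 2 ≤ (c₁ * √m) ^ 2 :=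
        sq_le_sq' (neg_le_of_abs_le mean) (le_of_abs_le mean)
      rwa [mul_pow, Real.sq_sqrt hm.le] at this
    rw [← h.integral_derivWithin_sq hr hsub htk]
    have eS : ∫ y in (0 : ℝ)..1, derivWithin (fun y => u y t - U.toFun y t) (Icc 0 1) y ^ 2
        ≤ c₂ * m := slope
    rw [← Real.sqrt_mul' _ hm.le]
    exact Real.sqrt_le_sqrt (by linarith)
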